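/- Let $n\ge 1$ and $g,g_0,g_1,g_0',g_1'\ge 0$, and put $\tilde g_0=g_0+g_0'$, $\tilde g_1=g_1+g_1'$. Let $\mathbb T=\mathbb R^n/2\pi\mathbb Z^n$ and let $W$ be the group of permutations and sign flips of the coordinates. For $\mu\in\mathbb Z^n$ put $e^\mu(x)=e^{i\sum_j\mu_jx_j}$ and $m_\mu=\sum_{\nu\in W\mu}e^\nu$. Let $\mathcal P^+=\{\lambda\in\mathbb Z^n:\lambda_1\ge\dots\ge\lambda_n\ge 0\}$, and write $\mu\le\lambda$ if $\sum_{j\le k}\mu_j\le\sum_{j\le k}\lambda_j$ for $k=1,\dots,n$. For a weight function $w$ on $\mathbb T$ put $\langle f,h\rangle_w=\int_{\mathbb T}f\,\overline h\,w\,dx$. With $(a;q)_\infty=\prod_{m\ge 0}(1-aq^m)$ and $(a_1,\dots,a_r;q)_\infty=\prod_s(a_s;q)_\infty$, define for $\beta>0$ $$\Delta_\beta(x)=\prod_{1\le j<k\le n}d_a(x_j+x_k)\,d_a(x_j-x_k)\prod_{1\le j\le n}d_b(x_j),\qquad d_c(z)=d_c^+(z)\,d_c^+(-z)\quad(c=a,b),$$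 $$d_a^+(z)=\frac{(e^{iz};e^{-\beta})_\infty}{(e^{-\beta g}e^{iz};e^{-\beta})_\infty},\qquad d_b^+(z)=\frac{(e^{2iz};e^{-\beta})_\infty}{(e^{-\beta g_0}e^{iz},\,-e^{-\beta g_1}e^{iz},\,e^{-\beta(g_0'+1/2)}e^{iz},\,-e^{-\beta(g_1'+1/2)}e^{iz};\,e^{-\beta})_\infty},$$ and $$\Delta_0(x)=\prod_{1\le j<k\le n}\Bigl|\sin\tfrac{x_j+x_k}{2}\,\sin\tfrac{x_j-x_k}{2}\Bigr|^{2g}\prod_{1\le j\le n}\Bigl|\sin\tfrac{x_j}{2}\Bigr|^{2\tilde g_0}\Bigl|\cos\tfrac{x_j}{2}\Bigr|^{2\tilde g_1}.$$ For $\lambda\in\mathcal P^+$ the Koornwinder polynomial $p_{\lambda,\beta}$ (for $\beta>0$) and the $BC_n$-type Jacobi polynomial $p_{\lambda,0}$ of Heckman and Opdam are defined, for $w=\Delta_\beta$ and $w=\Delta_0$ respectively, as the unique polynomial of the form $$p=m_\lambda+\sum_{\mu\in\mathcal P^+,\ \mu<\lambda}c_\mu\, m_\mu,\quad c_\mu\in\mathbb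 C,\qquad\text{with}\qquad \langle p,m_\mu\rangle_w=0\quad\text{for all }\mu\in\mathcal P^+,\ \mu<\lambda.$$ Then these polynomials are well defined (exactly one polynomial satisfies the conditions in each case), and: (i) for every $\lambda\in\mathcal P^+$, $\lim_{\beta\downarrow 0}p_{\lambda,\beta}=p_{\lambda,0}$, in the sense that each coefficient $c_\mu$ of $p_{\lambda,\beta}$ converges to the corresponding coefficient of $p_{\lambda,0}$, and that the convergence is uniform in $x$; (ii) $\langle p_{\lambda,0},p_{\lambda',0}\rangle_{\Delta_0}=0$ for all $\lambda,\lambda'\in\mathcal P^+$ with $\lambda\ne\lambda'$. -/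

import Mathlib

noncomputable section

namespace KoornwinderJacobi

/-- The `q`-shifted factorial `(a;q)_∞ = ∏_{m ≥ 0} (1 - a q^m)`. -/
def qShift (a : ℂ) (q : ℝ) : ℂ := ∏' m : ℕ, (1 - a * (q : ℂ) ^ m)

variable {n : ℕ}

/-- The character `e^μ(x) = exp (i ∑ μ_j x_j)` of the torus `ℝⁿ / 2πℤⁿ`. -/
def character (μ : Fin n → ℤ) (x : Fin n → ℝ) : ℂ :=
  Complex.exp (Complex.I * ∑ j, (μ j : ℂ) * (x j : ℂ))

/-- The orbit `W μ` of `μ ∈ ℤⁿ` under permutations and sign flips of the coordinates. -/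
def weylOrbit (μ : Fin n → ℤ) : Finset (Fin n → ℤ) :=
  (Finset.univ : Finset (Equiv.Perm (Fin n) × (Fin n → ℤˣ))).image
    fun w => fun j => (w.2 j : ℤ) * μ (w.1 j)

/-- The monomial symmetric function `m_μ = ∑_{ν ∈ W μ} e^ν`. -/
def monomialSym (μ : Fin n → ℤ) (x : Fin n → ℝ) : ℂ :=
  ∑ ν ∈ weylOrbit μ, character ν x

/-- Dominant weights: `μ_1 ≥ μ_2 ≥ ⋯ ≥ μ_n ≥ 0`. -/
def IsDominant (μ : Fin n → ℤ) : Prop := Antitone μ ∧ ∀ j, 0 ≤ μ j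

/-- The partial order on `ℤⁿ`: `μ ≤ ν` iff every partial sum `μ_1 + ⋯ + μ_k` is at most
`ν_1 + ⋯ + ν_k`. -/
def DomLE (μ ν : Fin n → ℤ) : Prop :=
  ∀ k : Fin n, ∑ j ∈ Finset.Iic k, μ j ≤ ∑ j ∈ Finset.Iic k, ν j

open Classical in
/-- The finite set of the dominant weights `μ < lam` (see `mem_below`; the box only serves to
exhibit finiteness). -/
def below (lam : Fin n → ℤ) : Finset (Fin n → ℤ) :=
  (Finset.Icc (fun _ => 0) (fun _ => ∑ j, lam j)).filter
    fun μ => IsDominant μ ∧ DomLE μ lam ∧ μ ≠ lam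

theorem mem_below (lam μ : Fin n → ℤ) :
    μ ∈ below lam ↔ IsDominant μ ∧ DomLE μ lam ∧ μ ≠ lam := by
  classical
  unfold below
  rw [Finset.mem_filter, Finset.mem_Icc]
  refine ⟨fun h => h.2, fun h => ⟨⟨h.1.2, fun i => ?_⟩, h⟩⟩
  obtain ⟨⟨-, hpos⟩, hle, -⟩ := h
  cases n with
  | zero => exact i.elim0
  | succ m =>
    have h1 := hle (Fin.last m)
    have h2 : Finset.Iic (Fin.last m) = Finset.univ := by
      ext j; simp [Fin.le_last]
    rw [h2] at h1
    exact (Finset.single_le_sum (fun j _ => hpos j) (Finset.mem_univ i)).trans h1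

/-- The polynomial `m_lam + ∑_{μ < lam} c_μ m_μ`, the sum being over dominant `μ`. -/
def monicSum (lam : Fin n → ℤ) (c : (Fin n → ℤ) → ℂ) (x : Fin n → ℝ) : ℂ :=
  monomialSym lam x + ∑ μ ∈ below lam, c μ * monomialSym μ x

/-- `⟨f, h⟩_w = ∫_𝕋 f \bar h w dx`, the torus being represented by the box `[-π, π]ⁿ`. -/
def innerW (w : (Fin n → ℝ) → ℂ) (f h : (Fin n → ℝ) → ℂ) : ℂ :=
  ∫ x in Set.Icc (fun _ : Fin n => -Real.pi) (fun _ => Real.pi),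
    f x * (starRingEnd ℂ) (h x) * w x

/-- The two conditions that define the polynomial with leading monomial `m_lam` attached to the
weight function `w`. -/
def IsMonicOrthogonal (w : (Fin n → ℝ) → ℂ) (lam : Fin n → ℤ) (p : (Fin n → ℝ) → ℂ) : Prop :=
  (∃ c : (Fin n → ℤ) → ℂ, p = monicSum lam c) ∧
    ∀ μ : Fin n → ℤ, IsDominant μ → DomLE μ lam → μ ≠ lam → innerW w p (monomialSym μ) = 0

open Classical in
/-- The polynomial that satisfies `IsMonicOrthogonal w lam` (and `0` if there is none). -/
def orthPoly (w : (Fin n → ℝ) → ℂ) (lam : Fin n → ℤ) : (Fin n → ℝ) → ℂ :=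
  if h : ∃ p, IsMonicOrthogonal w lam p then h.choose else 0

/-- The factor `d_a^+(z)`. -/
def daPlus (β g z : ℝ) : ℂ :=
  qShift (Complex.exp (Complex.I * z)) (Real.exp (-β)) /
    qShift (Real.exp (-β * g) * Complex.exp (Complex.I * z)) (Real.exp (-β))

/-- The factor `d_b^+(z)`. -/
def dbPlus (β g₀ g₁ g₀' g₁' z : ℝ) : ℂ :=
  qShift (Complex.exp (2 * Complex.I * z)) (Real.exp (-β)) /
    (qShift (Real.exp (-β * g₀) * Complex.exp (Complex.I * z)) (Real.exp (-β)) *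
      qShift (-(Real.exp (-β * g₁) * Complex.exp (Complex.I * z))) (Real.exp (-β)) *
      qShift (Real.exp (-β * (g₀' + 1 / 2)) * Complex.exp (Complex.I * z)) (Real.exp (-β)) *
      qShift (-(Real.exp (-β * (g₁' + 1 / 2)) * Complex.exp (Complex.I * z))) (Real.exp (-β)))

/-- `d_a(z) = d_a^+(z) d_a^+(-z)`. -/
def da (β g z : ℝ) : ℂ := daPlus β g z * daPlus β g (-z)

/-- `d_b(z) = d_b^+(z) d_b^+(-z)`. -/
def db (β g₀ g₁ g₀' g₁' z : ℝ) : ℂ := dbPlus β g₀ g₁ g₀' g₁' z * dbPlus β g₀ g₁ g₀' g₁' (-z)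

/-- Koornwinder's weight function `Δ_β` on the torus. -/
def koornwinderWeight (β g g₀ g₁ g₀' g₁' : ℝ) (x : Fin n → ℝ) : ℂ :=
  (∏ j : Fin n, ∏ k ∈ Finset.Ioi j, da β g (x j + x k) * da β g (x j - x k)) *
    ∏ j : Fin n, db β g₀ g₁ g₀' g₁' (x j)

/-- The weight function `Δ_0` of type `BC_n`, with parameters `g`, `G₀`, `G₁`. -/
def jacobiWeight (g G₀ G₁ : ℝ) (x : Fin n → ℝ) : ℂ :=
  (((∏ j : Fin n, ∏ k ∈ Finset.Ioi j,
        |Real.sin ((x j + x k) / 2) * Real.sin ((x j - x k) / 2)| ^ (2 * g)) *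
      ∏ j : Fin n, |Real.sin (x j / 2)| ^ (2 * G₀) * |Real.cos (x j / 2)| ^ (2 * G₁) : ℝ) : ℂ)

/-- Koornwinder's polynomial `p_{lam,β}`. -/
def koornwinderPoly (β g g₀ g₁ g₀' g₁' : ℝ) (lam : Fin n → ℤ) : (Fin n → ℝ) → ℂ :=
  orthPoly (koornwinderWeight β g g₀ g₁ g₀' g₁') lam

/-- The `BC_n`-type Jacobi polynomial `p_{lam,0}` of Heckman and Opdam. -/
def jacobiPoly (g G₀ G₁ : ℝ) (lam : Fin n → ℤ) : (Fin n → ℝ) → ℂ :=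
  orthPoly (jacobiWeight g G₀ G₁) lam

end KoornwinderJacobi

end

/-! Well-posedness and (i). For a bounded measurable weight that is positive almost everywhere,
`form` is positive definite on Laurent polynomials, since characters are linearly independent on the
torus. Hence the Gram matrix of the `m_μ` with `μ < lam` is invertible, and the defining conditions
form a linear system with exactly one solution, `solCoeff`. That solution depends continuously on
the inner products, so (i) reduces to convergence of integrals. Dominated convergence provides it
once the Koornwinder weights are bounded uniformly in `β` and converge almost everywhere to a
positive multiple of `Δ_0`; the constant does not affect the polynomials.

Both properties come from the quotient `(a;q)_∞ / (q^g a;q)_∞` with `q = e^{-β}` and `|a| ≤ 1`. For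
`0 ≤ g ≤ 1` the partial sums of the coefficients of its `q`-binomial series decrease and are
nonnegative, so the tail after degree `K` is at most the `K`-th partial sum on the whole closed
disc. This gives the bound `2` and convergence to `(1 - a)^g` away from `a = 1`
(`tendsto_diffSeries`, `qRatio_tendsto`); `qRatio_add_one` removes the restriction `g ≤ 1`. The
four-fold splitting `qShift_sq` writes `d_b^+` as a product of four such quotients.

Orthogonality (ii). The definition settles comparable weights only. For incomparable ones, take `D =
dunkl`, the derivative in the first coordinate plus divided differences and reflections for the
roots that involve this coordinate. It is symmetric for `Δ_0` (`form_dunkl`), by integration by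
parts against a regularised weight, and it preserves the span of the exponents in the convex hull of
the orbit of `lam`. Thus the symmetrised powers of `D` are symmetric and triangular on invariant
polynomials, and the Jacobi polynomials are their eigenvectors (`symmetrised_monicPoly`).

The eigenvalues must separate weights. On the extreme exponents, the coefficient of `D^k P` at `w
lam` depends only on the signed entry of `lam` that `w` puts in the first place, so `D` acts there
by a `2n × 2n` matrix, `leadingOp`. The eigenvalue is, up to a positive factor, the sum of the
entries of its `k`-th power applied to the all-ones vector. Solving the resolvent equation shows
that these numbers determine `F(z + g) / F(z)` for large `z`, with `F(z) = ∏ (z² - d_i²)` and `d =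
lam + ρ`; hence they determine `F`, then `d`, then `lam` (`resolvent_sum`, `separation`). -/

noncomputable section
namespace KoornwinderJacobi

/-! ### Signed permutations and the dominance order -/

section Combinatorics

variable {n : ℕ}

/-- A permutation together with a choice of signs. -/
abbrev SignedPerm (n : ℕ) := Equiv.Perm (Fin n) × (Fin n → ℤˣ)

/-- The action of a signed permutation on `ℤⁿ`. -/
def act (w : SignedPerm n) (μ : Fin n → ℤ) : Fin n → ℤ := fun j => (w.2 j : ℤ) * μ (w.1 j)

/-- The signed permutation with `act (comp v w) = act v ∘ act w`. -/
def SignedPerm.comp (v w : SignedPerm n) : SignedPerm n :=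
  (w.1 * v.1, fun j => v.2 j * w.2 (v.1 j))

/-- The inverse signed permutation. -/
def SignedPerm.symm (w : SignedPerm n) : SignedPerm n := (w.1⁻¹, fun j => w.2 (w.1⁻¹ j))

theorem units_mul_self_cast (u : ℤˣ) : (u : ℤ) * u = 1 := by
  rw [← Units.val_mul, Int.units_mul_self, Units.val_one]

theorem act_comp (v w : SignedPerm n) (μ : Fin n → ℤ) : act (v.comp w) μ = act v (act w μ) := by
  funext j; simp [act, SignedPerm.comp, mul_assoc]

theorem act_symm_act (w : SignedPerm n) (μ : Fin n → ℤ) : act w.symm (act w μ) = μ := by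
  funext j; simp [act, SignedPerm.symm, ← mul_assoc]

theorem SignedPerm.symm_symm (w : SignedPerm n) : w.symm.symm = w := by
  refine Prod.ext ?_ ?_
  · simp [SignedPerm.symm]
  · funext j; simp [SignedPerm.symm]

theorem act_act_symm (w : SignedPerm n) (μ : Fin n → ℤ) : act w (act w.symm μ) = μ := by
  have := act_symm_act w.symm μ
  rwa [SignedPerm.symm_symm] at this

theorem act_injective (w : SignedPerm n) : Function.Injective (act w) :=
  Function.LeftInverse.injective (act_symm_act w)

theorem act_one (μ : Fin n → ℤ) : act (1, 1) μ = μ := by funext j; simp [act]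

theorem act_sub (w : SignedPerm n) (μ ν : Fin n → ℤ) : act w (μ - ν) = act w μ - act w ν := by
  funext j; simp [act, mul_sub]

/-- Right translation on signed permutations. -/
def compRight (w : SignedPerm n) : SignedPerm n ≃ SignedPerm n where
  toFun v := v.comp w
  invFun v := v.comp w.symm
  left_inv v := by
    refine Prod.ext ?_ ?_
    · simp [SignedPerm.comp, SignedPerm.symm]
    · funext j; simp [SignedPerm.comp, SignedPerm.symm, mul_assoc]
  right_inv v := by
    refine Prod.ext ?_ ?_
    · simp [SignedPerm.comp, SignedPerm.symm]
    · funext j; simp [SignedPerm.comp, SignedPerm.symm, mul_assoc]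

theorem mem_weylOrbit {μ ν : Fin n → ℤ} : ν ∈ weylOrbit μ ↔ ∃ w, act w μ = ν := by
  simp only [weylOrbit, Finset.mem_image, Finset.mem_univ, true_and]
  exact Iff.rfl

theorem act_mem_weylOrbit {μ ν : Fin n → ℤ} (w : SignedPerm n) :
    act w ν ∈ weylOrbit μ ↔ ν ∈ weylOrbit μ := by
  rw [mem_weylOrbit, mem_weylOrbit]
  constructor
  · rintro ⟨v, h⟩
    exact ⟨w.symm.comp v, by rw [act_comp, h, act_symm_act]⟩
  · rintro ⟨v, h⟩
    exact ⟨w.comp v, by rw [act_comp, h]⟩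

theorem DomLE.refl (μ : Fin n → ℤ) : DomLE μ μ := fun _ => le_rfl

theorem DomLE.trans {μ ν ξ : Fin n → ℤ} (h : DomLE μ ν) (h' : DomLE ν ξ) : DomLE μ ξ :=
  fun k => (h k).trans (h' k)

theorem eq_of_partialSums_eq {μ ν : Fin n → ℤ}
    (h : ∀ k : Fin n, ∑ j ∈ Finset.Iic k, μ j = ∑ j ∈ Finset.Iic k, ν j) : μ = ν := by
  funext k
  induction k using WellFoundedLT.induction with
  | _ k ih =>
    have := h k
    rw [← Finset.Iio_insert, Finset.sum_insert (by simp), Finset.sum_insert (by simp),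
      Finset.sum_congr rfl fun j hj => ih j (Finset.mem_Iio.1 hj)] at this
    exact add_right_cancel this

theorem DomLE.antisymm {μ ν : Fin n → ℤ} (h : DomLE μ ν) (h' : DomLE ν μ) : μ = ν :=
  eq_of_partialSums_eq fun k => le_antisymm (h k) (h' k)

/-- `lam k` is a threshold: entries of `s` outside the initial segment are at most `lam k`, the
entries they replace are at least `lam k`, and there are equally many of both. -/
theorem sum_le_sum_Iic {lam : Fin n → ℤ} (hl : Antitone lam) (k : Fin n) (s : Finset (Fin n))
    (hs : s.card = (Finset.Iic k).card) : ∑ i ∈ s, lam i ≤ ∑ i ∈ Finset.Iic k, lam i := by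
  have hc : (s \ Finset.Iic k).card = (Finset.Iic k \ s).card := by
    rw [Finset.card_sdiff_comm hs]
  have h1 : ∑ i ∈ s \ Finset.Iic k, lam i ≤ (s \ Finset.Iic k).card • lam k :=
    Finset.sum_le_card_nsmul _ _ _ fun i hi => by
      simp only [Finset.mem_sdiff, Finset.mem_Iic, not_le] at hi
      exact hl hi.2.le
  have h2 : (Finset.Iic k \ s).card • lam k ≤ ∑ i ∈ Finset.Iic k \ s, lam i :=
    Finset.card_nsmul_le_sum _ _ _ fun i hi => by
      simp only [Finset.mem_sdiff, Finset.mem_Iic] at hi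
      exact hl hi.1
  have h3 := Finset.sum_sdiff_sub_sum_sdiff (f := lam) (s₁ := s) (s₂ := Finset.Iic k)
  rw [hc] at h1
  linarith

theorem IsDominant.act_domLE {lam : Fin n → ℤ} (hl : IsDominant lam) (w : SignedPerm n) :
    DomLE (act w lam) lam := by
  intro k
  calc ∑ j ∈ Finset.Iic k, act w lam j ≤ ∑ j ∈ Finset.Iic k, lam (w.1 j) := by
        refine Finset.sum_le_sum fun j _ => ?_
        have := hl.2 (w.1 j)
        rcases Int.units_eq_one_or (w.2 j) with h | h <;> simp [act, h]; linarith
    _ = ∑ i ∈ (Finset.Iic k).map w.1.toEmbedding, lam i := by simp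
    _ ≤ _ := sum_le_sum_Iic hl.1 k _ (Finset.card_map _)

theorem IsDominant.eq_of_act_eq {lam μ : Fin n → ℤ} (hl : IsDominant lam) (hm : IsDominant μ)
    {w : SignedPerm n} (h : act w μ = lam) : lam = μ := by
  refine DomLE.antisymm (h ▸ hm.act_domLE w) ?_
  have := hl.act_domLE w.symm
  rwa [← h, act_symm_act, h] at this

theorem exists_act_isDominant (ν : Fin n → ℤ) : ∃ w : SignedPerm n, IsDominant (act w ν) := by
  have hsgn : ∀ a : ℤ, ∃ u : ℤˣ, (u : ℤ) * a = |a| := fun a => by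
    rcases le_total 0 a with h | h
    · exact ⟨1, by simp [abs_of_nonneg h]⟩
    · exact ⟨-1, by simp [abs_of_nonpos h]⟩
  choose s hs using hsgn
  -- `Tuple.sort` is increasing, so sorting by `-|ν j|` arranges the absolute values in decreasing
  -- order.
  let f : Fin n → ℤ := fun j => -|ν j|
  refine ⟨(Tuple.sort f, fun j => s (ν (Tuple.sort f j))), fun i j hij => ?_, fun j => ?_⟩
  · have := Tuple.monotone_sort f hij
    simp only [Function.comp, f] at this
    simp only [act, hs]
    linarith
  · simp only [act, hs]; exact abs_nonneg _

/-- The vectors all of whose images under signed permutations are at most `lam`. -/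
def InHull (lam ν : Fin n → ℤ) : Prop := ∀ w, DomLE (act w ν) lam

theorem InHull.image {lam ν : Fin n → ℤ} (h : InHull lam ν) (w : SignedPerm n) :
    InHull lam (act w ν) := fun v => by rw [← act_comp]; exact h _

theorem InHull.domLE {lam ν : Fin n → ℤ} (h : InHull lam ν) : DomLE ν lam := by
  have := h (1, 1)
  rwa [act_one] at this

theorem IsDominant.inHull {lam μ : Fin n → ℤ} (hm : IsDominant μ) (h : DomLE μ lam) :
    InHull lam μ := fun w => (hm.act_domLE w).trans h

theorem IsDominant.inHull_self {lam : Fin n → ℤ} (hl : IsDominant lam) : InHull lam lam :=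
  hl.inHull (DomLE.refl _)

theorem InHull.mono {lam μ ν : Fin n → ℤ} (h : InHull μ ν) (hl : DomLE μ lam) :
    InHull lam ν := fun w => (h w).trans hl

theorem act_segment (w : SignedPerm n) {μ ν ξ : Fin n → ℤ} {a b : ℤ}
    (h : (a + b) • ν = a • μ + b • ξ) : (a + b) • act w ν = a • act w μ + b • act w ξ := by
  funext j
  have := congrFun h (w.1 j)
  simp only [Pi.smul_apply, Pi.add_apply, smul_eq_mul, act] at this ⊢
  linear_combination (w.2 j : ℤ) * this

theorem partialSum_segment {μ ν ξ : Fin n → ℤ} {a b : ℤ}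
    (h : (a + b) • ν = a • μ + b • ξ) (k : Fin n) :
    (a + b) * ∑ j ∈ Finset.Iic k, ν j
      = a * ∑ j ∈ Finset.Iic k, μ j + b * ∑ j ∈ Finset.Iic k, ξ j := by
  simp only [Finset.mul_sum, ← Finset.sum_add_distrib]
  refine Finset.sum_congr rfl fun j _ => ?_
  simpa using congrFun h j

/-- Convexity of the hull, with the convex combination multiplied by `a + b` to remain in `ℤ`. Root
strings are controlled by it. -/
theorem InHull.segment {lam μ ν ξ : Fin n → ℤ} {a b : ℤ} (ha : 0 ≤ a) (hb : 0 ≤ b)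
    (hab : 0 < a + b) (h : (a + b) • ν = a • μ + b • ξ) (hm : InHull lam μ)
    (hx : InHull lam ξ) : InHull lam ν := by
  intro w k
  have := partialSum_segment (act_segment w h) k
  nlinarith [hm w k, hx w k, mul_le_mul_of_nonneg_left (hm w k) ha,
    mul_le_mul_of_nonneg_left (hx w k) hb]

/-- Orbit points of `lam` are extreme points of the hull. After moving `ν` to `lam`, every partial
sum of both endpoints is at most that of `lam` while their weighted mean equals it, so both are
equal to it. -/
theorem InHull.extreme {lam μ ν ξ : Fin n → ℤ} {a b : ℤ} (ha : 0 < a) (hb : 0 < b)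
    (h : (a + b) • ν = a • μ + b • ξ) (hm : InHull lam μ)
    (hx : InHull lam ξ) (hν : ν ∈ weylOrbit lam) : μ = ξ := by
  obtain ⟨w, rfl⟩ := mem_weylOrbit.1 hν
  have h' := act_segment w.symm h
  rw [act_symm_act] at h'
  refine act_injective w.symm (eq_of_partialSums_eq fun k => ?_)
  have := partialSum_segment h' k
  have h1 := hm w.symm k
  have h2 := hx w.symm k
  have h3 := mul_nonneg ha.le (sub_nonneg.2 h1)
  have h4 := mul_nonneg hb.le (sub_nonneg.2 h2)
  have h5 : a * (∑ j ∈ Finset.Iic k, lam j - ∑ j ∈ Finset.Iic k, act w.symm μ j) = 0 := by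
    linarith
  have h6 : b * (∑ j ∈ Finset.Iic k, lam j - ∑ j ∈ Finset.Iic k, act w.symm ξ j) = 0 := by
    linarith
  have h7 := (mul_eq_zero.1 h5).resolve_left ha.ne'
  have h8 := (mul_eq_zero.1 h6).resolve_left hb.ne'
  linarith

end Combinatorics
end KoornwinderJacobi
end

noncomputable section
namespace KoornwinderJacobi

/-! ### Separation of the spectra -/

section Separation

/-- The hypotheses say `(z - leadingOp g κ d) u = T • 1`. The system is triangular enough for the
total of `u` to have a closed form, in which `d` occurs only through `∏ (z² - d_i²)` at `z` and at
`z + g`. -/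
theorem resolvent_sum (g κ z : ℝ) : ∀ (n : ℕ) (d up um : Fin n → ℝ) (T : ℝ),
    (∀ i, (z - d i) * up i = T + g * ∑ j, (if j < i then up j else 0)) →
    (∀ i, (z + d i) * um i = T + g * ∑ j, (if j = i then 0 else up j)
      + g * ∑ j, (if i < j then um j else 0) + κ * up i) →
    (2 * z + κ) * (∏ i, (z ^ 2 - d i ^ 2)) * T
      + g * (2 * z + g) * (∏ i, (z ^ 2 - d i ^ 2)) * (∑ i, up i + ∑ i, um i)
      = (2 * z + κ) * (∏ i, ((z + g) ^ 2 - d i ^ 2)) * T := by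
  intro n
  induction n with
  | zero => intro d up um T _ _; simp
  | succ n ih =>
    intro d up um T h1 h2
    have hp0 := h1 0
    have hm0 := h2 0
    simp only [Fin.sum_univ_succ, Fin.not_lt_zero, if_false, Finset.sum_const_zero,
      Fin.succ_ne_zero, Fin.succ_pos, if_true, lt_irrefl] at hp0 hm0
    -- `up 0` enters every other equation with coefficient `g` and `um 0` enters none, so dropping
    -- index `0` leaves the same system with `T` replaced by `T + g * up 0`.
    have := ih (fun i => d i.succ) (fun i => up i.succ) (fun i => um i.succ) (T + g * up 0)
      (fun i => by
        have := h1 i.succ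
        simp only [Fin.sum_univ_succ, Fin.succ_pos, if_true, Fin.succ_lt_succ_iff] at this
        rw [this]; ring)
      (fun i => by
        have := h2 i.succ
        simp only [Fin.sum_univ_succ, (Fin.succ_ne_zero i).symm, if_false, Fin.succ_lt_succ_iff,
          Fin.succ_inj, Fin.not_lt_zero] at this
        rw [this]; ring)
    simp only [Fin.sum_univ_succ, Fin.prod_univ_succ]
    set F := ∏ i : Fin n, (z ^ 2 - d i.succ ^ 2)
    set G := ∏ i : Fin n, ((z + g) ^ 2 - d i.succ ^ 2)
    set Sp := ∑ i : Fin n, up i.succ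
    set Sm := ∑ i : Fin n, um i.succ
    simp only [mul_zero, add_zero, zero_add] at hp0 hm0
    linear_combination (z - d 0) * (z + d 0 + g) * this
      + g * (2 * z + g) * F * (z - d 0) * hm0
      + (g * (2 * z + κ) * (z + d 0 + g) * G - g * (g - κ) * F * (z - d 0)) * hp0

theorem antitone_eq_of_prod_eq {n : ℕ} {d e : Fin n → ℝ} (hd : Antitone d) (he : Antitone e)
    (hd0 : ∀ i, 0 ≤ d i) (he0 : ∀ i, 0 ≤ e i)
    (h : Multiset.map (fun i => d i ^ 2) Finset.univ.val
      = Multiset.map (fun i => e i ^ 2) Finset.univ.val) : d = e := by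
  have h1 : Multiset.map d Finset.univ.val = Multiset.map e Finset.univ.val := by
    have := congrArg (Multiset.map Real.sqrt) h
    simpa [Multiset.map_map, Function.comp_def, Real.sqrt_sq (hd0 _), Real.sqrt_sq (he0 _)]
      using this
  have h2 : (List.ofFn d).Perm (List.ofFn e) := by
    rw [← Multiset.coe_eq_coe]
    have key : ∀ f : Fin n → ℝ, ((List.ofFn f : List ℝ) : Multiset ℝ)
        = Multiset.map f Finset.univ.val := fun f => by
      rw [List.ofFn_eq_map]; rfl
    rw [key, key, h1]
  have h3 : List.ofFn d = List.ofFn e :=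
    h2.eq_of_sortedGE (List.sortedGE_ofFn_iff.2 hd) (List.sortedGE_ofFn_iff.2 he)
  exact List.ofFn_injective h3

/-- The quotient of the two products is `g`-periodic for large `z` and tends to `1` at infinity, so
it is identically `1` there. -/
theorem prod_shift_unique {n : ℕ} {g : ℝ} (hg : 0 < g) (d e : Fin n → ℝ) {z₀ : ℝ}
    (h : ∀ z, z₀ ≤ z → (∏ i, ((z + g) ^ 2 - d i ^ 2)) * (∏ i, (z ^ 2 - e i ^ 2))
      = (∏ i, ((z + g) ^ 2 - e i ^ 2)) * (∏ i, (z ^ 2 - d i ^ 2))) :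
    ∃ z₁, ∀ z, z₁ ≤ z → ∏ i, (z ^ 2 - d i ^ 2) = ∏ i, (z ^ 2 - e i ^ 2) := by
  have pos : ∀ d : Fin n → ℝ, ∃ z₁, ∀ z, z₁ ≤ z → 0 < ∏ i, (z ^ 2 - d i ^ 2) := by
    intro d
    refine ⟨∑ i, |d i| + 1, fun z hz => Finset.prod_pos fun i _ => ?_⟩
    have h1 : |d i| ≤ ∑ i, |d i| :=
      Finset.single_le_sum (f := fun i => |d i|) (fun j _ => abs_nonneg _) (Finset.mem_univ i)
    have h2 : |d i| < z := by linarith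
    have := sq_lt_sq' (by linarith [abs_nonneg (d i)]) h2
    rw [sq_abs] at this
    linarith
  obtain ⟨z₁, h1⟩ := pos d
  obtain ⟨z₂, h2⟩ := pos e
  refine ⟨max z₀ (max z₁ z₂), fun z hz => ?_⟩
  have hz0 : z₀ ≤ z := (le_max_left _ _).trans hz
  have hz1 : z₁ ≤ z := (le_max_left _ _).trans ((le_max_right _ _).trans hz)
  have hz2 : z₂ ≤ z := (le_max_right _ _).trans ((le_max_right _ _).trans hz)
  set F : (Fin n → ℝ) → ℝ → ℝ := fun d z => ∏ i, (z ^ 2 - d i ^ 2) with hF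
  have step : ∀ k : ℕ, F d (z + k * g) / F e (z + k * g) = F d z / F e z := by
    intro k
    induction k with
    | zero => simp
    | succ k ih =>
      rw [← ih]
      have hk : 0 ≤ k * g := by positivity
      have := h (z + k * g) (by linarith)
      have e1 : z + ((k + 1 : ℕ) : ℝ) * g = z + k * g + g := by push_cast; ring
      rw [e1, div_eq_div_iff (h2 _ (by linarith)).ne' (h2 _ (by linarith)).ne']
      simpa [hF, mul_comm] using this
  have lim : Filter.Tendsto (fun x : ℝ => F d x / F e x) Filter.atTop (nhds 1) := by
    have : ∀ x, F d x / F e x = ∏ i, (x ^ 2 - d i ^ 2) / (x ^ 2 - e i ^ 2) := fun x => by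
      simp [hF, Finset.prod_div_distrib]
    simp only [this]
    rw [show (1 : ℝ) = ∏ i : Fin n, (1 : ℝ) by simp]
    refine tendsto_finsetProd _ fun i _ => ?_
    have hx : Filter.Tendsto (fun x : ℝ => x ^ 2) Filter.atTop Filter.atTop :=
      Filter.tendsto_pow_atTop two_ne_zero
    have hq : Filter.Tendsto (fun y : ℝ => 1 + (e i ^ 2 - d i ^ 2) / (y - e i ^ 2)) Filter.atTop
        (nhds (1 + 0)) :=
      tendsto_const_nhds.add (tendsto_const_nhds.div_atTop
        (Filter.tendsto_atTop_add_const_right _ (-(e i ^ 2)) Filter.tendsto_id))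
    rw [add_zero] at hq
    refine (hq.comp hx).congr' ?_
    filter_upwards [hx.eventually_gt_atTop (e i ^ 2)] with x hx
    have : x ^ 2 - e i ^ 2 ≠ 0 := by linarith
    simp only [Function.comp]
    field_simp
    ring
  have lim2 : Filter.Tendsto (fun k : ℕ => F d (z + k * g) / F e (z + k * g)) Filter.atTop
      (nhds 1) :=
    lim.comp (Filter.tendsto_atTop_add_const_left _ _
      (tendsto_natCast_atTop_atTop.atTop_mul_const hg))
  simp only [step] at lim2
  have := tendsto_nhds_unique tendsto_const_nhds lim2
  exact (div_eq_one_iff_eq (h2 _ hz2).ne').1 this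

theorem multiset_eq_of_prod_eq {n : ℕ} (d e : Fin n → ℝ) {z₁ : ℝ}
    (h : ∀ z, z₁ ≤ z → ∏ i, (z ^ 2 - d i ^ 2) = ∏ i, (z ^ 2 - e i ^ 2)) :
    Multiset.map (fun i => d i ^ 2) Finset.univ.val
      = Multiset.map (fun i => e i ^ 2) Finset.univ.val := by
  open Polynomial in
  have key : ((Multiset.map (fun i => d i ^ 2) Finset.univ.val).map fun a => X - C a).prod
      = ((Multiset.map (fun i => e i ^ 2) Finset.univ.val).map fun a => X - C a).prod := by
    refine Polynomial.eq_of_infinite_eval_eq _ _ (Set.infinite_of_not_bddAbove ?_)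
    rw [not_bddAbove_iff]
    intro M
    -- The products are polynomials in `y = z²`; the squares of large `z` provide an unbounded set
    -- of values of `y` on which they agree.
    refine ⟨(max z₁ (|M| + 1)) ^ 2, ?_, ?_⟩
    · have := h _ (le_max_left z₁ (|M| + 1))
      simp only [Set.mem_ofPred_eq, Multiset.map_map, Function.comp_def, Finset.prod_map_val,
        Polynomial.eval_prod, Polynomial.eval_sub, Polynomial.eval_X, Polynomial.eval_C]
      exact this
    · have h1 : |M| + 1 ≤ max z₁ (|M| + 1) := le_max_right _ _
      nlinarith [abs_nonneg M, le_abs_self M]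
  have := congrArg Polynomial.roots key
  simpa only [Polynomial.roots_multiset_prod_X_sub_C] using this

/-- The operator whose powers give the leading coefficients of the powers of the
Dunkl-type operator. -/
def leadingOp {n : ℕ} (g κ : ℝ) (d : Fin n → ℝ) :
    Module.End ℝ ((Fin n → ℝ) × (Fin n → ℝ)) where
  toFun u := (fun i => d i * u.1 i + g * ∑ j, (if j < i then u.1 j else 0),
    fun i => -(d i) * u.2 i + g * ∑ j, (if j = i then 0 else u.1 j)
      + g * ∑ j, (if i < j then u.2 j else 0) + κ * u.1 i)
  map_add' u v := by
    have e1 : ∀ (p : Prop) [Decidable p] (a b : ℝ),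
      (if p then a + b else 0) = (if p then a else 0) + (if p then b else 0) := by
        intros; split_ifs <;> simp
    have e2 : ∀ (p : Prop) [Decidable p] (a b : ℝ),
      (if p then 0 else a + b) = (if p then 0 else a) + (if p then 0 else b) := by
        intros; split_ifs <;> simp
    ext i <;> simp only [Prod.fst_add, Prod.snd_add, Pi.add_apply, e1, e2,
      Finset.sum_add_distrib] <;> ring
  map_smul' c u := by
    have e1 : ∀ (p : Prop) [Decidable p] (a : ℝ),
      (if p then c * a else 0) = c * (if p then a else 0) := by
        intros; split_ifs <;> simp
    have e2 : ∀ (p : Prop) [Decidable p] (a : ℝ),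
      (if p then 0 else c * a) = c * (if p then 0 else a) := by
        intros; split_ifs <;> simp
    ext i <;> simp only [Prod.smul_fst, Prod.smul_snd, Pi.smul_apply, smul_eq_mul, e1, e2,
      ← Finset.mul_sum, RingHom.id_apply] <;> ring

/-- The sum of all entries. -/
def entrySum (n : ℕ) : ((Fin n → ℝ) × (Fin n → ℝ)) →ₗ[ℝ] ℝ where
  toFun u := ∑ i, u.1 i + ∑ i, u.2 i
  map_add' u v := by simp [Finset.sum_add_distrib]; ring
  map_smul' c u := by simp [← Finset.mul_sum, mul_add]

theorem entrySum_aeval_eq {n : ℕ} {g κ : ℝ} {d e : Fin n → ℝ}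
    (h : ∀ k : ℕ, entrySum n (((leadingOp g κ d) ^ k) 1) = entrySum n (((leadingOp g κ e) ^ k) 1))
    (q : Polynomial ℝ) :
    entrySum n (Polynomial.aeval (leadingOp g κ d) q 1)
      = entrySum n (Polynomial.aeval (leadingOp g κ e) q 1) := by
  induction q using Polynomial.induction_on' with
  | add p q hp hq => simp only [map_add, LinearMap.add_apply, hp, hq]
  | monomial k a => 
    simp only [Polynomial.aeval_monomial, Module.algebraMap_end_eq_smul_id, smul_mul_assoc,
      LinearMap.smul_apply, map_smul]
    rw [show (LinearMap.id : Module.End ℝ ((Fin n → ℝ) × (Fin n → ℝ))) = 1 from rfl, one_mul,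
      one_mul, h k]

/-- At `g = 0` the shift argument is empty. The even powers then give the power sums of the `d_i²`:
the contributions of `κ` cancel on vectors with equal halves. -/
theorem leadingOp_sq_of_zero {n : ℕ} (κ : ℝ) (d : Fin n → ℝ) (k : ℕ) :
    ((leadingOp 0 κ d) ^ (2 * k)) 1 = (fun i => (d i ^ 2) ^ k, fun i => (d i ^ 2) ^ k) := by
  induction k with
  | zero => rfl
  | succ k ih =>
    rw [show 2 * (k + 1) = (2 * k) + 1 + 1 by ring, pow_succ', pow_succ',
      Module.End.mul_apply, Module.End.mul_apply, ih]
    ext i <;> simp [leadingOp] <;> ring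

/-- For `g > 0`, equal moments give equal entry sums for every polynomial in the two operators, in
particular for their resolvents, and `resolvent_sum` turns this into equality of the shifted
quotients. The case `g = 0` uses power sums. Antitone nonnegative vectors are recovered from the
multiset of their squares. -/
theorem separation {n : ℕ} {g κ : ℝ} (hg : 0 ≤ g) (hκ : 0 ≤ κ) {d e : Fin n → ℝ}
    (hd : Antitone d) (he : Antitone e) (hd0 : ∀ i, 0 ≤ d i) (he0 : ∀ i, 0 ≤ e i)
    (h : ∀ k : ℕ, entrySum n (((leadingOp g κ d) ^ k) 1)
      = entrySum n (((leadingOp g κ e) ^ k) 1)) : d = e := by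
  refine antitone_eq_of_prod_eq hd he hd0 he0 ?_
  rcases hg.eq_or_lt with rfl | hg
  · have h1 : ∀ q : Polynomial ℝ, ∑ i, q.eval (d i ^ 2) = ∑ i, q.eval (e i ^ 2) := by
      intro q
      induction q using Polynomial.induction_on' with
      | add p q hp hq => simp only [Polynomial.eval_add, Finset.sum_add_distrib, hp, hq]
      | monomial k a =>
        have := h (2 * k)
        rw [leadingOp_sq_of_zero, leadingOp_sq_of_zero] at this
        simp only [Polynomial.eval_monomial, ← Finset.mul_sum]
        congr 1
        simp only [entrySum, LinearMap.coe_mk, AddHom.coe_mk] at this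
        linarith
    classical
    ext a
    set s : Finset ℝ := insert a (Finset.univ.image (fun i => d i ^ 2)
      ∪ Finset.univ.image (fun i => e i ^ 2)) with hs
    -- A polynomial that is the indicator of `a` on all values involved; summing it counts the
    -- multiplicity of `a`.
    have h2 := h1 (Lagrange.interpolate s id (fun x => if a = x then 1 else 0))
    have ev : ∀ x ∈ s, (Lagrange.interpolate s id (fun x => if a = x then (1 : ℝ) else 0)).eval x
        = if a = x then 1 else 0 := fun x hx =>
      Lagrange.eval_interpolate_at_node _ (Set.injOn_id _) hx
    rw [Finset.sum_congr rfl fun i _ => ev _ (by simp [hs]),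
      Finset.sum_congr rfl fun i _ => ev (e i ^ 2) (by simp [hs])] at h2
    simp only [Multiset.count_map]
    simp only [Finset.sum_boole, Nat.cast_inj] at h2
    exact h2
  · suffices ∃ z₀, ∀ z, z₀ ≤ z → (∏ i, ((z + g) ^ 2 - d i ^ 2)) * (∏ i, (z ^ 2 - e i ^ 2))
        = (∏ i, ((z + g) ^ 2 - e i ^ 2)) * (∏ i, (z ^ 2 - d i ^ 2)) by
      obtain ⟨z₀, h0⟩ := this
      obtain ⟨z₁, h1⟩ := prod_shift_unique hg d e h0
      exact multiset_eq_of_prod_eq d e h1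
    set A := leadingOp g κ d
    set B := leadingOp g κ e
    -- By Cayley–Hamilton, `χ` annihilates both operators, so one polynomial `q` serves to invert `z
    -- - A` and `z - B` simultaneously.
    set χ := LinearMap.charpoly A * LinearMap.charpoly B with hχ
    have hm : χ.Monic := (LinearMap.charpoly_monic A).mul (LinearMap.charpoly_monic B)
    have hA : Polynomial.aeval A χ = 0 := by
      rw [hχ, map_mul, LinearMap.aeval_self_charpoly, zero_mul]
    have hB : Polynomial.aeval B χ = 0 := by
      rw [hχ, map_mul, LinearMap.aeval_self_charpoly, mul_zero]
    obtain ⟨M, hM⟩ := (Polynomial.rootSet_finite χ ℝ).bddAbove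
    refine ⟨max 1 (M + 1), fun z hz => ?_⟩
    have hz1 : 1 ≤ z := (le_max_left _ _).trans hz
    have hzM : M + 1 ≤ z := (le_max_right _ _).trans hz
    have hne : χ.eval z ≠ 0 := by
      intro h0
      have : z ∈ χ.rootSet ℝ := by
        rw [Polynomial.mem_rootSet]; exact ⟨hm.ne_zero, by simpa using h0⟩
      linarith [hM this]
    -- From `χ - χ(z) = (X - z) q` it follows that `(z - D) q(D) 1 = χ(z) 1` whenever `χ(D) = 0`: a
    -- resolvent without matrix inverses.
    obtain ⟨q, hq⟩ := Polynomial.X_sub_C_dvd_sub_C_eval (a := z) (p := χ)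
    have res : ∀ D : Module.End ℝ ((Fin n → ℝ) × (Fin n → ℝ)), Polynomial.aeval D χ = 0 →
        z • (Polynomial.aeval D q 1) - D (Polynomial.aeval D q 1) = (χ.eval z) • 1 := by
      intro D hD
      have := congrArg (fun p => Polynomial.aeval D p 1) hq
      simp only [map_sub, map_mul, hD, Polynomial.aeval_C, Polynomial.aeval_X,
        Module.algebraMap_end_eq_smul_id, LinearMap.sub_apply, Module.End.mul_apply,
        LinearMap.smul_apply, LinearMap.id_apply, zero_sub] at this
      rw [← neg_sub, ← this]; simp
    have formula : ∀ d : Fin n → ℝ, Polynomial.aeval (leadingOp g κ d) χ = 0 →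
        (2 * z + κ) * (∏ i, (z ^ 2 - d i ^ 2)) * χ.eval z
          + g * (2 * z + g) * (∏ i, (z ^ 2 - d i ^ 2))
            * entrySum n (Polynomial.aeval (leadingOp g κ d) q 1)
          = (2 * z + κ) * (∏ i, ((z + g) ^ 2 - d i ^ 2)) * χ.eval z := by
      intro d hD
      have hr := res _ hD
      set u := Polynomial.aeval (leadingOp g κ d) q 1
      refine resolvent_sum g κ z n d u.1 u.2 (χ.eval z) (fun i => ?_) (fun i => ?_)
      · have := congrFun (congrArg Prod.fst hr) i
        simp [leadingOp] at this
        linarith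
      · have := congrFun (congrArg Prod.snd hr) i
        simp [leadingOp] at this
        linarith
    have f1 := formula d hA
    have f2 := formula e hB
    have hS : entrySum n (Polynomial.aeval (leadingOp g κ d) q 1)
      = entrySum n (Polynomial.aeval (leadingOp g κ e) q 1) := entrySum_aeval_eq h q
    rw [hS] at f1
    have hc : (2 * z + κ) * χ.eval z ≠ 0 := mul_ne_zero (by linarith) hne
    refine mul_left_cancel₀ hc ?_
    linear_combination (∏ i, (z ^ 2 - d i ^ 2)) * f2 - (∏ i, (z ^ 2 - e i ^ 2)) * f1

end Separation
end KoornwinderJacobi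
end

noncomputable section
namespace KoornwinderJacobi
open Filter Topology MeasureTheory

/-! ### Laurent polynomials and weighted inner products -/

section Characters

variable {n : ℕ}

theorem character_zero (x : Fin n → ℝ) : character 0 x = 1 := by simp [character]

theorem character_add (μ ν : Fin n → ℤ) (x : Fin n → ℝ) :
    character (μ + ν) x = character μ x * character ν x := by
  rw [character, character, character, ← Complex.exp_add, ← mul_add, ← Finset.sum_add_distrib]
  congr 2
  exact Finset.sum_congr rfl fun j _ => by push_cast [Pi.add_apply]; ring

theorem character_neg (μ : Fin n → ℤ) (x : Fin n → ℝ) :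
    character (-μ) x = (character μ x)⁻¹ := by
  rw [character, character, ← Complex.exp_neg, ← mul_neg, ← Finset.sum_neg_distrib]
  congr 2
  exact Finset.sum_congr rfl fun j _ => by push_cast [Pi.neg_apply]; ring

theorem character_ne_zero (μ : Fin n → ℤ) (x : Fin n → ℝ) : character μ x ≠ 0 :=
  Complex.exp_ne_zero _

theorem character_eq_exp_ofReal (μ : Fin n → ℤ) (x : Fin n → ℝ) :
    character μ x = Complex.exp ((∑ j, (μ j : ℝ) * x j : ℝ) * Complex.I) := by
  rw [character, mul_comm]; push_cast; rfl

theorem norm_character (μ : Fin n → ℤ) (x : Fin n → ℝ) : ‖character μ x‖ = 1 := by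
  rw [character_eq_exp_ofReal, Complex.norm_exp_ofReal_mul_I]

theorem conj_character (μ : Fin n → ℤ) (x : Fin n → ℝ) :
    (starRingEnd ℂ) (character μ x) = character (-μ) x := by
  rw [character_neg, Complex.inv_eq_conj (norm_character μ x)]

theorem continuous_character (μ : Fin n → ℤ) : Continuous (character μ) := by
  unfold character; fun_prop

/-- The cube `[-π, π]ⁿ`. -/
def cube (n : ℕ) : Set (Fin n → ℝ) := Set.Icc (fun _ => -Real.pi) (fun _ => Real.pi)

theorem restrict_cube : (volume.restrict (cube n) : Measure (Fin n → ℝ))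
    = Measure.pi fun _ => (volume.restrict (Set.Icc (-Real.pi) Real.pi) : Measure ℝ) := by
  rw [cube, ← Set.pi_univ_Icc, volume_pi, Measure.restrict_pi_pi]

theorem integral_character {μ : Fin n → ℤ} (hμ : μ ≠ 0) :
    ∫ x in cube n, character μ x = 0 := by
  have h1 : ∀ x : Fin n → ℝ, character μ x = ∏ j, Complex.exp (Complex.I * μ j * x j) := fun x => by
    rw [character, ← Complex.exp_sum, Finset.mul_sum]
    congr 1
    exact Finset.sum_congr rfl fun j _ => by ring
  simp only [h1]
  rw [restrict_cube, integral_fintype_prod_eq_prod (f := fun j (t : ℝ) =>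
    Complex.exp (Complex.I * μ j * t))]
  obtain ⟨j, hj⟩ := Function.ne_iff.1 hμ
  refine Finset.prod_eq_zero (Finset.mem_univ j) ?_
  have hj' : Complex.I * (μ j : ℂ) ≠ 0 :=
    mul_ne_zero Complex.I_ne_zero (by exact_mod_cast hj)
  rw [integral_Icc_eq_integral_Ioc, ← intervalIntegral.integral_of_le (by linarith [Real.pi_pos]),
    integral_exp_mul_complex hj']
  have : Complex.exp (Complex.I * μ j * (Real.pi : ℝ))
      = Complex.exp (Complex.I * μ j * ((-Real.pi : ℝ) : ℂ)) := by
    rw [Complex.exp_eq_exp_iff_exists_int]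
    exact ⟨μ j, by push_cast; ring⟩
  rw [this, sub_self, zero_div]

theorem integral_character_zero_ne : ∫ x in cube n, character (0 : Fin n → ℤ) x ≠ 0 := by
  simp only [character_zero]
  rw [integral_const, Complex.real_smul, mul_one, Complex.ofReal_ne_zero, measureReal_restrict_apply_univ]
  rw [cube, Measure.real, Real.volume_Icc_pi, ENNReal.toReal_prod]
  refine Finset.prod_ne_zero_iff.2 fun i _ => ?_
  rw [ENNReal.toReal_ofReal (by linarith [Real.pi_pos])]
  linarith [Real.pi_pos]

/-- Laurent polynomials in `n` variables. -/
abbrev LPoly (n : ℕ) := (Fin n → ℤ) →₀ ℂ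

/-- The function on the torus given by a Laurent polynomial. -/
def ev : LPoly n →ₗ[ℂ] ((Fin n → ℝ) → ℂ) := Finsupp.linearCombination ℂ character

theorem ev_single (μ : Fin n → ℤ) (c : ℂ) (x : Fin n → ℝ) :
    ev (Finsupp.single μ c) x = c * character μ x := by
  simp [ev]

theorem ev_apply (f : LPoly n) (x : Fin n → ℝ) :
    ev f x = ∑ μ ∈ f.support, f μ * character μ x := by
  simp [ev, Finsupp.linearCombination_apply, Finsupp.sum]

theorem continuous_ev (f : LPoly n) : Continuous (ev f) := by
  have : ev f = fun x => ∑ μ ∈ f.support, f μ * character μ x := funext (ev_apply f)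
  rw [this]
  exact continuous_finsetSum _ fun μ _ => continuous_const.mul (continuous_character μ)

theorem integral_ev_mul_conj (f : LPoly n) (ν : Fin n → ℤ) :
    ∫ x in cube n, ev f x * (starRingEnd ℂ) (character ν x)
      = f ν * ∫ x in cube n, character (0 : Fin n → ℤ) x := by
  have hi : ∀ μ : Fin n → ℤ, Integrable (fun x => character μ x) (volume.restrict (cube n)) :=
    fun μ => (continuous_character μ).integrableOn_Icc
  have h : ∀ x, ev f x * (starRingEnd ℂ) (character ν x)
      = ∑ μ ∈ f.support, f μ * character (μ - ν) x := fun x => by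
    rw [ev_apply, Finset.sum_mul]
    refine Finset.sum_congr rfl fun μ _ => ?_
    rw [conj_character, sub_eq_add_neg, character_add, mul_assoc]
  simp only [h]
  rw [integral_finsetSum _ fun μ _ => (hi _).const_mul _]
  simp only [integral_const_mul]
  by_cases hν : ν ∈ f.support
  · rw [Finset.sum_eq_single_of_mem ν hν, sub_self]
    intro μ _ hμ
    rw [integral_character (sub_ne_zero.2 hμ), mul_zero]
  · rw [Finsupp.notMem_support_iff.1 hν, zero_mul]
    refine Finset.sum_eq_zero fun μ hμ => ?_
    rw [integral_character (sub_ne_zero.2 fun h => hν (by rwa [← h])), mul_zero]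

/-- Each coefficient is a Fourier coefficient of the function, up to a nonzero constant. -/
theorem eq_zero_of_ev_ae_eq_zero {f : LPoly n}
    (h : ∀ᵐ x ∂(volume.restrict (cube n)), ev f x = 0) : f = 0 := by
  ext ν
  have h1 := integral_ev_mul_conj f ν
  rw [integral_eq_zero_of_ae (h.mono fun x hx => by simp [hx])] at h1
  exact (mul_eq_zero.1 h1.symm).resolve_right integral_character_zero_ne

end Characters

/-! ### Positive definiteness of the weighted inner products -/

section InnerProduct

variable {n : ℕ}

/-- Bounded measurable weights that are positive almost everywhere. -/
structure GoodWeight (v : (Fin n → ℝ) → ℝ) : Prop where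
  measurable : Measurable v
  nonneg : ∀ x, 0 ≤ v x
  bounded : ∃ C, ∀ x, v x ≤ C
  pos : ∀ᵐ x, 0 < v x

/-- The inner product of Laurent polynomials with respect to a real weight. -/
def form (v : (Fin n → ℝ) → ℝ) (f h : LPoly n) : ℂ :=
  innerW (fun x => (v x : ℂ)) (ev f) (ev h)

variable {v : (Fin n → ℝ) → ℝ}

theorem GoodWeight.integrable_mul (hv : GoodWeight v) {F : (Fin n → ℝ) → ℂ} (hF : Continuous F) :
    Integrable (fun x => F x * v x) (volume.restrict (cube n)) := by
  obtain ⟨C, hC⟩ := hv.bounded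
  refine Integrable.mul_bdd (c := C) (hF.integrableOn_Icc) ?_ (Eventually.of_forall fun x => ?_)
  · exact (Complex.measurable_ofReal.comp hv.measurable).aestronglyMeasurable
  · rw [Complex.norm_real, Real.norm_of_nonneg (hv.nonneg x)]; exact hC x

theorem GoodWeight.integrable (hv : GoodWeight v) (f h : LPoly n) :
    Integrable (fun x => ev f x * (starRingEnd ℂ) (ev h x) * v x) (volume.restrict (cube n)) :=
  hv.integrable_mul ((continuous_ev f).mul (Complex.continuous_conj.comp (continuous_ev h)))

theorem form_eq (v : (Fin n → ℝ) → ℝ) (f h : LPoly n) :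
    form v f h = ∫ x in cube n, ev f x * (starRingEnd ℂ) (ev h x) * v x := rfl

theorem form_conj (v : (Fin n → ℝ) → ℝ) (f h : LPoly n) :
    (starRingEnd ℂ) (form v f h) = form v h f := by
  rw [form_eq, form_eq, ← integral_conj]
  refine integral_congr_ae (Eventually.of_forall fun x => ?_)
  simp only [map_mul, Complex.conj_conj, Complex.conj_ofReal]
  ring

theorem GoodWeight.form_add_left (hv : GoodWeight v) (f f' h : LPoly n) :
    form v (f + f') h = form v f h + form v f' h := by
  rw [form_eq, form_eq, form_eq, ← integral_add (hv.integrable _ _) (hv.integrable _ _)]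
  refine integral_congr_ae (Eventually.of_forall fun x => ?_)
  simp only [map_add, Pi.add_apply]; ring

theorem form_smul_left (v : (Fin n → ℝ) → ℝ) (c : ℂ) (f h : LPoly n) :
    form v (c • f) h = c * form v f h := by
  rw [form_eq, form_eq, ← integral_const_mul]
  refine integral_congr_ae (Eventually.of_forall fun x => ?_)
  simp only [map_smul, Pi.smul_apply, smul_eq_mul]; ring

/-- The inner product as a linear functional of its first argument. -/
def GoodWeight.formLeft (hv : GoodWeight v) (h : LPoly n) : LPoly n →ₗ[ℂ] ℂ where
  toFun f := form v f h
  map_add' f f' := hv.form_add_left f f' h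
  map_smul' c f := form_smul_left v c f h

theorem GoodWeight.form_sum_left (hv : GoodWeight v) {ι : Type*} (s : Finset ι)
    (F : ι → LPoly n) (h : LPoly n) : form v (∑ i ∈ s, F i) h = ∑ i ∈ s, form v (F i) h :=
  map_sum (hv.formLeft h) F s

theorem GoodWeight.form_sub_left (hv : GoodWeight v) (f f' h : LPoly n) :
    form v (f - f') h = form v f h - form v f' h :=
  map_sub (hv.formLeft h) f f'

theorem GoodWeight.form_sum_right (hv : GoodWeight v) {ι : Type*} (s : Finset ι)
    (f : LPoly n) (F : ι → LPoly n) : form v f (∑ i ∈ s, F i) = ∑ i ∈ s, form v f (F i) := by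
  rw [← form_conj, hv.form_sum_left, map_sum]
  simp only [form_conj]

theorem form_smul_right (v : (Fin n → ℝ) → ℝ) (c : ℂ) (f h : LPoly n) :
    form v f (c • h) = (starRingEnd ℂ) c * form v f h := by
  rw [← form_conj, form_smul_left, map_mul, form_conj]

theorem GoodWeight.eq_zero_of_form_self (hv : GoodWeight v) {f : LPoly n}
    (h : form v f f = 0) : f = 0 := by
  have e : ∀ x, ev f x * (starRingEnd ℂ) (ev f x) * v x = ((‖ev f x‖ ^ 2 * v x : ℝ) : ℂ) :=
    fun x => by rw [Complex.mul_conj, Complex.normSq_eq_norm_sq]; push_cast; rfl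
  have hi := hv.integrable f f
  rw [form_eq] at h
  simp only [e] at h hi
  have h1 : ∫ x in cube n, ‖ev f x‖ ^ 2 * v x = 0 := by
    rw [integral_complex_ofReal] at h
    exact_mod_cast h
  have h2 : Integrable (fun x => ‖ev f x‖ ^ 2 * v x) (volume.restrict (cube n)) := by
    simpa only [RCLike.re_eq_complex_re, Complex.ofReal_re] using hi.re
  rw [integral_eq_zero_iff_of_nonneg
    (fun x => mul_nonneg (sq_nonneg _) (hv.nonneg x)) h2] at h1
  refine eq_zero_of_ev_ae_eq_zero ?_
  filter_upwards [h1, ae_restrict_of_ae hv.pos] with x hx hp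
  have := (mul_eq_zero.1 hx).resolve_right hp.ne'
  simpa using this

end InnerProduct

/-! ### Monomial symmetric functions, Gram matrices and continuity of the solution in the weight -/

section Monomials

variable {n : ℕ}

/-- The monomial symmetric Laurent polynomial. -/
def symPoly (μ : Fin n → ℤ) : LPoly n := ∑ ν ∈ weylOrbit μ, Finsupp.single ν 1

theorem ev_symPoly (μ : Fin n → ℤ) : ev (symPoly μ) = monomialSym μ := by
  funext x
  simp [symPoly, monomialSym, map_sum, ev_single, Finset.sum_apply]

theorem symPoly_apply (μ ν : Fin n → ℤ) : symPoly μ ν = if ν ∈ weylOrbit μ then 1 else 0 := by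
  simp [symPoly, Finsupp.finsetSum_apply, Finsupp.single_apply]

theorem IsDominant.symPoly_apply {μ ν : Fin n → ℤ} (hμ : IsDominant μ) (hν : IsDominant ν) :
    symPoly μ ν = if ν = μ then 1 else 0 := by
  rw [KoornwinderJacobi.symPoly_apply]
  congr 1
  rw [mem_weylOrbit, eq_iff_iff]
  exact ⟨fun ⟨w, hw⟩ => hν.eq_of_act_eq hμ hw, fun h => ⟨(1, 1), by rw [act_one, h]⟩⟩

/-- The Laurent polynomial whose function is `monicSum lam c`. -/
def monicPoly (lam : Fin n → ℤ) (c : (Fin n → ℤ) → ℂ) : LPoly n :=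
  symPoly lam + ∑ μ ∈ below lam, c μ • symPoly μ

theorem ev_monicPoly (lam : Fin n → ℤ) (c : (Fin n → ℤ) → ℂ) :
    ev (monicPoly lam c) = monicSum lam c := by
  funext x
  simp [monicPoly, monicSum, map_sum, Finset.sum_apply, ev_symPoly]

theorem isDominant_of_mem_below {lam μ : Fin n → ℤ} (h : μ ∈ below lam) : IsDominant μ :=
  ((mem_below lam μ).1 h).1

theorem sum_symPoly_apply {lam ν : Fin n → ℤ} (hν : ν ∈ below lam) (c : (Fin n → ℤ) → ℂ) :
    (∑ μ ∈ below lam, c μ • symPoly μ) ν = c ν := by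
  simp only [Finsupp.finsetSum_apply, Finsupp.smul_apply, smul_eq_mul]
  rw [Finset.sum_eq_single_of_mem ν hν]
  · rw [(isDominant_of_mem_below hν).symPoly_apply (isDominant_of_mem_below hν), if_pos rfl, mul_one]
  · intro μ hμ hne
    rw [(isDominant_of_mem_below hμ).symPoly_apply (isDominant_of_mem_below hν), if_neg hne.symm,
      mul_zero]

/-- The Gram matrix of the monomials below `lam`. -/
def gram (w : (Fin n → ℝ) → ℂ) (lam : Fin n → ℤ) : Matrix (below lam) (below lam) ℂ :=
  Matrix.of fun μ ν => innerW w (monomialSym ν.1) (monomialSym μ.1)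

/-- The inner products of `m_lam` with the monomials below `lam`. -/
def gramVec (w : (Fin n → ℝ) → ℂ) (lam : Fin n → ℤ) : below lam → ℂ :=
  fun μ => innerW w (monomialSym lam) (monomialSym μ.1)

/-- The coefficients of the orthogonal polynomial. -/
def solCoeff (w : (Fin n → ℝ) → ℂ) (lam μ : Fin n → ℤ) : ℂ :=
  open Classical in
  if h : μ ∈ below lam then -((gram w lam)⁻¹.mulVec (gramVec w lam)) ⟨μ, h⟩ else 0

variable {v : (Fin n → ℝ) → ℝ}

theorem form_symPoly (v : (Fin n → ℝ) → ℝ) (μ ν : Fin n → ℤ) :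
    form v (symPoly μ) (symPoly ν)
      = innerW (fun x => (v x : ℂ)) (monomialSym μ) (monomialSym ν) := by
  rw [form, ev_symPoly, ev_symPoly]

/-- A kernel vector is the coefficient vector of a combination of the `m_μ` orthogonal to each
`m_μ`, hence to itself; by definiteness it vanishes. -/
theorem GoodWeight.isUnit_gram (hv : GoodWeight v) (lam : Fin n → ℤ) :
    IsUnit (gram (fun x => (v x : ℂ)) lam) := by
  classical
  rw [← Matrix.mulVec_injective_iff_isUnit]
  refine (injective_iff_map_eq_zero (gram (fun x => (v x : ℂ)) lam).mulVecLin).2 fun c hc => ?_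
  set f : LPoly n := ∑ ν : below lam, c ν • symPoly ν.1 with hf
  have h1 : ∀ μ : below lam, form v f (symPoly μ.1) = 0 := by
    intro μ
    have := congrFun hc μ
    simp only [Matrix.mulVecLin_apply, Matrix.mulVec, dotProduct, gram, Matrix.of_apply,
      Pi.zero_apply] at this
    rw [hf, hv.form_sum_left, ← this]
    refine Finset.sum_congr rfl fun ν _ => ?_
    rw [form_smul_left, form_symPoly, mul_comm]
  have h2 : form v f f = 0 := by
    have h3 : form v f f = form v f (∑ ν : below lam, c ν • symPoly ν.1) := rfl
    rw [h3, hv.form_sum_right]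
    refine Finset.sum_eq_zero fun μ _ => ?_
    rw [form_smul_right, h1, mul_zero]
  have h3 := hv.eq_zero_of_form_self h2
  funext ν
  -- The coefficients are read off at dominant exponents, each of which occurs in exactly one `m_μ`.
  have h4 := sum_symPoly_apply ν.2 (fun μ => if h : μ ∈ below lam then c ⟨μ, h⟩ else 0)
  rw [← Finset.sum_coe_sort] at h4
  simp only [Finset.coe_mem, dite_true, Subtype.coe_eta] at h4
  rw [← h4, ← hf, h3]
  rfl

theorem GoodWeight.isMonicOrthogonal_iff (hv : GoodWeight v) (lam : Fin n → ℤ)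
    (p : (Fin n → ℝ) → ℂ) : IsMonicOrthogonal (fun x => (v x : ℂ)) lam p
      ↔ p = monicSum lam (solCoeff (fun x => (v x : ℂ)) lam) := by
  classical
  set w : (Fin n → ℝ) → ℂ := fun x => (v x : ℂ) with hw
  have hdet : IsUnit (gram w lam).det := (Matrix.isUnit_iff_isUnit_det _).1 (hv.isUnit_gram lam)
  have key : ∀ c : (Fin n → ℤ) → ℂ, ∀ μ : below lam,
      innerW w (monicSum lam c) (monomialSym μ.1)
        = gramVec w lam μ + (gram w lam).mulVec (fun ν => c ν.1) μ := by
    intro c μ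
    rw [← ev_monicPoly, ← ev_symPoly]
    change form v _ _ = _
    rw [monicPoly, hv.form_add_left, hv.form_sum_left, ← Finset.sum_coe_sort, form_symPoly]
    simp only [gramVec, Matrix.mulVec, dotProduct, gram, Matrix.of_apply]
    congr 1
    refine Finset.sum_congr rfl fun ν _ => ?_
    rw [form_smul_left, form_symPoly, mul_comm]
  have hsol : (fun ν : below lam => solCoeff w lam ν.1)
      = -((gram w lam)⁻¹.mulVec (gramVec w lam)) := by
    funext ν; simp [solCoeff]
  constructor
  · rintro ⟨⟨c, rfl⟩, h⟩
    have h1 : (gram w lam).mulVec (fun ν => c ν.1) = -gramVec w lam := by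
      funext μ
      have h2 := (mem_below _ _).1 μ.2
      have := h μ.1 h2.1 h2.2.1 h2.2.2
      rw [key] at this
      rw [Pi.neg_apply]
      linear_combination this
    have h2 : (fun ν : below lam => c ν.1) = fun ν : below lam => solCoeff w lam ν.1 := by
      rw [hsol, ← Matrix.mulVec_neg, ← h1, Matrix.mulVec_mulVec, Matrix.nonsing_inv_mul _ hdet,
        Matrix.one_mulVec]
    funext x
    rw [monicSum, monicSum]
    congr 1
    refine Finset.sum_congr rfl fun μ hμ => ?_
    rw [show c μ = solCoeff w lam μ from congrFun h2 ⟨μ, hμ⟩]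
  · rintro rfl
    refine ⟨⟨_, rfl⟩, fun μ h1 h2 h3 => ?_⟩
    have := key (solCoeff w lam) ⟨μ, (mem_below _ _).2 ⟨h1, h2, h3⟩⟩
    rw [this, hsol, Matrix.mulVec_neg, Matrix.mulVec_mulVec, Matrix.mul_nonsing_inv _ hdet,
      Matrix.one_mulVec]
    simp

theorem GoodWeight.isMonicOrthogonal_orthPoly (hv : GoodWeight v) (lam : Fin n → ℤ) :
    IsMonicOrthogonal (fun x => (v x : ℂ)) lam (orthPoly (fun x => (v x : ℂ)) lam) := by
  have h : ∃ p, IsMonicOrthogonal (fun x => (v x : ℂ)) lam p :=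
    ⟨_, (hv.isMonicOrthogonal_iff lam _).2 rfl⟩
  rw [orthPoly, dif_pos h]
  exact h.choose_spec

theorem GoodWeight.orthPoly_eq (hv : GoodWeight v) (lam : Fin n → ℤ) :
    orthPoly (fun x => (v x : ℂ)) lam = monicSum lam (solCoeff (fun x => (v x : ℂ)) lam) :=
  (hv.isMonicOrthogonal_iff lam _).1 (hv.isMonicOrthogonal_orthPoly lam)

theorem GoodWeight.isMonicOrthogonal_iff_eq (hv : GoodWeight v) (lam : Fin n → ℤ)
    (p : (Fin n → ℝ) → ℂ) : IsMonicOrthogonal (fun x => (v x : ℂ)) lam p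
      ↔ p = orthPoly (fun x => (v x : ℂ)) lam := by
  rw [hv.isMonicOrthogonal_iff, hv.orthPoly_eq]

theorem innerW_const_mul (C : ℂ) (w f h : (Fin n → ℝ) → ℂ) :
    innerW (fun x => C * w x) f h = C * innerW w f h := by
  rw [innerW, innerW, ← integral_const_mul]
  refine integral_congr_ae (Eventually.of_forall fun x => ?_)
  ring

theorem orthPoly_const_mul {C : ℂ} (hC : C ≠ 0) (w : (Fin n → ℝ) → ℂ) (lam : Fin n → ℤ) :
    orthPoly (fun x => C * w x) lam = orthPoly w lam := by
  have : IsMonicOrthogonal (fun x => C * w x) lam = IsMonicOrthogonal w lam := by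
    funext p
    simp only [IsMonicOrthogonal, innerW_const_mul, mul_eq_zero, hC, false_or]
  -- `orthPoly` is a choice from a predicate; equal predicates make the same choice, so uniqueness
  -- is not needed here.
  have key : ∀ P Q : ((Fin n → ℝ) → ℂ) → Prop, P = Q →
      (open Classical in if h : ∃ p, P p then h.choose else 0)
        = (open Classical in if h : ∃ p, Q p then h.choose else 0) := by
    rintro P _ rfl; rfl
  exact key _ _ this

theorem tendsto_innerW {ι : Type*} {l : Filter ι} [l.IsCountablyGenerated]
    {v : ι → (Fin n → ℝ) → ℝ} {v₀ : (Fin n → ℝ) → ℝ} {C : ℝ}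
    (hm : ∀ᶠ i in l, Measurable (v i)) (hb : ∀ᶠ i in l, ∀ x, |v i x| ≤ C)
    (hlim : ∀ᵐ x, Tendsto (fun i => v i x) l (𝓝 (v₀ x))) (f h : LPoly n) :
    Tendsto (fun i => innerW (fun x => (v i x : ℂ)) (ev f) (ev h)) l
      (𝓝 (innerW (fun x => (v₀ x : ℂ)) (ev f) (ev h))) := by
  set F : (Fin n → ℝ) → ℂ := fun x => ev f x * (starRingEnd ℂ) (ev h x) with hF
  have hFc : Continuous F :=
    (continuous_ev f).mul (Complex.continuous_conj.comp (continuous_ev h))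
  refine tendsto_integral_filter_of_dominated_convergence (fun x => ‖F x‖ * C) ?_ ?_ ?_ ?_
  · filter_upwards [hm] with i hi
    exact (hFc.measurable.mul (Complex.measurable_ofReal.comp hi)).aestronglyMeasurable
  · filter_upwards [hb] with i hi
    refine Eventually.of_forall fun x => ?_
    rw [norm_mul, Complex.norm_real]
    exact mul_le_mul_of_nonneg_left (hi x) (norm_nonneg _)
  · exact (hFc.norm.integrableOn_Icc).mul_const C
  · filter_upwards [ae_restrict_of_ae hlim] with x hx
    exact ((Complex.continuous_ofReal.tendsto _).comp hx).const_mul _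

/-- Only the limiting Gram matrix has to be invertible: the inverse is the adjugate divided by the
determinant, continuous where the determinant is nonzero. -/
theorem GoodWeight.tendsto_solCoeff {ι : Type*} {l : Filter ι} {w : ι → (Fin n → ℝ) → ℂ}
    (hv : GoodWeight v) (h : ∀ μ ν : Fin n → ℤ,
      Tendsto (fun i => innerW (w i) (monomialSym μ) (monomialSym ν)) l
        (𝓝 (innerW (fun x => (v x : ℂ)) (monomialSym μ) (monomialSym ν))))
    (lam μ : Fin n → ℤ) :
    Tendsto (fun i => solCoeff (w i) lam μ) l (𝓝 (solCoeff (fun x => (v x : ℂ)) lam μ)) := by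
  classical
  by_cases hμ : μ ∈ below lam
  · have hdet : (gram (fun x => (v x : ℂ)) lam).det ≠ 0 :=
      ((Matrix.isUnit_iff_isUnit_det _).1 (hv.isUnit_gram lam)).ne_zero
    have hG : Tendsto (fun i => gram (w i) lam) l (𝓝 (gram (fun x => (v x : ℂ)) lam)) :=
      tendsto_pi_nhds.2 fun a => tendsto_pi_nhds.2 fun b => h b.1 a.1
    have hb : Tendsto (fun i => gramVec (w i) lam) l (𝓝 (gramVec (fun x => (v x : ℂ)) lam)) :=
      tendsto_pi_nhds.2 fun a => h lam a.1
    have hd := ((continuous_id.matrix_det).tendsto (gram (fun x => (v x : ℂ)) lam)).comp hG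
    have ha := ((continuous_id.matrix_adjugate).tendsto (gram (fun x => (v x : ℂ)) lam)).comp hG
    have hi : Tendsto (fun i => (gram (w i) lam)⁻¹) l (𝓝 (gram (fun x => (v x : ℂ)) lam)⁻¹) := by
      simp only [Matrix.inv_def, Ring.inverse_eq_inv']
      exact (hd.inv₀ hdet).smul ha
    have hmv : Continuous fun p : Matrix (below lam) (below lam) ℂ × (below lam → ℂ) =>
        p.1.mulVec p.2 := continuous_fst.matrix_mulVec continuous_snd
    have := (hmv.tendsto _).comp (hi.prodMk_nhds hb)
    simp only [solCoeff, dif_pos hμ]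
    exact ((tendsto_pi_nhds.1 this) ⟨μ, hμ⟩).neg
  · simp only [solCoeff, dif_neg hμ]
    exact tendsto_const_nhds

theorem norm_monomialSym_le (μ : Fin n → ℤ) (x : Fin n → ℝ) :
    ‖monomialSym μ x‖ ≤ (weylOrbit μ).card := by
  rw [monomialSym]
  refine (norm_sum_le _ _).trans ?_
  simp [norm_character]

theorem tendstoUniformly_monicSum {ι : Type*} {l : Filter ι} {lam : Fin n → ℤ}
    {c : ι → (Fin n → ℤ) → ℂ} {c₀ : (Fin n → ℤ) → ℂ}
    (h : ∀ μ ∈ below lam, Tendsto (fun i => c i μ) l (𝓝 (c₀ μ))) :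
    TendstoUniformly (fun i => monicSum lam (c i)) (monicSum lam c₀) l := by
  rw [Metric.tendstoUniformly_iff]
  intro ε hε
  have h1 : Tendsto (fun i => ∑ μ ∈ below lam, ‖c₀ μ - c i μ‖ * (weylOrbit μ).card) l (𝓝 0) := by
    have : Tendsto (fun i => ∑ μ ∈ below lam, ‖c₀ μ - c i μ‖ * (weylOrbit μ).card) l
        (𝓝 (∑ μ ∈ below lam, ‖c₀ μ - c₀ μ‖ * (weylOrbit μ).card)) :=
      tendsto_finsetSum _ fun μ hμ => ((tendsto_const_nhds.sub (h μ hμ)).norm).mul_const _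
    simpa using this
  filter_upwards [h1.eventually_lt_const hε] with i hi x
  refine lt_of_le_of_lt ?_ hi
  rw [dist_eq_norm, monicSum, monicSum, add_sub_add_left_eq_sub, ← Finset.sum_sub_distrib]
  refine (norm_sum_le _ _).trans (Finset.sum_le_sum fun μ _ => ?_)
  rw [← sub_mul, norm_mul]
  exact mul_le_mul_of_nonneg_left (norm_monomialSym_le μ x) (norm_nonneg _)

end Monomials
end KoornwinderJacobi
end

noncomputable section
namespace KoornwinderJacobi
open Filter Topology

/-! ### The `q`-shifted factorials and the limit `q → 1` -/

section QShift

theorem summable_norm_mul_pow (a : ℂ) {q : ℝ} (h0 : 0 ≤ q) (h1 : q < 1) :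
    Summable fun m : ℕ => ‖-(a * (q : ℂ) ^ m)‖ := by
  simp only [norm_neg, norm_mul, norm_pow, Complex.norm_real, Real.norm_of_nonneg h0]
  exact (summable_geometric_of_lt_one h0 h1).mul_left _

theorem multipliable_qShift (a : ℂ) {q : ℝ} (h0 : 0 ≤ q) (h1 : q < 1) :
    Multipliable fun m : ℕ => (1 - a * (q : ℂ) ^ m) := by
  simpa only [sub_eq_add_neg] using multipliable_one_add_of_summable (summable_norm_mul_pow a h0 h1)

theorem tendsto_qShift (a : ℂ) {q : ℝ} (h0 : 0 ≤ q) (h1 : q < 1) :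
    Tendsto (fun N => ∏ m ∈ Finset.range N, (1 - a * (q : ℂ) ^ m)) atTop (𝓝 (qShift a q)) :=
  (multipliable_qShift a h0 h1).tendsto_prod_tprod_nat

theorem qShift_eq_mul (a : ℂ) {q : ℝ} (h0 : 0 ≤ q) (h1 : q < 1) :
    qShift a q = (1 - a) * qShift (q * a) q := by
  have h := (tendsto_qShift a h0 h1).comp (tendsto_add_atTop_nat 1)
  refine tendsto_nhds_unique h ?_
  refine ((tendsto_qShift (q * a) h0 h1).const_mul (1 - a)).congr fun N => ?_
  simp only [Function.comp]
  rw [Finset.prod_range_succ', pow_zero, mul_one, mul_comm]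
  congr 1
  exact Finset.prod_congr rfl fun m _ => by ring

theorem one_sub_mul_ne_zero {a : ℂ} (ha : ‖a‖ ≤ 1) (ha1 : a ≠ 1) {r : ℝ} (h0 : 0 ≤ r)
    (h1 : r ≤ 1) : 1 - a * (r : ℂ) ≠ 0 := by
  intro h
  have h2 : a * (r : ℂ) = 1 := (sub_eq_zero.1 h).symm
  have h3 : ‖a‖ * r = 1 := by
    have := congrArg norm h2
    rwa [norm_mul, Complex.norm_real, Real.norm_of_nonneg h0, norm_one] at this
  have h4 : r = 1 := by nlinarith [norm_nonneg a]
  rw [h4] at h2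
  exact ha1 (by simpa using h2)

theorem qShift_ne_zero {a : ℂ} {q : ℝ} (h0 : 0 ≤ q) (h1 : q < 1) (ha : ‖a‖ ≤ 1) (ha1 : a ≠ 1) :
    qShift a q ≠ 0 := by
  have := tprod_one_add_ne_zero_of_summable (f := fun m : ℕ => -(a * (q : ℂ) ^ m)) ?_
    (summable_norm_mul_pow a h0 h1)
  · rw [qShift]
    simpa only [← sub_eq_add_neg] using this
  · intro m
    rw [← sub_eq_add_neg]
    exact_mod_cast one_sub_mul_ne_zero ha ha1 (pow_nonneg h0 m) (pow_le_one₀ h0 h1.le)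

theorem conj_qShift (a : ℂ) {q : ℝ} (h0 : 0 ≤ q) (h1 : q < 1) :
    (starRingEnd ℂ) (qShift a q) = qShift ((starRingEnd ℂ) a) q := by
  refine tendsto_nhds_unique ((Complex.continuous_conj.tendsto _).comp (tendsto_qShift a h0 h1)) ?_
  refine (tendsto_qShift _ h0 h1).congr fun N => ?_
  simp [map_prod]

theorem measurable_qShift {q : ℝ} (h0 : 0 ≤ q) (h1 : q < 1) :
    Measurable fun a : ℂ => qShift a q := by
  refine measurable_of_tendsto_metrizable
    (f := fun (N : ℕ) (a : ℂ) => ∏ m ∈ Finset.range N, (1 - a * (q : ℂ) ^ m)) (fun N => ?_) ?_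
  · exact Continuous.measurable (by fun_prop)
  · rw [tendsto_pi_nhds]
    exact fun a => tendsto_qShift a h0 h1

/-- The even-indexed factors `1 - a² q^{2N}` split as `(1 - a q^N)(1 + a q^N)`; the odd-indexed ones
split likewise with `√q a` in place of `a`. This matches the numerator of `d_b^+` with its four
denominators. -/
theorem qShift_sq (a : ℂ) {q : ℝ} (h0 : 0 < q) (h1 : q < 1) :
    qShift (a ^ 2) q = qShift a q * qShift (-a) q * qShift (Real.sqrt q * a) q
      * qShift (-(Real.sqrt q * a)) q := by
  have hs : ((Real.sqrt q : ℝ) : ℂ) ^ 2 = q := by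
    rw [← Complex.ofReal_pow, Real.sq_sqrt h0.le]
  have h := (tendsto_qShift (a ^ 2) h0.le h1).comp (tendsto_id.const_mul_atTop' (r := 2) two_pos)
  refine tendsto_nhds_unique h ?_
  refine ((((tendsto_qShift a h0.le h1).mul (tendsto_qShift (-a) h0.le h1)).mul
    (tendsto_qShift (Real.sqrt q * a) h0.le h1)).mul
    (tendsto_qShift (-(Real.sqrt q * a)) h0.le h1)).congr fun N => ?_
  simp only [Function.comp, id]
  induction N with
  | zero => simp
  | succ N ih =>
    rw [show 2 * (N + 1) = 2 * N + 1 + 1 by ring, Finset.prod_range_succ _ (2 * N + 1),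
      Finset.prod_range_succ _ (2 * N), ← ih]
    simp only [Finset.prod_range_succ]
    have e1 : (1 - a * (q : ℂ) ^ N) * (1 - -a * (q : ℂ) ^ N) = 1 - a ^ 2 * (q : ℂ) ^ (2 * N) := by
      ring
    have e2 : (1 - (Real.sqrt q : ℂ) * a * (q : ℂ) ^ N) * (1 - -((Real.sqrt q : ℂ) * a) * (q : ℂ) ^ N)
        = 1 - a ^ 2 * (q : ℂ) ^ (2 * N + 1) := by
      linear_combination -a ^ 2 * (q : ℂ) ^ (2 * N) * hs
    rw [← e1, ← e2]
    ring

end QShift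

/-! ### Power series whose coefficients have decreasing nonnegative partial sums -/

section PartialSumSeries

/-- The coefficients with partial sums `s`. -/
def diffCoeff (s : ℕ → ℝ) : ℕ → ℝ
  | 0 => s 0
  | k + 1 => s (k + 1) - s k

/-- The power series whose coefficients have the partial sums `s`. -/
def diffSeries (s : ℕ → ℝ) (a : ℂ) : ℂ := ∑' k, (diffCoeff s k : ℂ) * a ^ k

variable {s : ℕ → ℝ}

/-- Past index `0` all coefficients are nonpositive, so sums of absolute values telescope. Absolute
convergence on the closed disc and a uniform tail bound follow. -/
theorem hasSum_diff_tail (hs : Antitone s) (h0 : ∀ k, 0 ≤ s k) (K : ℕ) :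
    Summable (fun k => |diffCoeff s (k + K + 1)|) ∧ ∑' k, |diffCoeff s (k + K + 1)| ≤ s K := by
  have hb : ∀ N, ∑ k ∈ Finset.range N, |diffCoeff s (k + K + 1)| ≤ s K := by
    intro N
    have : ∑ k ∈ Finset.range N, |diffCoeff s (k + K + 1)| = s K - s (N + K) := by
      induction N with
      | zero => simp
      | succ N ih =>
        have h1 : s (N + K + 1) ≤ s (N + K) := hs (Nat.le_succ _)
        rw [Finset.sum_range_succ, ih, diffCoeff, abs_of_nonpos (by linarith),
          show N + 1 + K = N + K + 1 by ring]
        ring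
    rw [this]; linarith [h0 (N + K)]
  exact ⟨summable_of_sum_range_le (fun k => abs_nonneg _) hb,
    Real.tsum_le_of_sum_range_le (fun k => abs_nonneg _) hb⟩

theorem summable_abs_diffCoeff (hs : Antitone s) (h0 : ∀ k, 0 ≤ s k) :
    Summable fun k => |diffCoeff s k| :=
  (summable_nat_add_iff 1).1 (by simpa using (hasSum_diff_tail hs h0 0).1)

theorem norm_diff_term_le {a : ℂ} (ha : ‖a‖ ≤ 1) (k : ℕ) :
    ‖(diffCoeff s k : ℂ) * a ^ k‖ ≤ |diffCoeff s k| := by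
  rw [norm_mul, Complex.norm_real, norm_pow, Real.norm_eq_abs]
  exact mul_le_of_le_one_right (abs_nonneg _) (pow_le_one₀ (norm_nonneg _) ha)

theorem summable_diff (hs : Antitone s) (h0 : ∀ k, 0 ≤ s k) {a : ℂ} (ha : ‖a‖ ≤ 1) :
    Summable fun k => (diffCoeff s k : ℂ) * a ^ k :=
  Summable.of_norm_bounded (summable_abs_diffCoeff hs h0) (norm_diff_term_le ha)

theorem norm_diffSeries_sub_le (hs : Antitone s) (h0 : ∀ k, 0 ≤ s k) {a : ℂ} (ha : ‖a‖ ≤ 1)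
    (K : ℕ) :
    ‖diffSeries s a - ∑ k ∈ Finset.range (K + 1), (diffCoeff s k : ℂ) * a ^ k‖ ≤ s K := by
  rw [diffSeries, ← (summable_diff hs h0 ha).sum_add_tsum_nat_add (K + 1), add_sub_cancel_left]
  have := hasSum_diff_tail hs h0 K
  exact (tsum_of_norm_bounded this.1.hasSum fun k => norm_diff_term_le ha (k + K + 1)).trans this.2

theorem norm_diffSeries_le (hs : Antitone s) (h0 : ∀ k, 0 ≤ s k) {a : ℂ} (ha : ‖a‖ ≤ 1) :
    ‖diffSeries s a‖ ≤ 2 * s 0 := by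
  have h1 := norm_diffSeries_sub_le hs h0 ha 0
  simp only [zero_add, Finset.range_one, Finset.sum_singleton, pow_zero, mul_one, diffCoeff] at h1
  calc ‖diffSeries s a‖ = ‖(diffSeries s a - s 0) + s 0‖ := by rw [sub_add_cancel]
    _ ≤ ‖diffSeries s a - s 0‖ + ‖(s 0 : ℂ)‖ := norm_add_le _ _
    _ ≤ s 0 + s 0 := by
      rw [Complex.norm_real, Real.norm_of_nonneg (h0 0)]; gcongr
    _ = 2 * s 0 := by ring

theorem continuousOn_diffSeries (hs : Antitone s) (h0 : ∀ k, 0 ≤ s k) :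
    ContinuousOn (diffSeries s) (Metric.closedBall 0 1) :=
  continuousOn_tsum (fun k => by fun_prop) (summable_abs_diffCoeff hs h0)
    fun k a ha => norm_diff_term_le (by simpa using ha) k

/-- If the partial sums converge termwise and the limit of the limits is `0`, then the series
converge, with moving arguments. -/
theorem tendsto_diffSeries {ι : Type*} {l : Filter ι} {t : ι → ℕ → ℝ} {f : ι → ℂ} {a b : ℂ}
    (ht : ∀ᶠ i in l, Antitone (t i) ∧ ∀ k, 0 ≤ t i k) (hts : ∀ k, Tendsto (fun i => t i k) l (𝓝 (s k)))
    (hs : Tendsto s atTop (𝓝 0)) (hf : Tendsto f l (𝓝 a)) (hf1 : ∀ᶠ i in l, ‖f i‖ ≤ 1)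
    (hb : ∀ K, ‖b - ∑ k ∈ Finset.range (K + 1), (diffCoeff s k : ℂ) * a ^ k‖ ≤ s K) :
    Tendsto (fun i => diffSeries (t i) (f i)) l (𝓝 b) := by
  rw [Metric.tendsto_nhds]
  intro ε hε
  -- Cut at degree `K`: the two tails are bounded by the `K`-th partial sums, each below `ε / 4`,
  -- and the finite parts converge.
  obtain ⟨K, hK⟩ := (hs.eventually_lt_const (show (0 : ℝ) < ε / 4 by linarith)).exists
  have hc : ∀ k, Tendsto (fun i => diffCoeff (t i) k) l (𝓝 (diffCoeff s k)) := by
    intro k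
    cases k with
    | zero => exact hts 0
    | succ k => exact (hts (k + 1)).sub (hts k)
  have hP : Tendsto (fun i => ∑ k ∈ Finset.range (K + 1), (diffCoeff (t i) k : ℂ) * f i ^ k) l
      (𝓝 (∑ k ∈ Finset.range (K + 1), (diffCoeff s k : ℂ) * a ^ k)) :=
    tendsto_finsetSum _ fun k _ =>
      ((Complex.continuous_ofReal.tendsto _).comp (hc k)).mul (hf.pow k)
  filter_upwards [ht, hf1, (Metric.tendsto_nhds.1 hP) (ε / 4) (by linarith),
    (hts K).eventually_lt_const hK] with i h1 h2 h3 h4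
  have h5 := norm_diffSeries_sub_le h1.1 h1.2 h2 K
  have h6 := hb K
  rw [dist_eq_norm] at h3 ⊢
  set P := ∑ k ∈ Finset.range (K + 1), (diffCoeff (t i) k : ℂ) * f i ^ k
  set Q := ∑ k ∈ Finset.range (K + 1), (diffCoeff s k : ℂ) * a ^ k
  calc ‖diffSeries (t i) (f i) - b‖ = ‖(diffSeries (t i) (f i) - P) + (P - Q) + -(b - Q)‖ := by
        congr 1; ring
    _ ≤ ‖diffSeries (t i) (f i) - P‖ + ‖P - Q‖ + ‖b - Q‖ := by
        refine (norm_add_le _ _).trans ?_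
        rw [norm_neg]
        gcongr
        exact norm_add_le _ _
    _ < ε := by linarith

end PartialSumSeries

/-! ### The `q`-binomial and binomial series and the limit of the basic quotient -/

section QBinomial

/-- The partial sums of the `q`-binomial series of `(a;q)_∞ / (ya;q)_∞`. -/
def qPartial (q y : ℝ) : ℕ → ℝ
  | 0 => 1
  | k + 1 => qPartial q y k * (1 - (1 - y) / (1 - q ^ (k + 1)))

variable {q y : ℝ}

/-- The new factor is `(y - q^{k+1}) / (1 - q^{k+1})`. With `y = q^g`, the condition `q ≤ y` means
`g ≤ 1`, and this is where that restriction originates. -/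
theorem qPartial_nonneg (h0 : 0 < q) (h1 : q < 1) (hy : q ≤ y) (k : ℕ) :
    0 ≤ qPartial q y k := by
  induction k with
  | zero => simp [qPartial]
  | succ k ih =>
    rw [qPartial]
    refine mul_nonneg ih ?_
    have h2 : q ^ (k + 1) ≤ q := by
      rw [pow_succ]; exact mul_le_of_le_one_left h0.le (pow_le_one₀ h0.le h1.le)
    have h3 : 0 < 1 - q ^ (k + 1) := by linarith
    rw [sub_nonneg, div_le_one h3]; linarith

theorem qPartial_antitone (h0 : 0 < q) (h1 : q < 1) (hy : q ≤ y) (hy1 : y ≤ 1) :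
    Antitone (qPartial q y) := by
  refine antitone_nat_of_succ_le fun k => ?_
  rw [qPartial]
  have h3 : 0 < 1 - q ^ (k + 1) := by linarith [pow_lt_one₀ h0.le h1 k.add_one_ne_zero]
  refine mul_le_of_le_one_right (qPartial_nonneg h0 h1 hy k) ?_
  linarith [div_nonneg (sub_nonneg.2 hy1) h3.le]

theorem diffCoeff_qPartial (h0 : 0 < q) (h1 : q < 1) (k : ℕ) :
    diffCoeff (qPartial q y) (k + 1) * (1 - q ^ (k + 1))
      = diffCoeff (qPartial q y) k * (y - q ^ k) := by
  have hk : ∀ k : ℕ, 1 - q ^ (k + 1) ≠ 0 := fun k =>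
    (sub_pos.2 (pow_lt_one₀ h0.le h1 k.add_one_ne_zero)).ne'
  cases k with
  | zero => 
    have := hk 0
    simp only [diffCoeff, qPartial, zero_add, pow_one, pow_zero] at this ⊢
    field_simp
    ring
  | succ k =>
    have h2 := hk k
    have h3 := hk (k + 1)
    simp only [diffCoeff, qPartial]
    field_simp
    ring

/-- The coefficient recursion `diffCoeff_qPartial`, summed against powers of `a`. -/
theorem diffSeries_qPartial_functional (h0 : 0 < q) (h1 : q < 1) (hy : q ≤ y) (hy1 : y ≤ 1)
    {a : ℂ} (ha : ‖a‖ ≤ 1) :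
    (1 - y * a) * diffSeries (qPartial q y) a = (1 - a) * diffSeries (qPartial q y) (q * a) := by
  have hS := qPartial_antitone h0 h1 hy hy1
  have hN := qPartial_nonneg h0 h1 hy
  have hqa : ‖(q : ℂ) * a‖ ≤ 1 := by
    rw [norm_mul, Complex.norm_real, Real.norm_of_nonneg h0.le]
    exact mul_le_one₀ h1.le (norm_nonneg _) ha
  have s1 := summable_diff hS hN ha
  have s2 := summable_diff hS hN hqa
  have t1 := (summable_nat_add_iff 1).2 s1
  have t2 := (summable_nat_add_iff 1).2 s2
  have e1 := s1.tsum_eq_zero_add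
  have e2 := s2.tsum_eq_zero_add
  set c := diffCoeff (qPartial q y)
  have key : ∑' k, ((c (k + 1) : ℂ) * a ^ (k + 1)) - y * a * ∑' k, (c k : ℂ) * a ^ k
      = ∑' k, ((c (k + 1) : ℂ) * (q * a) ^ (k + 1)) - a * ∑' k, (c k : ℂ) * (q * a) ^ k := by
    rw [← tsum_mul_left, ← tsum_mul_left, ← t1.tsum_sub (s1.mul_left _),
      ← t2.tsum_sub (s2.mul_left _)]
    refine tsum_congr fun k => ?_
    have h : (c (k + 1) : ℂ) * (1 - (q : ℂ) ^ (k + 1)) = c k * (y - (q : ℂ) ^ k) := by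
      exact_mod_cast diffCoeff_qPartial (y := y) h0 h1 k
    rw [mul_pow, mul_pow]
    linear_combination a ^ (k + 1) * h
  rw [diffSeries, diffSeries, sub_mul, sub_mul, one_mul, one_mul]
  rw [e1, e2]
  rw [e1, e2] at key
  simp only [pow_zero] at key ⊢
  linear_combination key

/-- The `q`-binomial theorem on the closed disc: iterate the functional equation `N` times and use
continuity at `0`, where the series equals `1`. Stated as a product, it also holds where the
denominator vanishes. -/
theorem diffSeries_qPartial (h0 : 0 < q) (h1 : q < 1) (hy : q ≤ y) (hy1 : y ≤ 1)
    {a : ℂ} (ha : ‖a‖ ≤ 1) :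
    diffSeries (qPartial q y) a * qShift (y * a) q = qShift a q := by
  have hS := qPartial_antitone h0 h1 hy hy1
  have hN := qPartial_nonneg h0 h1 hy
  have hle : ∀ N : ℕ, ‖(q : ℂ) ^ N * a‖ ≤ 1 := fun N => by
    rw [norm_mul, norm_pow, Complex.norm_real, Real.norm_of_nonneg h0.le]
    exact mul_le_one₀ (pow_le_one₀ h0.le h1.le) (norm_nonneg _) ha
  have iter : ∀ N, diffSeries (qPartial q y) a
        * ∏ m ∈ Finset.range N, (1 - y * a * (q : ℂ) ^ m)
      = (∏ m ∈ Finset.range N, (1 - a * (q : ℂ) ^ m))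
        * diffSeries (qPartial q y) ((q : ℂ) ^ N * a) := by
    intro N
    induction N with
    | zero => simp
    | succ N ih =>
      have := diffSeries_qPartial_functional h0 h1 hy hy1 (hle N)
      rw [show (q : ℂ) * ((q : ℂ) ^ N * a) = (q : ℂ) ^ (N + 1) * a by ring] at this
      rw [Finset.prod_range_succ, Finset.prod_range_succ, ← mul_assoc, ih]
      linear_combination (∏ m ∈ Finset.range N, (1 - a * (q : ℂ) ^ m)) * this
  have hz : Tendsto (fun N : ℕ => (q : ℂ) ^ N * a) atTop (𝓝[Metric.closedBall 0 1] 0) := by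
    refine tendsto_nhdsWithin_iff.2 ⟨?_, Eventually.of_forall fun N => by simpa using hle N⟩
    have : Tendsto (fun N : ℕ => (q : ℂ) ^ N) atTop (𝓝 0) :=
      tendsto_pow_atTop_nhds_zero_of_norm_lt_one
        (by rwa [Complex.norm_real, Real.norm_of_nonneg h0.le])
    simpa using this.mul_const a
  have hlim : Tendsto (fun N : ℕ => diffSeries (qPartial q y) ((q : ℂ) ^ N * a)) atTop (𝓝 1) := by
    have h2 := ((continuousOn_diffSeries hS hN) 0 (by simp)).tendsto.comp hz
    have h3 : diffSeries (qPartial q y) 0 = 1 := by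
      rw [diffSeries, tsum_eq_single 0 (fun k hk => by simp [hk])]
      simp [diffCoeff, qPartial]
    rwa [h3] at h2
  have hl := ((tendsto_qShift (y * a) h0.le h1).const_mul (diffSeries (qPartial q y) a))
  have hr := (tendsto_qShift a h0.le h1).mul hlim
  rw [mul_one] at hr
  refine tendsto_nhds_unique hl (hr.congr fun N => (iter N).symm)

/-- The partial sums of the binomial series of `(1 - a)^g`. -/
def binomPartial (g : ℝ) : ℕ → ℝ
  | 0 => 1
  | k + 1 => binomPartial g k * (1 - g / (k + 1))

theorem binomPartial_nonneg {g : ℝ} (h1 : g ≤ 1) (k : ℕ) : 0 ≤ binomPartial g k := by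
  induction k with
  | zero => simp [binomPartial]
  | succ k ih =>
    rw [binomPartial]
    refine mul_nonneg ih ?_
    rw [sub_nonneg, div_le_one (by positivity)]
    linarith [(Nat.cast_nonneg k : (0 : ℝ) ≤ k)]

theorem binomPartial_antitone {g : ℝ} (h0 : 0 ≤ g) (h1 : g ≤ 1) : Antitone (binomPartial g) := by
  refine antitone_nat_of_succ_le fun k => ?_
  rw [binomPartial]
  refine mul_le_of_le_one_right (binomPartial_nonneg h1 k) ?_
  have : 0 ≤ g / (k + 1) := by positivity
  linarith

/-- The product `∏ (1 - g / i)` is at most `exp (-g ∑ 1 / i)`, and the harmonic series diverges. -/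
theorem binomPartial_tendsto {g : ℝ} (h0 : 0 < g) (h1 : g ≤ 1) :
    Tendsto (binomPartial g) atTop (𝓝 0) := by
  have hb : ∀ k, binomPartial g k ≤ Real.exp (-(g * ∑ i ∈ Finset.range k, 1 / ((i : ℝ) + 1))) := by
    intro k
    induction k with
    | zero => simp [binomPartial]
    | succ k ih =>
      rw [binomPartial, Finset.sum_range_succ, mul_add, neg_add, Real.exp_add]
      have h2 := Real.add_one_le_exp (-(g * (1 / ((k : ℝ) + 1))))
      have h3 : 0 ≤ 1 - g / ((k : ℝ) + 1) := by
        rw [sub_nonneg, div_le_one (by positivity)]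
        linarith [(Nat.cast_nonneg k : (0 : ℝ) ≤ k)]
      refine mul_le_mul ih ?_ h3 (Real.exp_nonneg _)
      rw [mul_one_div] at h2 ⊢
      linarith
  refine squeeze_zero (binomPartial_nonneg h1) hb ?_
  refine Real.tendsto_exp_neg_atTop_nhds_zero.comp ?_
  exact Real.tendsto_sum_range_one_div_nat_succ_atTop.const_mul_atTop h0

theorem choose_succ_mul (r : ℂ) (k : ℕ) :
    Ring.choose r (k + 1) * (k + 1) = Ring.choose r k * (r - k) := by
  rw [Ring.choose_eq_smul, Ring.choose_eq_smul, descPochhammer_succ_right,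
    Polynomial.smeval_mul, Polynomial.smeval_sub, Polynomial.smeval_X, Polynomial.smeval_natCast]
  simp only [smul_eq_mul, pow_one, pow_zero, nsmul_eq_mul, mul_one, Nat.factorial_succ,
    Nat.cast_mul, Nat.cast_succ]
  have h1 : (k.factorial : ℂ) ≠ 0 := by exact_mod_cast Nat.factorial_ne_zero k
  have h2 : (k : ℂ) + 1 ≠ 0 := by exact_mod_cast Nat.succ_ne_zero k
  field_simp

theorem diffCoeff_binomPartial (g : ℝ) (k : ℕ) :
    (diffCoeff (binomPartial g) k : ℂ) = Ring.choose (g : ℂ) k * (-1) ^ k := by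
  have step : ∀ k : ℕ, diffCoeff (binomPartial g) (k + 1) * ((k : ℝ) + 1)
      = diffCoeff (binomPartial g) k * (k - g) := by
    intro k
    cases k with
    | zero => simp [diffCoeff, binomPartial]
    | succ k =>
      have : ((k : ℝ) + 1) ≠ 0 := by positivity
      have : ((k : ℝ) + 1 + 1) ≠ 0 := by positivity
      simp only [diffCoeff, binomPartial, Nat.cast_succ]
      field_simp
      ring
  induction k with
  | zero => simp [diffCoeff, binomPartial]
  | succ k ih =>
    have h1 : (k : ℂ) + 1 ≠ 0 := by exact_mod_cast Nat.succ_ne_zero k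
    have h2 : (diffCoeff (binomPartial g) (k + 1) : ℂ) * (k + 1)
      = diffCoeff (binomPartial g) k * (k - g) := by exact_mod_cast step k
    rw [ih] at h2
    refine mul_right_cancel₀ h1 (h2.trans ?_)
    rw [pow_succ]
    linear_combination (-1 : ℂ) ^ k * choose_succ_mul g k

theorem diffSeries_binomPartial (g : ℝ) {a : ℂ} (ha : ‖a‖ < 1) :
    diffSeries (binomPartial g) a = (1 - a) ^ (g : ℂ) := by
  have h := (Complex.one_add_cpow_hasFPowerSeriesOnBall_zero (a := (g : ℂ))).hasSum
    (y := -a) (by simpa [← ofReal_norm] using ha)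
  rw [diffSeries, zero_add, ← sub_eq_add_neg] at *
  rw [← h.tsum_eq]
  refine tsum_congr fun k => ?_
  rw [diffCoeff_binomPartial]
  simp only [binomialSeries_apply, List.ofFn_const, List.prod_replicate, smul_eq_mul]
  rw [neg_pow]; ring

theorem re_one_sub_pos {a : ℂ} (ha : ‖a‖ ≤ 1) (ha1 : a ≠ 1) : 0 < (1 - a).re := by
  have h1 : a.re ≤ ‖a‖ := Complex.re_le_norm a
  rcases (h1.trans ha).lt_or_eq with h | h
  · simpa using h
  · exfalso
    apply ha1
    have h2 : a.re ^ 2 + a.im ^ 2 ≤ 1 := by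
      have := Complex.sq_norm a
      rw [Complex.normSq_apply] at this
      nlinarith [norm_nonneg a]
    apply Complex.ext
    · simpa using h
    · have : a.im ^ 2 = 0 := le_antisymm (by rw [h] at h2; linarith) (sq_nonneg _)
      simpa using this

/-- Inside the disc this is the tail bound for the binomial series. It passes to the unit circle
along the radius `r a`, `r → 1`, because `1 - a` stays in the right half-plane. -/
theorem norm_cpow_sub_partial_le {g : ℝ} (h0 : 0 ≤ g) (h1 : g ≤ 1) {a : ℂ} (ha : ‖a‖ ≤ 1)
    (ha1 : a ≠ 1) (K : ℕ) :
    ‖(1 - a) ^ (g : ℂ) - ∑ k ∈ Finset.range (K + 1), (diffCoeff (binomPartial g) k : ℂ) * a ^ k‖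
      ≤ binomPartial g K := by
  have hr : Tendsto (fun r : ℝ => (r : ℂ) * a) (𝓝[<] 1) (𝓝 a) := by
    have : ContinuousAt (fun r : ℝ => (r : ℂ) * a) 1 := by fun_prop
    simpa using this.tendsto.mono_left nhdsWithin_le_nhds
  have hc : Tendsto (fun r : ℝ => (1 - (r : ℂ) * a) ^ (g : ℂ)
      - ∑ k ∈ Finset.range (K + 1), (diffCoeff (binomPartial g) k : ℂ) * ((r : ℂ) * a) ^ k)
      (𝓝[<] 1) (𝓝 ((1 - a) ^ (g : ℂ)
        - ∑ k ∈ Finset.range (K + 1), (diffCoeff (binomPartial g) k : ℂ) * a ^ k)) := by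
    refine Tendsto.sub ?_ (tendsto_finsetSum _ fun k _ => (hr.pow k).const_mul _)
    exact (continuousAt_cpow_const (Or.inl (re_one_sub_pos ha ha1))).tendsto.comp
      (tendsto_const_nhds.sub hr)
  refine le_of_tendsto hc.norm ?_
  filter_upwards [Ioo_mem_nhdsLT (show (0 : ℝ) < 1 by norm_num)] with r hr
  have : ‖(r : ℂ) * a‖ < 1 := by
    rw [norm_mul, Complex.norm_real, Real.norm_of_nonneg hr.1.le]
    exact mul_lt_one_of_nonneg_of_lt_one_left hr.1.le hr.2 ha
  rw [← diffSeries_binomPartial g this]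
  exact norm_diffSeries_sub_le (binomPartial_antitone h0 h1) (binomPartial_nonneg h1) this.le K

theorem tendsto_one_sub_exp_div (c : ℝ) :
    Tendsto (fun β : ℝ => (1 - Real.exp (-β * c)) / β) (𝓝[>] 0) (𝓝 c) := by
  have h : HasDerivAt (fun β : ℝ => 1 - Real.exp (-β * c)) c 0 := by
    have h1 : HasDerivAt (fun β : ℝ => -β * c) (-1 * c) 0 :=
      ((hasDerivAt_id (0 : ℝ)).neg).mul_const c
    simpa using (h1.exp).const_sub 1
  have h2 := h.tendsto_slope_zero_right
  refine h2.congr fun β => ?_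
  simp [div_eq_inv_mul]

theorem tendsto_qPartial (g : ℝ) (k : ℕ) :
    Tendsto (fun β : ℝ => qPartial (Real.exp (-β)) (Real.exp (-β * g)) k) (𝓝[>] 0)
      (𝓝 (binomPartial g k)) := by
  induction k with
  | zero => simp [qPartial, binomPartial]
  | succ k ih =>
    simp only [qPartial, binomPartial]
    refine ih.mul (tendsto_const_nhds.sub ?_)
    have h1 := (tendsto_one_sub_exp_div g).div (tendsto_one_sub_exp_div (k + 1)) (by positivity)
    refine h1.congr' ?_
    filter_upwards [self_mem_nhdsWithin] with β hβ
    have hβ : β ≠ 0 := ne_of_gt hβ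
    have e : Real.exp (-β) ^ (k + 1) = Real.exp (-β * (k + 1)) := by
      rw [← Real.exp_nat_mul]; congr 1; push_cast; ring
    simp only [Pi.div_apply]
    rw [e, div_div_div_cancel_right₀ hβ]

/-- The quotient `(a;q)_∞ / (q^g a;q)_∞` with `q = e^{-β}`. -/
def qRatio (β g : ℝ) (a : ℂ) : ℂ :=
  qShift a (Real.exp (-β)) / qShift (Real.exp (-β * g) * a) (Real.exp (-β))

theorem exp_neg_lt_one {β : ℝ} (hβ : 0 < β) : Real.exp (-β) < 1 := by
  rw [Real.exp_lt_one_iff]; linarith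

theorem norm_exp_mul_le {β g : ℝ} (hβ : 0 < β) (hg : 0 ≤ g) {a : ℂ} (ha : ‖a‖ ≤ 1) :
    ‖(Real.exp (-β * g) : ℂ) * a‖ ≤ 1 := by
  rw [norm_mul, Complex.norm_real, Real.norm_of_nonneg (Real.exp_nonneg _)]
  refine mul_le_one₀ ?_ (norm_nonneg _) ha
  rw [Real.exp_le_one_iff]; nlinarith

theorem exp_mul_ne_one {β g : ℝ} (hβ : 0 < β) (hg : 0 ≤ g) {a : ℂ} (ha : ‖a‖ ≤ 1) (ha1 : a ≠ 1) :
    (Real.exp (-β * g) : ℂ) * a ≠ 1 := fun h => by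
  have := one_sub_mul_ne_zero ha ha1 (Real.exp_nonneg (-β * g))
    (by rw [Real.exp_le_one_iff]; nlinarith)
  rw [mul_comm, h, sub_self] at this
  exact this rfl

theorem qRatio_ne_zero {β g : ℝ} (hβ : 0 < β) (hg : 0 ≤ g) {a : ℂ} (ha : ‖a‖ ≤ 1) (ha1 : a ≠ 1) :
    qRatio β g a ≠ 0 :=
  div_ne_zero (qShift_ne_zero (Real.exp_nonneg _) (exp_neg_lt_one hβ) ha ha1)
    (qShift_ne_zero (Real.exp_nonneg _) (exp_neg_lt_one hβ) (norm_exp_mul_le hβ hg ha)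
      (exp_mul_ne_one hβ hg ha ha1))

theorem qRatio_eq_diffSeries {β g : ℝ} (hβ : 0 < β) (hg : 0 ≤ g) (hg1 : g ≤ 1) {a : ℂ}
    (ha : ‖a‖ ≤ 1) (hne : qShift (Real.exp (-β * g) * a) (Real.exp (-β)) ≠ 0) :
    qRatio β g a = diffSeries (qPartial (Real.exp (-β)) (Real.exp (-β * g))) a := by
  rw [qRatio, div_eq_iff hne]
  exact (diffSeries_qPartial (Real.exp_pos _) (exp_neg_lt_one hβ)
    (Real.exp_le_exp.2 (by nlinarith)) (by rw [Real.exp_le_one_iff]; nlinarith) ha).symm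

/-- Lowers `g` by one at the price of moving the argument to `q a`; for this reason the limit
theorem below admits arguments depending on `β`. -/
theorem qRatio_add_one {β : ℝ} (hβ : 0 < β) (g : ℝ) (a : ℂ) :
    qRatio β (g + 1) a = (1 - a) * qRatio β g (Real.exp (-β) * a) := by
  rw [qRatio, qRatio, qShift_eq_mul a (Real.exp_nonneg _) (exp_neg_lt_one hβ), mul_div_assoc,
    show -β * (g + 1) = -β * g + -β by ring, Real.exp_add]
  push_cast
  rw [mul_assoc]

theorem qRatio_norm_le_of_le_one {β g : ℝ} (hβ : 0 < β) (hg : 0 ≤ g) (hg1 : g ≤ 1) {a : ℂ}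
    (ha : ‖a‖ ≤ 1) : ‖qRatio β g a‖ ≤ 2 := by
  by_cases hne : qShift (Real.exp (-β * g) * a) (Real.exp (-β)) = 0
  -- Where the denominator vanishes, the quotient is `0` by the convention for division, so the
  -- bound holds at every point of the closed disc.
  · rw [qRatio, hne, div_zero, norm_zero]; exact zero_le_two
  · rw [qRatio_eq_diffSeries hβ hg hg1 ha hne]
    have hy : Real.exp (-β) ≤ Real.exp (-β * g) := Real.exp_le_exp.2 (by nlinarith)
    refine (norm_diffSeries_le (qPartial_antitone (Real.exp_pos _) (exp_neg_lt_one hβ) hy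
      (by rw [Real.exp_le_one_iff]; nlinarith))
      (qPartial_nonneg (Real.exp_pos _) (exp_neg_lt_one hβ) hy) ha).trans ?_
    simp [qPartial]

theorem qRatio_tendsto_of_le_one {g : ℝ} (hg : 0 ≤ g) (hg1 : g ≤ 1) {f : ℝ → ℂ} {a : ℂ}
    (hf : Tendsto f (𝓝[>] 0) (𝓝 a)) (hf1 : ∀ᶠ β in 𝓝[>] 0, ‖f β‖ ≤ 1) (ha : a ≠ 1) :
    Tendsto (fun β => qRatio β g (f β)) (𝓝[>] 0) (𝓝 ((1 - a) ^ (g : ℂ))) := by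
  have ha1 : ‖a‖ ≤ 1 := le_of_tendsto hf.norm hf1
  have hpos : ∀ᶠ β : ℝ in 𝓝[>] 0, 0 < β := self_mem_nhdsWithin
  have hfa : ∀ᶠ β in 𝓝[>] 0, f β ≠ 1 := hf.eventually_ne ha
  -- For `g = 0` the partial sums are constantly `1` and do not tend to `0`; here the quotient is
  -- eventually exactly `1`.
  rcases hg.eq_or_lt with rfl | hg0
  · simp only [Complex.ofReal_zero, Complex.cpow_zero]
    refine tendsto_const_nhds.congr' ?_
    filter_upwards [hf1, hpos, hfa] with β h1 h2 h3
    rw [qRatio, mul_zero, Real.exp_zero, Complex.ofReal_one, one_mul, div_self]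
    exact qShift_ne_zero (Real.exp_nonneg _) (exp_neg_lt_one h2) h1 h3
  · have hle : ∀ β : ℝ, 0 < β → Real.exp (-β) ≤ Real.exp (-β * g) ∧ Real.exp (-β * g) ≤ 1 :=
      fun β hβ => ⟨Real.exp_le_exp.2 (by nlinarith), by rw [Real.exp_le_one_iff]; nlinarith⟩
    have key := tendsto_diffSeries (s := binomPartial g)
      (t := fun β : ℝ => qPartial (Real.exp (-β)) (Real.exp (-β * g))) (f := f) (a := a)
      (l := 𝓝[>] 0) (b := (1 - a) ^ (g : ℂ)) (by
        filter_upwards [hpos] with β hβ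
        exact ⟨qPartial_antitone (Real.exp_pos _) (exp_neg_lt_one hβ) (hle β hβ).1 (hle β hβ).2,
          qPartial_nonneg (Real.exp_pos _) (exp_neg_lt_one hβ) (hle β hβ).1⟩)
      (tendsto_qPartial g) (binomPartial_tendsto hg0 hg1) hf hf1
      (norm_cpow_sub_partial_le hg hg1 ha1 ha)
    refine key.congr' ?_
    filter_upwards [hf1, hpos, hfa] with β h1 h2 h3
    exact (qRatio_eq_diffSeries h2 hg hg1 h1 (qShift_ne_zero (Real.exp_nonneg _)
      (exp_neg_lt_one h2) (norm_exp_mul_le h2 hg h1) (exp_mul_ne_one h2 hg h1 h3))).symm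

theorem tendsto_exp_neg_mul (c : ℝ) {f : ℝ → ℂ} {a : ℂ} (hf : Tendsto f (𝓝[>] 0) (𝓝 a)) :
    Tendsto (fun β : ℝ => (Real.exp (-β * c) : ℂ) * f β) (𝓝[>] 0) (𝓝 a) := by
  have : ContinuousAt (fun β : ℝ => (Real.exp (-β * c) : ℂ)) 0 := by fun_prop
  have h := this.tendsto.mono_left (nhdsWithin_le_nhds (s := Set.Ioi 0))
  simpa using h.mul hf

theorem qRatio_tendsto {g : ℝ} (hg : 0 ≤ g) {f : ℝ → ℂ} {a : ℂ}
    (hf : Tendsto f (𝓝[>] 0) (𝓝 a)) (hf1 : ∀ᶠ β in 𝓝[>] 0, ‖f β‖ ≤ 1) (ha : a ≠ 1) :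
    Tendsto (fun β => qRatio β g (f β)) (𝓝[>] 0) (𝓝 ((1 - a) ^ (g : ℂ))) := by
  obtain ⟨N, hN⟩ := exists_nat_ge g
  induction N generalizing g f with
  | zero => exact qRatio_tendsto_of_le_one hg (by simp at hN; linarith) hf hf1 ha
  | succ N ih =>
    rcases le_total g 1 with h1 | h1
    · exact qRatio_tendsto_of_le_one hg h1 hf hf1 ha
    · have hpos : ∀ᶠ β : ℝ in 𝓝[>] 0, 0 < β := self_mem_nhdsWithin
      have hf' : Tendsto (fun β : ℝ => (Real.exp (-β) : ℂ) * f β) (𝓝[>] 0) (𝓝 a) := by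
        simpa using tendsto_exp_neg_mul 1 hf
      have := ih (g := g - 1) (by linarith) hf' (by
        filter_upwards [hf1, hpos] with β h1 h2
        simpa using norm_exp_mul_le h2 zero_le_one h1) (by push_cast at hN; linarith)
      have h2 := (tendsto_const_nhds.sub hf).mul this (a := (1 : ℂ) - a)
      have hne : (1 : ℂ) - a ≠ 0 := sub_ne_zero.2 ha.symm
      have e : (1 - a) * (1 - a) ^ ((g - 1 : ℝ) : ℂ) = (1 - a) ^ (g : ℂ) := by
        nth_rewrite 1 [← Complex.cpow_one (1 - a)]
        rw [← Complex.cpow_add _ _ hne]; congr 1; push_cast; ring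
      rw [e] at h2
      refine h2.congr' ?_
      filter_upwards [hpos] with β hβ
      have := qRatio_add_one hβ (g - 1) (f β)
      rw [sub_add_cancel] at this
      exact this.symm

theorem qRatio_norm_le {g : ℝ} (hg : 0 ≤ g) : ∃ C : ℝ, ∀ β : ℝ, 0 < β → ∀ a : ℂ, ‖a‖ ≤ 1 →
    ‖qRatio β g a‖ ≤ C := by
  obtain ⟨N, hN⟩ := exists_nat_ge g
  induction N generalizing g with
  | zero => exact ⟨2, fun β hβ a ha =>
      qRatio_norm_le_of_le_one hβ hg (by simp at hN; linarith) ha⟩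
  | succ N ih =>
    rcases le_total g 1 with h1 | h1
    · exact ⟨2, fun β hβ a ha => qRatio_norm_le_of_le_one hβ hg h1 ha⟩
    · obtain ⟨C, hC⟩ := ih (g := g - 1) (by linarith) (by push_cast at hN; linarith)
      refine ⟨2 * C, fun β hβ a ha => ?_⟩
      have := qRatio_add_one hβ (g - 1) a
      rw [sub_add_cancel] at this
      rw [this, norm_mul]
      have h2 : ‖1 - a‖ ≤ 2 := (norm_sub_le _ _).trans (by rw [norm_one]; linarith)
      have h3 := hC β hβ ((Real.exp (-β) : ℂ) * a) (by simpa using norm_exp_mul_le hβ zero_le_one ha)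
      exact mul_le_mul h2 h3 (norm_nonneg _) zero_le_two

end QBinomial
end KoornwinderJacobi
end

noncomputable section
namespace KoornwinderJacobi
open Filter Topology MeasureTheory

/-! ### The weight functions and their limit -/

section Weights

variable {n : ℕ}

/-- Points at which no nontrivial character takes the value `1`. -/
def Generic (x : Fin n → ℝ) : Prop := ∀ μ : Fin n → ℤ, μ ≠ 0 → character μ x ≠ 1

/-- For each nonzero `μ` the exceptional set is the preimage of the countable set `2πℤ` under a
nonzero linear form, hence null; there are countably many `μ`. -/
theorem ae_generic : ∀ᵐ x : Fin n → ℝ, Generic x := by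
  unfold Generic
  rw [ae_all_iff]
  intro μ
  by_cases hμ : μ = 0
  · simp [hμ]
  let L : (Fin n → ℝ) →ₗ[ℝ] ℝ := ∑ j, (μ j : ℝ) • LinearMap.proj j
  have hL : ∀ x, L x = ∑ j, (μ j : ℝ) * x j := fun x => by simp [L]
  have hsurj : Function.Surjective L := by
    refine LinearMap.surjective (fun h => hμ ?_)
    funext j
    have := LinearMap.congr_fun h (Pi.single j 1)
    rw [hL] at this
    simpa [Pi.single_apply] using this
  set s : Set ℝ := (Set.range fun k : ℤ => (2 * Real.pi * k : ℝ))ᶜ with hs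
  have hcount : (Set.range fun k : ℤ => (2 * Real.pi * k : ℝ)).Countable := Set.countable_range _
  have h1 : ∀ᵐ y : ℝ, y ∈ s := hcount.ae_notMem volume
  have h2 := (ae_comp_linearMap_mem_iff L volume volume hsurj hcount.measurableSet.compl).2 h1
  filter_upwards [h2] with x hx _ hc
  rw [character_eq_exp_ofReal, ← hL, Complex.exp_eq_one_iff] at hc
  obtain ⟨k, hk⟩ := hc
  refine hx ⟨k, ?_⟩
  have : ((L x : ℝ) : ℂ) = ((2 * Real.pi * k : ℝ) : ℂ) := by
    refine mul_right_cancel₀ Complex.I_ne_zero (hk.trans ?_)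
    push_cast; ring
  exact (Complex.ofReal_injective this).symm

/-- The number `e^{iz}`. -/
def phase (z : ℝ) : ℂ := Complex.exp (Complex.I * z)

theorem norm_phase (z : ℝ) : ‖phase z‖ = 1 := by
  rw [phase, mul_comm, Complex.norm_exp_ofReal_mul_I]

theorem phase_neg (z : ℝ) : phase (-z) = (starRingEnd ℂ) (phase z) := by
  rw [phase, phase, ← Complex.exp_conj]; simp

theorem continuous_phase : Continuous phase := by unfold phase; fun_prop

theorem phase_add_eq (x : Fin n → ℝ) (j k : Fin n) :
    phase (x j + x k) = character (Pi.single j 1 + Pi.single k 1) x := by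
  rw [phase, character]
  congr 2
  simp [add_mul, Finset.sum_add_distrib, Pi.single_apply]

theorem phase_sub_eq (x : Fin n → ℝ) (j k : Fin n) :
    phase (x j - x k) = character (Pi.single j 1 - Pi.single k 1) x := by
  rw [phase, character]
  congr 2
  simp [sub_mul, Finset.sum_sub_distrib, Pi.single_apply]

theorem Generic.phase_add_ne {x : Fin n → ℝ} (hx : Generic x) (j k : Fin n) :
    phase (x j + x k) ≠ 1 := by
  rw [phase_add_eq]
  refine hx _ fun h => ?_
  have := congrFun h j
  by_cases hjk : j = k
  · subst hjk; simp at this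
  · simp [hjk] at this

theorem Generic.phase_sub_ne {x : Fin n → ℝ} (hx : Generic x) {j k : Fin n} (hjk : j ≠ k) :
    phase (x j - x k) ≠ 1 := by
  rw [phase_sub_eq]
  refine hx _ fun h => ?_
  have := congrFun h j
  simp [hjk] at this

theorem Generic.phase_sq_ne {x : Fin n → ℝ} (hx : Generic x) (j : Fin n) :
    phase (x j) ^ 2 ≠ 1 := by
  have := hx.phase_add_ne j j
  rwa [show phase (x j + x j) = phase (x j) ^ 2 by
    rw [phase, phase, sq, ← Complex.exp_add]; congr 1; push_cast; ring] at this

theorem conj_qRatio {β : ℝ} (hβ : 0 < β) (g : ℝ) (a : ℂ) :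
    (starRingEnd ℂ) (qRatio β g a) = qRatio β g ((starRingEnd ℂ) a) := by
  rw [qRatio, qRatio, map_div₀, conj_qShift _ (Real.exp_nonneg _) (exp_neg_lt_one hβ),
    conj_qShift _ (Real.exp_nonneg _) (exp_neg_lt_one hβ), map_mul, Complex.conj_ofReal]

theorem measurable_qRatio {β : ℝ} (hβ : 0 < β) (g : ℝ) : Measurable (qRatio β g) :=
  (measurable_qShift (Real.exp_nonneg _) (exp_neg_lt_one hβ)).div
    ((measurable_qShift (Real.exp_nonneg _) (exp_neg_lt_one hβ)).comp
      (measurable_const.mul measurable_id))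

/-- `q` and `g` are real, so replacing `z` by `-z` conjugates the quotient, and the weight factor is
a squared modulus. -/
theorem da_eq {β : ℝ} (hβ : 0 < β) (g z : ℝ) : da β g z = ((‖qRatio β g (phase z)‖ ^ 2 : ℝ) : ℂ) := by
  have h : ∀ z : ℝ, daPlus β g z = qRatio β g (phase z) := fun z => rfl
  rw [da, h, h, phase_neg, ← conj_qRatio hβ, Complex.mul_conj, Complex.normSq_eq_norm_sq]

/-- The half step `e^{-β/2}`. -/
def halfStep (β : ℝ) : ℂ := (Real.exp (-β * (1 / 2)) : ℝ)

/-- The function `d_b^+` as a product of four quotients of `q`-shifted factorials. -/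
def bRatio (β g₀ g₁ g₀' g₁' : ℝ) (a : ℂ) : ℂ :=
  qRatio β g₀ a * qRatio β g₁ (-a) * qRatio β g₀' (halfStep β * a)
    * qRatio β g₁' (-(halfStep β * a))

/-- The parameters shifted by `1/2` combine with the factors in `±√q a` of `qShift_sq`, leaving
quotients with exponents `g₀'`, `g₁'` and argument `±q^{1/2} a`. -/
theorem dbPlus_eq {β : ℝ} (hβ : 0 < β) (g₀ g₁ g₀' g₁' z : ℝ) :
    dbPlus β g₀ g₁ g₀' g₁' z = bRatio β g₀ g₁ g₀' g₁' (phase z) := by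
  have hs : (Real.sqrt (Real.exp (-β)) : ℂ) = halfStep β := by
    rw [halfStep, Real.sqrt_eq_rpow, ← Real.exp_mul]
  have e : ∀ c : ℝ, (Real.exp (-β * (c + 1 / 2)) : ℂ) = Real.exp (-β * c) * halfStep β := fun c => by
    rw [halfStep, ← Complex.ofReal_mul, ← Real.exp_add]; congr 2; ring
  have h2 : Complex.exp (2 * Complex.I * z) = phase z ^ 2 := by
    rw [phase, sq, ← Complex.exp_add]; congr 1; ring
  rw [dbPlus, h2, qShift_sq _ (Real.exp_pos _) (exp_neg_lt_one hβ), hs, e, e]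
  change _ / (qShift (_ * phase z) _ * qShift (-(_ * phase z)) _ * qShift (_ * phase z) _
    * qShift (-(_ * phase z)) _) = _
  simp only [bRatio, qRatio, mul_neg, mul_assoc, div_mul_div_comm]

theorem conj_bRatio {β : ℝ} (hβ : 0 < β) (g₀ g₁ g₀' g₁' : ℝ) (a : ℂ) :
    (starRingEnd ℂ) (bRatio β g₀ g₁ g₀' g₁' a) = bRatio β g₀ g₁ g₀' g₁' ((starRingEnd ℂ) a) := by
  simp only [bRatio, map_mul, conj_qRatio hβ, map_neg, halfStep, Complex.conj_ofReal]

theorem db_eq {β : ℝ} (hβ : 0 < β) (g₀ g₁ g₀' g₁' z : ℝ) :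
    db β g₀ g₁ g₀' g₁' z = ((‖bRatio β g₀ g₁ g₀' g₁' (phase z)‖ ^ 2 : ℝ) : ℂ) := by
  rw [db, dbPlus_eq hβ, dbPlus_eq hβ, phase_neg, ← conj_bRatio hβ, Complex.mul_conj,
    Complex.normSq_eq_norm_sq]

/-- Koornwinder's weight function as a real function. -/
def realKoornwinder (β g g₀ g₁ g₀' g₁' : ℝ) (x : Fin n → ℝ) : ℝ :=
  (∏ j : Fin n, ∏ k ∈ Finset.Ioi j, ‖qRatio β g (phase (x j + x k))‖ ^ 2
      * ‖qRatio β g (phase (x j - x k))‖ ^ 2) *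
    ∏ j : Fin n, ‖bRatio β g₀ g₁ g₀' g₁' (phase (x j))‖ ^ 2

theorem koornwinderWeight_eq {β : ℝ} (hβ : 0 < β) (g g₀ g₁ g₀' g₁' : ℝ) :
    (koornwinderWeight β g g₀ g₁ g₀' g₁' : (Fin n → ℝ) → ℂ)
      = fun x => ((realKoornwinder β g g₀ g₁ g₀' g₁' x : ℝ) : ℂ) := by
  funext x
  simp only [koornwinderWeight, realKoornwinder, da_eq hβ, db_eq hβ]
  push_cast
  rfl

theorem norm_halfStep_mul_le {β : ℝ} (hβ : 0 < β) {a : ℂ} (ha : ‖a‖ ≤ 1) :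
    ‖halfStep β * a‖ ≤ 1 := norm_exp_mul_le hβ (by norm_num) ha

theorem bRatio_ne_zero {β g₀ g₁ g₀' g₁' : ℝ} (hβ : 0 < β) (hg₀ : 0 ≤ g₀) (hg₁ : 0 ≤ g₁)
    (hg₀' : 0 ≤ g₀') (hg₁' : 0 ≤ g₁') {a : ℂ} (ha : ‖a‖ ≤ 1) (h2 : a ^ 2 ≠ 1) :
    bRatio β g₀ g₁ g₀' g₁' a ≠ 0 := by
  have h1 : a ≠ 1 := fun h => h2 (by rw [h, one_pow])
  have h3 : -a ≠ 1 := fun h => h2 (by rw [← neg_sq, h, one_pow])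
  have hn : ‖-a‖ ≤ 1 := by rwa [norm_neg]
  have h4 : halfStep β * a ≠ 1 := exp_mul_ne_one hβ (by norm_num) ha h1
  have h5 : -(halfStep β * a) ≠ 1 := by
    rw [← mul_neg]; exact exp_mul_ne_one hβ (by norm_num) hn h3
  have hl := norm_halfStep_mul_le hβ ha
  exact mul_ne_zero (mul_ne_zero (mul_ne_zero (qRatio_ne_zero hβ hg₀ ha h1)
    (qRatio_ne_zero hβ hg₁ hn h3)) (qRatio_ne_zero hβ hg₀' hl h4))
    (qRatio_ne_zero hβ hg₁' (by rwa [norm_neg]) h5)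

theorem bRatio_norm_le {g₀ g₁ g₀' g₁' : ℝ} (hg₀ : 0 ≤ g₀) (hg₁ : 0 ≤ g₁)
    (hg₀' : 0 ≤ g₀') (hg₁' : 0 ≤ g₁') : ∃ C : ℝ, ∀ β : ℝ, 0 < β → ∀ a : ℂ, ‖a‖ ≤ 1 →
      ‖bRatio β g₀ g₁ g₀' g₁' a‖ ≤ C := by
  obtain ⟨A, hA⟩ := qRatio_norm_le hg₀
  obtain ⟨B, hB⟩ := qRatio_norm_le hg₁
  obtain ⟨C, hC⟩ := qRatio_norm_le hg₀'
  obtain ⟨D, hD⟩ := qRatio_norm_le hg₁'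
  refine ⟨A * B * C * D, fun β hβ a ha => ?_⟩
  have h1 := hA β hβ a ha
  have h2 := hB β hβ (-a) (by rwa [norm_neg])
  have hl := norm_halfStep_mul_le hβ ha
  have h3 := hC β hβ _ hl
  have h4 := hD β hβ (-(halfStep β * a)) (by rwa [norm_neg])
  have hA0 := (norm_nonneg _).trans h1
  have hB0 := (norm_nonneg _).trans h2
  have hC0 := (norm_nonneg _).trans h3
  simp only [bRatio, norm_mul]
  gcongr

/-- The half step tends to `1`, so the primed quotients have the same base in the limit as the
unprimed ones and the exponents add up. -/
theorem bRatio_tendsto {g₀ g₁ g₀' g₁' : ℝ} (hg₀ : 0 ≤ g₀) (hg₁ : 0 ≤ g₁)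
    (hg₀' : 0 ≤ g₀') (hg₁' : 0 ≤ g₁') {a : ℂ} (ha : ‖a‖ ≤ 1) (h2 : a ^ 2 ≠ 1) :
    Tendsto (fun β => ‖bRatio β g₀ g₁ g₀' g₁' a‖) (𝓝[>] 0)
      (𝓝 (‖1 - a‖ ^ (g₀ + g₀') * ‖1 + a‖ ^ (g₁ + g₁'))) := by
  have h1 : a ≠ 1 := fun h => h2 (by rw [h, one_pow])
  have h3 : -a ≠ 1 := fun h => h2 (by rw [← neg_sq, h, one_pow])
  have hn : ‖-a‖ ≤ 1 := by rwa [norm_neg]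
  have hpos : ∀ᶠ β : ℝ in 𝓝[>] 0, 0 < β := self_mem_nhdsWithin
  have hh : Tendsto (fun β => halfStep β * a) (𝓝[>] 0) (𝓝 a) :=
    tendsto_exp_neg_mul (1 / 2) tendsto_const_nhds
  have hl : ∀ᶠ β : ℝ in 𝓝[>] 0, ‖halfStep β * a‖ ≤ 1 :=
    hpos.mono fun β hβ => norm_halfStep_mul_le hβ ha
  have t1 := (qRatio_tendsto hg₀ (f := fun _ => a) tendsto_const_nhds
    (Eventually.of_forall fun _ => ha) h1).norm
  have t2 := (qRatio_tendsto hg₁ (f := fun _ => -a) tendsto_const_nhds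
    (Eventually.of_forall fun _ => hn) h3).norm
  have t3 := (qRatio_tendsto hg₀' hh hl h1).norm
  have t4 := (qRatio_tendsto hg₁' hh.neg (hl.mono fun β h => by rwa [norm_neg]) h3).norm
  have := ((t1.mul t2).mul t3).mul t4
  simp only [Complex.norm_cpow_real, sub_neg_eq_add] at this
  simp only [bRatio, norm_mul]
  refine this.trans_eq ?_
  rw [Real.rpow_add_of_nonneg (norm_nonneg _) hg₀ hg₀',
    Real.rpow_add_of_nonneg (norm_nonneg _) hg₁ hg₁']
  congr 1
  ring

theorem goodWeight_realKoornwinder {β g g₀ g₁ g₀' g₁' : ℝ} (hβ : 0 < β) (hg : 0 ≤ g)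
    (hg₀ : 0 ≤ g₀) (hg₁ : 0 ≤ g₁) (hg₀' : 0 ≤ g₀') (hg₁' : 0 ≤ g₁')
    (hb : ∃ C, ∀ x : Fin n → ℝ, realKoornwinder β g g₀ g₁ g₀' g₁' x ≤ C) :
    GoodWeight (realKoornwinder β g g₀ g₁ g₀' g₁' : (Fin n → ℝ) → ℝ) where
  measurable := by
    unfold realKoornwinder bRatio
    have h := fun g => measurable_qRatio hβ g
    have hp := continuous_phase.measurable
    have m1 : ∀ (g : ℝ) (F : (Fin n → ℝ) → ℂ), Measurable F →
        Measurable fun x => qRatio β g (F x) := fun g F hF => (h g).comp hF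
    have m2 : ∀ F : (Fin n → ℝ) → ℝ, Measurable F → Measurable fun x => phase (F x) :=
      fun F hF => hp.comp hF
    refine Measurable.mul (Finset.measurable_fun_prod _ fun j _ =>
      Finset.measurable_fun_prod _ fun k _ => ?_) (Finset.measurable_fun_prod _ fun j _ => ?_)
    · exact ((m1 _ _ (m2 _ (by fun_prop))).norm.pow_const 2).mul
        ((m1 _ _ (m2 _ (by fun_prop))).norm.pow_const 2)
    · have hj := m2 (fun x => x j) (by fun_prop)
      exact ((((m1 _ _ hj).mul (m1 _ _ hj.neg)).mul (m1 _ _ (hj.const_mul _))).mul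
        (m1 _ _ (hj.const_mul _).neg)).norm.pow_const 2
  nonneg x := by unfold realKoornwinder; positivity
  bounded := hb
  pos := by
    filter_upwards [ae_generic] with x hx
    refine mul_pos (Finset.prod_pos fun j _ => Finset.prod_pos fun k hk => ?_)
      (Finset.prod_pos fun j _ => ?_)
    · have hjk : j ≠ k := (Finset.mem_Ioi.1 hk).ne
      have h1 := qRatio_ne_zero hβ hg (norm_phase _).le (hx.phase_add_ne j k)
      have h2 := qRatio_ne_zero hβ hg (norm_phase _).le (hx.phase_sub_ne hjk)
      positivity
    · have := bRatio_ne_zero hβ hg₀ hg₁ hg₀' hg₁' (norm_phase (x j)).le (hx.phase_sq_ne j)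
      positivity

theorem realKoornwinder_le {g g₀ g₁ g₀' g₁' : ℝ} (hg : 0 ≤ g)
    (hg₀ : 0 ≤ g₀) (hg₁ : 0 ≤ g₁) (hg₀' : 0 ≤ g₀') (hg₁' : 0 ≤ g₁') :
    ∃ C : ℝ, ∀ β : ℝ, 0 < β → ∀ x : Fin n → ℝ, realKoornwinder β g g₀ g₁ g₀' g₁' x ≤ C := by
  obtain ⟨A, hA⟩ := qRatio_norm_le hg
  obtain ⟨B, hB⟩ := bRatio_norm_le hg₀ hg₁ hg₀' hg₁'
  refine ⟨(∏ j : Fin n, ∏ k ∈ Finset.Ioi j, A ^ 2 * A ^ 2) * ∏ j : Fin n, B ^ 2,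
    fun β hβ x => ?_⟩
  unfold realKoornwinder
  gcongr with j _ k _ j _
  · exact hA β hβ _ (norm_phase _).le
  · exact hA β hβ _ (norm_phase _).le
  · exact hB β hβ _ (norm_phase _).le

/-- The weight function of the Jacobi polynomials as a real function. -/
def realJacobi (g G₀ G₁ : ℝ) (x : Fin n → ℝ) : ℝ :=
  (∏ j : Fin n, ∏ k ∈ Finset.Ioi j,
      |Real.sin ((x j + x k) / 2) * Real.sin ((x j - x k) / 2)| ^ (2 * g)) *
    ∏ j : Fin n, |Real.sin (x j / 2)| ^ (2 * G₀) * |Real.cos (x j / 2)| ^ (2 * G₁)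

theorem norm_one_sub_phase (z : ℝ) : ‖1 - phase z‖ = 2 * |Real.sin (z / 2)| := by
  rw [norm_sub_rev, phase, Complex.norm_exp_I_mul_ofReal_sub_one, norm_mul]
  simp

theorem norm_one_add_phase (z : ℝ) : ‖1 + phase z‖ = 2 * |Real.cos (z / 2)| := by
  have h : phase (z + Real.pi) = -phase z := by
    rw [phase, phase, Complex.ofReal_add, mul_add, Complex.exp_add, mul_comm Complex.I (Real.pi : ℂ),
      Complex.exp_pi_mul_I, mul_neg_one]
  have := norm_one_sub_phase (z + Real.pi)
  rw [h, sub_neg_eq_add, add_div, Real.sin_add_pi_div_two] at this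
  exact this

theorem Generic.sin_add_ne {x : Fin n → ℝ} (hx : Generic x) (j k : Fin n) :
    Real.sin ((x j + x k) / 2) ≠ 0 := fun h => by
  have := norm_one_sub_phase (x j + x k)
  rw [h, abs_zero, mul_zero, norm_eq_zero] at this
  exact hx.phase_add_ne j k (sub_eq_zero.1 this).symm

theorem Generic.sin_sub_ne {x : Fin n → ℝ} (hx : Generic x) {j k : Fin n} (hjk : j ≠ k) :
    Real.sin ((x j - x k) / 2) ≠ 0 := fun h => by
  have := norm_one_sub_phase (x j - x k)
  rw [h, abs_zero, mul_zero, norm_eq_zero] at this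
  exact hx.phase_sub_ne hjk (sub_eq_zero.1 this).symm

theorem Generic.sin_ne {x : Fin n → ℝ} (hx : Generic x) (j : Fin n) :
    Real.sin (x j / 2) ≠ 0 := fun h => by
  have := norm_one_sub_phase (x j)
  rw [h, abs_zero, mul_zero, norm_eq_zero] at this
  exact hx.phase_sq_ne j (by rw [(sub_eq_zero.1 this).symm, one_pow])

theorem Generic.cos_ne {x : Fin n → ℝ} (hx : Generic x) (j : Fin n) :
    Real.cos (x j / 2) ≠ 0 := fun h => by
  have := norm_one_add_phase (x j)
  rw [h, abs_zero, mul_zero, norm_eq_zero] at this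
  exact hx.phase_sq_ne j (by rw [← neg_sq, ← eq_neg_of_add_eq_zero_left this, one_pow])

theorem goodWeight_realJacobi {g G₀ G₁ : ℝ} (hg : 0 ≤ g) (hG₀ : 0 ≤ G₀) (hG₁ : 0 ≤ G₁) :
    GoodWeight (realJacobi g G₀ G₁ : (Fin n → ℝ) → ℝ) where
  measurable := by unfold realJacobi; fun_prop
  nonneg x := by unfold realJacobi; positivity
  bounded := by
    refine ⟨1, fun x => ?_⟩
    unfold realJacobi
    have h : ∀ a b : ℝ, |a| ≤ 1 → 0 ≤ b → |a| ^ (2 * b) ≤ 1 := fun a b ha hb =>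
      Real.rpow_le_one (abs_nonneg _) ha (by linarith)
    refine mul_le_one₀ (Finset.prod_le_one (fun j _ => by positivity) fun j _ =>
      Finset.prod_le_one (fun k _ => by positivity) fun k _ => h _ _ ?_ hg) (by positivity)
      (Finset.prod_le_one (fun j _ => by positivity) fun j _ =>
        mul_le_one₀ (h _ _ (Real.abs_sin_le_one _) hG₀) (by positivity)
          (h _ _ (Real.abs_cos_le_one _) hG₁))
    rw [abs_mul]
    exact mul_le_one₀ (Real.abs_sin_le_one _) (abs_nonneg _) (Real.abs_sin_le_one _)
  pos := by
    filter_upwards [ae_generic] with x hx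
    refine mul_pos (Finset.prod_pos fun j _ => Finset.prod_pos fun k hk => ?_)
      (Finset.prod_pos fun j _ => ?_)
    · have h1 := hx.sin_add_ne j k
      have h2 := hx.sin_sub_ne (Finset.mem_Ioi.1 hk).ne
      positivity
    · have h1 := hx.sin_ne j
      have h2 := hx.cos_ne j
      positivity

/-- The limit of Koornwinder's weight function is a constant multiple of the Jacobi weight. -/
def limitConst (n : ℕ) (g G₀ G₁ : ℝ) : ℝ :=
  (∏ j : Fin n, ∏ _k ∈ Finset.Ioi j, ((2 : ℝ) ^ (2 * g)) * (2 : ℝ) ^ (2 * g))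
    * ∏ _j : Fin n, (2 : ℝ) ^ (2 * G₀) * (2 : ℝ) ^ (2 * G₁)

theorem limitConst_pos (n : ℕ) (g G₀ G₁ : ℝ) : 0 < limitConst n g G₀ G₁ := by
  unfold limitConst; positivity

theorem tendsto_realKoornwinder {g g₀ g₁ g₀' g₁' : ℝ} (hg : 0 ≤ g)
    (hg₀ : 0 ≤ g₀) (hg₁ : 0 ≤ g₁) (hg₀' : 0 ≤ g₀') (hg₁' : 0 ≤ g₁') {x : Fin n → ℝ}
    (hx : Generic x) :
    Tendsto (fun β => realKoornwinder β g g₀ g₁ g₀' g₁' x) (𝓝[>] 0)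
      (𝓝 (limitConst n g (g₀ + g₀') (g₁ + g₁') * realJacobi g (g₀ + g₀') (g₁ + g₁') x)) := by
  have sq_rpow : ∀ a b : ℝ, 0 ≤ a → (a ^ b) ^ 2 = a ^ (2 * b) := fun a b ha => by
    rw [mul_comm, Real.rpow_mul ha]; norm_cast
  have h1 : ∀ z : ℝ, phase z ≠ 1 → Tendsto (fun β => ‖qRatio β g (phase z)‖ ^ 2) (𝓝[>] 0)
      (𝓝 (2 ^ (2 * g) * |Real.sin (z / 2)| ^ (2 * g))) := by
    intro z hz
    have := ((qRatio_tendsto hg (f := fun _ => phase z) tendsto_const_nhds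
      (Eventually.of_forall fun _ => (norm_phase z).le) hz).norm).pow 2
    rwa [Complex.norm_cpow_real, norm_one_sub_phase, sq_rpow _ _ (by positivity),
      Real.mul_rpow zero_le_two (abs_nonneg _)] at this
  have h2 : ∀ z : ℝ, phase z ^ 2 ≠ 1 →
      Tendsto (fun β => ‖bRatio β g₀ g₁ g₀' g₁' (phase z)‖ ^ 2) (𝓝[>] 0)
      (𝓝 ((2 ^ (2 * (g₀ + g₀')) * 2 ^ (2 * (g₁ + g₁'))) * (|Real.sin (z / 2)| ^ (2 * (g₀ + g₀'))
        * |Real.cos (z / 2)| ^ (2 * (g₁ + g₁'))))) := by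
    intro z hz
    have := (bRatio_tendsto hg₀ hg₁ hg₀' hg₁' (norm_phase z).le hz).pow 2
    rw [norm_one_sub_phase, norm_one_add_phase, mul_pow, sq_rpow _ _ (by positivity),
      sq_rpow _ _ (by positivity), Real.mul_rpow zero_le_two (abs_nonneg _),
      Real.mul_rpow zero_le_two (abs_nonneg _)] at this
    convert this using 2
    ring
  have key : limitConst n g (g₀ + g₀') (g₁ + g₁') * realJacobi g (g₀ + g₀') (g₁ + g₁') x
      = (∏ j : Fin n, ∏ k ∈ Finset.Ioi j, (2 ^ (2 * g) * |Real.sin ((x j + x k) / 2)| ^ (2 * g))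
        * (2 ^ (2 * g) * |Real.sin ((x j - x k) / 2)| ^ (2 * g)))
        * ∏ j : Fin n, ((2 ^ (2 * (g₀ + g₀')) * 2 ^ (2 * (g₁ + g₁')))
          * (|Real.sin (x j / 2)| ^ (2 * (g₀ + g₀')) * |Real.cos (x j / 2)| ^ (2 * (g₁ + g₁')))) := by
    unfold limitConst realJacobi
    rw [mul_mul_mul_comm, ← Finset.prod_mul_distrib, ← Finset.prod_mul_distrib]
    congr 1
    refine Finset.prod_congr rfl fun j _ => ?_
    rw [← Finset.prod_mul_distrib]
    refine Finset.prod_congr rfl fun k _ => ?_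
    rw [abs_mul, Real.mul_rpow (abs_nonneg _) (abs_nonneg _)]
    ring
  rw [key]
  unfold realKoornwinder
  refine Tendsto.mul (tendsto_finsetProd _ fun j _ => tendsto_finsetProd _ fun k hk =>
    (h1 _ (hx.phase_add_ne j k)).mul (h1 _ (hx.phase_sub_ne (Finset.mem_Ioi.1 hk).ne)))
    (tendsto_finsetProd _ fun j _ => h2 _ (hx.phase_sq_ne j))

theorem GoodWeight.const_mul {v : (Fin n → ℝ) → ℝ} (hv : GoodWeight v) {C : ℝ} (hC : 0 < C) :
    GoodWeight fun x => C * v x where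
  measurable := hv.measurable.const_mul C
  nonneg x := mul_nonneg hC.le (hv.nonneg x)
  bounded := by
    obtain ⟨B, hB⟩ := hv.bounded
    exact ⟨C * B, fun x => mul_le_mul_of_nonneg_left (hB x) hC.le⟩
  pos := hv.pos.mono fun x hx => mul_pos hC hx

end Weights
end KoornwinderJacobi
end

noncomputable section
namespace KoornwinderJacobi
open Filter Topology MeasureTheory

/-! ### Dunkl-type operators and their leading coefficients -/

section Mirrors

variable {n : ℕ}

/-- A reflection in the group of signed permutations with a root `α`, together with a sign that
twists the corresponding divided difference. -/
structure Mirror (n : ℕ) where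
  /-- The reflection. -/
  w : SignedPerm n
  /-- The root. -/
  α : Fin n → ℤ
  /-- The pairing with the coroot. -/
  pair : (Fin n → ℤ) → ℤ
  /-- The twisting sign. -/
  sign : ℤˣ
  act_eq : ∀ μ, act w μ = μ - pair μ • α
  pair_act : ∀ μ, pair (act w μ) = -pair μ
  root_ne : α ≠ 0
  act_root : act w α = -α
  -- Makes `1 - (ε e^{-α})^k` equal to `1 - e^{-kα}`, so the twisted divided difference of a
  -- monomial is again a Laurent polynomial.
  sign_pow : ∀ (μ : Fin n → ℤ) (k : ℕ), pair μ = k → ((sign : ℤ) : ℂ) ^ k = 1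

namespace Mirror

variable (M : Mirror n)

theorem act_act (μ : Fin n → ℤ) : act M.w (act M.w μ) = μ := by
  rw [M.act_eq, M.pair_act, M.act_eq]; simp

theorem act_eq_iff {μ ν : Fin n → ℤ} : act M.w μ = ν ↔ μ = act M.w ν :=
  ⟨fun h => by rw [← h, M.act_act], fun h => by rw [h, M.act_act]⟩

/-- The sum of the monomials on the root string of length `k` below `μ`, those in the interior
counted twice. -/
def string (k : ℕ) (μ : Fin n → ℤ) : LPoly n :=
  ∑ i ∈ Finset.range k, Finsupp.single (μ - (i : ℤ) • M.α) (((M.sign : ℤ) : ℂ) ^ i)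
    + ∑ i ∈ Finset.range k, Finsupp.single (μ - ((i + 1 : ℕ) : ℤ) • M.α) (((M.sign : ℤ) : ℂ) ^ (i + 1))

/-- The divided difference of a monomial. -/
def divMono (μ : Fin n → ℤ) : LPoly n :=
  if 0 ≤ M.pair μ then M.string (M.pair μ).toNat μ
  else -M.string (-M.pair μ).toNat (act M.w μ)

/-- The divided difference `(1 + ε e^{-α}) / (1 - ε e^{-α}) (1 - s)`. -/
def divOp : LPoly n →ₗ[ℂ] LPoly n := Finsupp.linearCombination ℂ M.divMono

/-- The action of a signed permutation on Laurent polynomials. -/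
def _root_.KoornwinderJacobi.actOp (w : SignedPerm n) : LPoly n →ₗ[ℂ] LPoly n :=
  Finsupp.lmapDomain ℂ ℂ (act w)

theorem _root_.KoornwinderJacobi.actOp_apply (w : SignedPerm n) (f : LPoly n) (ν : Fin n → ℤ) :
    actOp w f (act w ν) = f ν :=
  Finsupp.mapDomain_apply (act_injective w) f ν

theorem _root_.KoornwinderJacobi.actOp_single (w : SignedPerm n) (μ : Fin n → ℤ) (c : ℂ) :
    actOp w (Finsupp.single μ c) = Finsupp.single (act w μ) c := by
  simp [actOp, Finsupp.lmapDomain_apply]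

theorem actOp_apply (f : LPoly n) (ν : Fin n → ℤ) : actOp M.w f ν = f (act M.w ν) := by
  conv_lhs => rw [← M.act_act ν]
  rw [KoornwinderJacobi.actOp_apply]

/-- The points of a root string lie on the segment from `μ` to its reflection, so the hull contains
the string and its interior points are not extreme. -/
theorem string_segment {μ : Fin n → ℤ} {k : ℕ} (hk : M.pair μ = k) {i : ℕ} (hi : i ≤ k) :
    (((k - i : ℕ) : ℤ) + (i : ℤ)) • (μ - (i : ℤ) • M.α)
      = ((k - i : ℕ) : ℤ) • μ + (i : ℤ) • act M.w μ := by
  rw [M.act_eq, hk]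
  funext j
  simp only [Pi.smul_apply, Pi.sub_apply, Pi.add_apply, smul_eq_mul]
  push_cast [hi]
  ring

/-- Laurent polynomials supported in the hull of `lam`. -/
def _root_.KoornwinderJacobi.hullSub (lam : Fin n → ℤ) : Submodule ℂ (LPoly n) :=
  Finsupp.supported ℂ ℂ {ν | InHull lam ν}

theorem _root_.KoornwinderJacobi.single_mem_hullSub {lam μ : Fin n → ℤ} (h : InHull lam μ) (c : ℂ) :
    Finsupp.single μ c ∈ hullSub lam := Finsupp.single_mem_supported ℂ c h

theorem _root_.KoornwinderJacobi.inHull_of_mem_support {lam μ : Fin n → ℤ} {f : LPoly n}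
    (hf : f ∈ hullSub lam) (h : f μ ≠ 0) : InHull lam μ :=
  hf (by simpa using h)

theorem inHull_string {lam μ : Fin n → ℤ} {k : ℕ} (hk : M.pair μ = k) (h : InHull lam μ)
    {i : ℕ} (hi : i ≤ k) : InHull lam (μ - (i : ℤ) • M.α) := by
  rcases Nat.eq_zero_or_pos k with h0 | h0
  · have : i = 0 := by omega
    simpa [this] using h
  · exact InHull.segment (by positivity) (by positivity) (by omega)
      (M.string_segment hk hi) h (h.image _)

theorem string_mem {lam μ : Fin n → ℤ} {k : ℕ} (hk : M.pair μ = k) (h : InHull lam μ) :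
    M.string k μ ∈ hullSub lam :=
  Submodule.add_mem _
    (Submodule.sum_mem _ fun _ hi => single_mem_hullSub
      (M.inHull_string hk h (Finset.mem_range.1 hi).le) _)
    (Submodule.sum_mem _ fun _ hi => single_mem_hullSub
      (M.inHull_string hk h (Finset.mem_range.1 hi)) _)

theorem divMono_mem {lam μ : Fin n → ℤ} (h : InHull lam μ) : M.divMono μ ∈ hullSub lam := by
  unfold divMono
  split_ifs with hp
  · exact M.string_mem (by omega) h
  · exact Submodule.neg_mem _ (M.string_mem (by rw [M.pair_act]; omega) (h.image _))

theorem divOp_mem {lam : Fin n → ℤ} {f : LPoly n} (hf : f ∈ hullSub lam) :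
    M.divOp f ∈ hullSub lam := by
  rw [divOp, Finsupp.linearCombination_apply, Finsupp.sum]
  exact Submodule.sum_mem _ fun μ hμ => Submodule.smul_mem _ _ (M.divMono_mem (hf hμ))

theorem _root_.KoornwinderJacobi.actOp_mem {lam : Fin n → ℤ} (w : SignedPerm n) {f : LPoly n}
    (hf : f ∈ hullSub lam) : actOp w f ∈ hullSub lam := by
  rw [← Finsupp.sum_single f, Finsupp.sum, map_sum]
  refine Submodule.sum_mem _ fun μ hμ => ?_
  rw [actOp_single]
  exact single_mem_hullSub ((hf hμ : InHull lam μ).image w) _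

/-- By `InHull.extreme`, interior points of the string never lie on the orbit of `lam`; only its two
endpoints contribute. -/
theorem string_apply {lam μ ν : Fin n → ℤ} {k : ℕ} (hk : M.pair μ = k) (hk0 : 0 < k)
    (h : InHull lam μ) (hν : ν ∈ weylOrbit lam) :
    M.string k μ ν = (if μ = ν then 1 else 0) + (if act M.w μ = ν then 1 else 0) := by
  have hne : ∀ i : ℕ, 0 < i → i < k → μ - (i : ℤ) • M.α ≠ ν := by
    intro i h0 h1 he
    have h2 := InHull.extreme (a := ((k - i : ℕ) : ℤ)) (b := (i : ℤ)) (by omega) (by omega)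
      (M.string_segment hk h1.le) h (h.image M.w) (by rw [he]; exact hν)
    rw [M.act_eq, hk, eq_comm, sub_eq_self, smul_eq_zero] at h2
    rcases h2 with h2 | h2
    · omega
    · exact M.root_ne h2
  simp only [string, Finsupp.add_apply, Finsupp.finsetSum_apply, Finsupp.single_apply]
  congr 1
  · rw [Finset.sum_eq_single_of_mem 0 (Finset.mem_range.2 hk0)]
    · simp
    · intro i hi h0
      rw [if_neg (hne i (by omega) (Finset.mem_range.1 hi))]
  · rw [Finset.sum_eq_single_of_mem (k - 1) (Finset.mem_range.2 (by omega))]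
    · rw [show k - 1 + 1 = k by omega, M.sign_pow μ k hk, M.act_eq, hk]
    · intro i hi h0
      have := Finset.mem_range.1 hi
      rw [if_neg (hne (i + 1) (by omega) (by omega))]

theorem divMono_apply {lam μ ν : Fin n → ℤ} (h : InHull lam μ) (hν : ν ∈ weylOrbit lam) :
    M.divMono μ ν = ((M.pair ν).sign : ℂ)
      * ((if μ = ν then 1 else 0) - (if μ = act M.w ν then 1 else 0)) := by
  have e : ∀ μ, (if act M.w μ = ν then (1 : ℂ) else 0) = if μ = act M.w ν then 1 else 0 :=
    fun μ => by simp only [M.act_eq_iff]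
  rcases lt_trichotomy (M.pair μ) 0 with hp | hp | hp
  · rw [divMono, if_neg (by omega), Finsupp.neg_apply,
      M.string_apply (lam := lam) (by rw [M.pair_act]; omega) (by omega) (h.image _) hν, M.act_act, e]
    by_cases h1 : μ = ν
    · subst h1
      have : μ ≠ act M.w μ := fun h => by have := M.pair_act μ; rw [← h] at this; omega
      simp [this, Int.sign_eq_neg_one_of_neg hp]
    · by_cases h2 : μ = act M.w ν
      · have : M.pair ν = -M.pair μ := by rw [h2, M.pair_act, neg_neg]
        have h3 : ν ≠ μ := fun h => h1 h.symm
        rw [this, Int.sign_eq_one_of_pos (by omega)]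
        simp [h1, ← h2]
      · simp [h1, h2]
  · rw [divMono, if_pos (by omega), hp]
    have : M.string (0 : ℤ).toNat μ = 0 := by simp [string]
    rw [this, Finsupp.zero_apply]
    by_cases h1 : μ = ν
    · subst h1; simp [hp]
    · by_cases h2 : μ = act M.w ν
      · have : M.pair ν = -M.pair μ := by rw [h2, M.pair_act, neg_neg]
        simp [this, hp]
      · simp [h1, h2]
  · rw [divMono, if_pos hp.le, M.string_apply (lam := lam) (by omega) (by omega) h hν, e]
    by_cases h1 : μ = ν
    · subst h1
      have : μ ≠ act M.w μ := fun h => by have := M.pair_act μ; rw [← h] at this; omega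
      simp [this, Int.sign_eq_one_of_pos hp]
    · by_cases h2 : μ = act M.w ν
      · have : M.pair ν = -M.pair μ := by rw [h2, M.pair_act, neg_neg]
        rw [this, Int.sign_eq_neg_one_of_neg (by omega)]
        simp [h1, ← h2]
      · simp [h1, h2]

/-- On extreme exponents the divided difference depends only on the side of the mirror; the rest of
each string goes to other exponents. -/
theorem divOp_apply {lam ν : Fin n → ℤ} {f : LPoly n} (hf : f ∈ hullSub lam)
    (hν : ν ∈ weylOrbit lam) :
    M.divOp f ν = ((M.pair ν).sign : ℂ) * (f ν - f (act M.w ν)) := by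
  rw [divOp, Finsupp.linearCombination_apply, Finsupp.sum, Finsupp.finsetSum_apply]
  have : ∀ μ ∈ f.support, (f μ • M.divMono μ) ν = ((M.pair ν).sign : ℂ)
      * ((if μ = ν then f μ else 0) - (if μ = act M.w ν then f μ else 0)) := by
    intro μ hμ
    rw [Finsupp.smul_apply, M.divMono_apply (hf hμ) hν, smul_eq_mul]
    split_ifs <;> ring
  rw [Finset.sum_congr rfl this, ← Finset.mul_sum, Finset.sum_sub_distrib]
  congr 2
  · simp only [Finset.sum_ite_eq', Finsupp.mem_support_iff, ne_eq, ite_not]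
    split_ifs with h <;> simp [h]
  · simp only [Finset.sum_ite_eq', Finsupp.mem_support_iff, ne_eq, ite_not]
    split_ifs with h <;> simp [h]

/-- A geometric sum in `ε e^{-α}`, with the denominator cleared so that points on the mirror are
included. -/
theorem ev_string_mul (k : ℕ) (μ : Fin n → ℤ) (hk : M.pair μ = k) (x : Fin n → ℝ) :
    (1 - ((M.sign : ℤ) : ℂ) * (character M.α x)⁻¹) * ev (M.string k μ) x
      = (1 + ((M.sign : ℤ) : ℂ) * (character M.α x)⁻¹)
        * (character μ x - character (act M.w μ) x) := by
  have hc : ∀ i : ℕ, character (μ - (i : ℤ) • M.α) x = character μ x * ((character M.α x)⁻¹) ^ i := by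
    intro i
    induction i with
    | zero => simp
    | succ i ih =>
      rw [pow_succ, ← mul_assoc, ← ih, ← character_neg, ← character_add]
      congr 1
      push_cast
      rw [add_smul, one_smul]; abel
  set b := (character M.α x)⁻¹
  set ε := ((M.sign : ℤ) : ℂ)
  have e1 : ev (M.string k μ) x = character μ x * (1 + ε * b) * ∑ i ∈ Finset.range k, (ε * b) ^ i := by
    simp only [string, map_add, map_sum, Pi.add_apply, Finset.sum_apply, ev_single, hc]
    rw [mul_add, mul_one, add_mul, Finset.mul_sum, Finset.mul_sum]
    congr 1 <;> exact Finset.sum_congr rfl fun i _ => by simp only [ε]; ring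
  have e2 : character (act M.w μ) x = character μ x * (ε * b) ^ k := by
    rw [M.act_eq, hk, hc, mul_pow, M.sign_pow μ k hk, one_mul]
  have e3 := mul_neg_geom_sum (ε * b) k
  rw [e1, e2]
  linear_combination character μ x * (1 + ε * b) * e3

theorem ev_divMono_mul (μ : Fin n → ℤ) (x : Fin n → ℝ) :
    (1 - ((M.sign : ℤ) : ℂ) * (character M.α x)⁻¹) * ev (M.divMono μ) x
      = (1 + ((M.sign : ℤ) : ℂ) * (character M.α x)⁻¹)
        * (character μ x - character (act M.w μ) x) := by
  unfold divMono
  split_ifs with hp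
  · exact M.ev_string_mul _ μ (by omega) x
  · have := M.ev_string_mul (-M.pair μ).toNat (act M.w μ) (by rw [M.pair_act]; omega) x
    rw [M.act_act] at this
    rw [map_neg, Pi.neg_apply]
    linear_combination -this

end Mirror

end Mirrors

/-! ### The mirrors moving the first coordinate and the operator built from them -/

section DunklOperator

variable {m : ℕ}

/-- The reflection in `e₀ - e_l`. -/
def swapMirror (l : Fin m) : Mirror (m + 1) where
  w := (Equiv.swap 0 l.succ, 1)
  α := Pi.single 0 1 - Pi.single l.succ 1
  pair μ := μ 0 - μ l.succ
  sign := 1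
  act_eq μ := by
    funext j
    by_cases h0 : j = 0
    · subst h0; simp [act]
    · by_cases h1 : j = l.succ
      · subst h1; simp [act]
      · simp [act, Equiv.swap_apply_of_ne_of_ne h0 h1, h0, h1]
  pair_act μ := by simp [act]
  root_ne h := by
    have := congrFun h 0
    simp at this
  act_root := by
    funext j
    by_cases h0 : j = 0
    · subst h0; simp [act]
    · by_cases h1 : j = l.succ
      · subst h1; simp [act]
      · simp [act, Equiv.swap_apply_of_ne_of_ne h0 h1, h0, h1]
  sign_pow μ k _ := by simp

/-- The reflection in `e₀ + e_l`. -/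
def negSwapMirror (l : Fin m) : Mirror (m + 1) where
  w := (Equiv.swap 0 l.succ, fun j => if j = 0 ∨ j = l.succ then -1 else 1)
  α := Pi.single 0 1 + Pi.single l.succ 1
  pair μ := μ 0 + μ l.succ
  sign := 1
  act_eq μ := by
    funext j
    by_cases h0 : j = 0
    · subst h0; simp [act]
    · by_cases h1 : j = l.succ
      · subst h1; simp [act]
      · simp [act, Equiv.swap_apply_of_ne_of_ne h0 h1, h0, h1]
  pair_act μ := by simp [act]
  root_ne h := by
    have := congrFun h 0
    simp at this
  act_root := by
    funext j
    by_cases h0 : j = 0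
    · subst h0; simp [act]
    · by_cases h1 : j = l.succ
      · subst h1; simp [act]
      · simp [act, Equiv.swap_apply_of_ne_of_ne h0 h1, h0, h1]
  sign_pow μ k _ := by simp

/-- The sign flip of the first coordinate, with twisting sign `ε`. -/
def flipMirror (m : ℕ) (ε : ℤˣ) : Mirror (m + 1) where
  w := (1, fun j => if j = 0 then -1 else 1)
  α := Pi.single 0 1
  pair μ := 2 * μ 0
  sign := ε
  act_eq μ := by
    funext j
    by_cases h0 : j = 0
    · subst h0; simp [act]; ring
    · simp [act, h0]
  pair_act μ := by simp [act]
  root_ne h := by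
    have := congrFun h 0
    simp at this
  act_root := by
    funext j
    by_cases h0 : j = 0
    · subst h0; simp [act]
    · simp [act, h0]
  -- The pairing `2 * μ 0` is even, so the sign `-1` is admissible; it produces the `cos` factor of
  -- the weight.
  sign_pow μ k hk := by
    have : Even k := by
      rw [← Int.even_coe_nat, ← hk]; exact even_two_mul _
    rcases Int.units_eq_one_or ε with rfl | rfl <;> simp [this]

/-- The index set of the mirrors that move the first coordinate. -/
abbrev MirrorIndex (m : ℕ) := (Fin m × Bool) ⊕ Bool

/-- The mirrors that move the first coordinate. -/
def mirror : MirrorIndex m → Mirror (m + 1)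
  | .inl (l, true) => swapMirror l
  | .inl (l, false) => negSwapMirror l
  | .inr true => flipMirror m 1
  | .inr false => flipMirror m (-1)

/-- The multiplicities of the mirrors. -/
def multiplicity (g G₀ G₁ : ℝ) : MirrorIndex m → ℝ
  | .inl _ => g
  | .inr true => G₀
  | .inr false => G₁

/-- The derivative `-i ∂/∂x₀` on Laurent polynomials. -/
def derivOp (m : ℕ) : LPoly (m + 1) →ₗ[ℂ] LPoly (m + 1) :=
  Finsupp.linearCombination ℂ fun μ => Finsupp.single μ (μ 0 : ℂ)

theorem derivOp_single (μ : Fin (m + 1) → ℤ) (c : ℂ) :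
    derivOp m (Finsupp.single μ c) = Finsupp.single μ (c * μ 0) := by
  simp [derivOp]

theorem derivOp_apply (f : LPoly (m + 1)) (ν : Fin (m + 1) → ℤ) :
    derivOp m f ν = ν 0 * f ν := by
  induction f using Finsupp.induction_linear with
  | zero => simp
  | add f h hf hh => rw [map_add, Finsupp.add_apply, hf, hh, Finsupp.add_apply, mul_add]
  | single μ c =>
    rw [derivOp_single, Finsupp.single_apply, Finsupp.single_apply]
    split_ifs with h
    · rw [h, mul_comm]
    · simp

/-- The Dunkl-type operator attached to the first coordinate. -/
def dunkl (g G₀ G₁ : ℝ) : LPoly (m + 1) →ₗ[ℂ] LPoly (m + 1) :=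
  derivOp m + (1 / 2 : ℂ) • ∑ i : MirrorIndex m,
    (multiplicity g G₀ G₁ i : ℂ) • ((mirror i).divOp + actOp (mirror i).w)

theorem dunkl_mem {g G₀ G₁ : ℝ} {lam : Fin (m + 1) → ℤ} {f : LPoly (m + 1)}
    (hf : f ∈ hullSub lam) : dunkl g G₀ G₁ f ∈ hullSub lam := by
  rw [dunkl, LinearMap.add_apply, LinearMap.smul_apply, LinearMap.sum_apply]
  refine Submodule.add_mem _ ?_ (Submodule.smul_mem _ _ (Submodule.sum_mem _ fun i _ =>
    Submodule.smul_mem _ _ (Submodule.add_mem _ ((mirror i).divOp_mem hf) (actOp_mem _ hf))))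
  intro ν hν
  have : derivOp m f ν ≠ 0 := by simpa using hν
  rw [derivOp_apply] at this
  exact inHull_of_mem_support hf (right_ne_zero_of_mul this)

theorem dunkl_apply {g G₀ G₁ : ℝ} {lam ν : Fin (m + 1) → ℤ} {f : LPoly (m + 1)}
    (hf : f ∈ hullSub lam) (hν : ν ∈ weylOrbit lam) :
    dunkl g G₀ G₁ f ν = ν 0 * f ν + (1 / 2 : ℂ) * ∑ i : MirrorIndex m,
      (multiplicity g G₀ G₁ i : ℂ) * ((((mirror i).pair ν).sign : ℂ)
        * (f ν - f (act (mirror i).w ν)) + f (act (mirror i).w ν)) := by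
  rw [dunkl, LinearMap.add_apply, LinearMap.smul_apply, LinearMap.sum_apply, Finsupp.add_apply,
    Finsupp.smul_apply, Finsupp.finsetSum_apply, derivOp_apply, smul_eq_mul]
  congr 2
  refine Finset.sum_congr rfl fun i _ => ?_
  rw [LinearMap.smul_apply, LinearMap.add_apply, Finsupp.smul_apply, Finsupp.add_apply,
    (mirror i).divOp_apply hf hν, (mirror i).actOp_apply, smul_eq_mul]

end DunklOperator
end KoornwinderJacobi
end

noncomputable section
namespace KoornwinderJacobi
open Filter Topology MeasureTheory

/-! ### The operator on extreme coefficients, and its eigenvalues -/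

section LeadingCoefficients

variable {m : ℕ}

/-- The entry of a pair of vectors at a signed position. -/
def entry {n : ℕ} (u : (Fin n → ℝ) × (Fin n → ℝ)) (i : Fin n) (e : ℤˣ) : ℝ :=
  if e = 1 then u.1 i else u.2 i

/-- The shifted weight `lam + ρ`. -/
def shifted (g κ : ℝ) (lam : Fin (m + 1) → ℤ) (i : Fin (m + 1)) : ℝ :=
  lam i + g * ((m : ℝ) - (i : ℕ)) + κ / 2

/-- With the reflection added to the divided difference, the term reduces to the coefficient itself
on the nonnegative side. When the pairing is `0`, both coefficients agree, so the boundary may be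
counted with either side. -/
theorem sign_term_of_nonneg {x : ℤ} {a b : ℝ} (hx : 0 ≤ x) (h : x = 0 → a = b) :
    (x.sign : ℝ) * (a - b) + b = a := by
  rcases hx.eq_or_lt with h0 | h0
  · rw [h h0.symm]; simp
  · rw [Int.sign_eq_one_of_pos h0]; simp

theorem sign_term_of_nonpos {x : ℤ} {a b : ℝ} (hx : x ≤ 0) (h : x = 0 → a = b) :
    (x.sign : ℝ) * (a - b) + b = -a + 2 * b := by
  rcases hx.eq_or_lt with h0 | h0
  · rw [h h0]; simp; ring
  · rw [Int.sign_eq_neg_one_of_neg h0]; simp; ring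

theorem sum_perm_succ (σ : Equiv.Perm (Fin (m + 1))) (F : Fin (m + 1) → ℝ) :
    ∑ l : Fin m, F (σ l.succ) = ∑ j, (if j = σ 0 then 0 else F j) := by
  rw [← Equiv.sum_comp σ, Fin.sum_univ_succ, if_pos rfl, zero_add]
  refine Finset.sum_congr rfl fun l _ => ?_
  rw [if_neg]
  intro h
  exact Fin.succ_ne_zero l (σ.injective h)

theorem card_gt (i : Fin (m + 1)) :
    ∑ j : Fin (m + 1), (if i < j then (1 : ℝ) else 0) = (m : ℝ) - (i : ℕ) := by
  rw [Finset.sum_boole, show (Finset.univ.filter fun j => i < j) = Finset.Ioi i by ext; simp,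
    Fin.card_Ioi]
  rw [Nat.cast_sub (by omega), Nat.cast_sub (by omega)]
  push_cast
  ring

/-- The sum over the mirrors of one row of the leading matrix. -/
theorem leading_row {g G₀ G₁ : ℝ} {lam : Fin (m + 1) → ℤ} (hl : IsDominant lam)
    (u : (Fin (m + 1) → ℝ) × (Fin (m + 1) → ℝ)) (σ : Equiv.Perm (Fin (m + 1)))
    (δ : Fin (m + 1) → ℤˣ)
    (hwd : ∀ l : Fin m, ∀ e : ℤˣ, (δ 0 : ℤ) * lam (σ 0) = e * lam (σ l.succ) →
      entry u (σ 0) (δ 0) = entry u (σ l.succ) e)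
    (hwd0 : (δ 0 : ℤ) * lam (σ 0) = -((δ 0 : ℤ) * lam (σ 0)) →
      entry u (σ 0) (δ 0) = entry u (σ 0) (-δ 0)) :
    (((δ 0 : ℤ) * lam (σ 0) : ℤ) : ℝ) * entry u (σ 0) (δ 0)
      + 1 / 2 * (∑ l : Fin m, g * ∑ e : ℤˣ,
          ((((δ 0 : ℤ) * lam (σ 0) - e * lam (σ l.succ) : ℤ).sign : ℝ)
            * (entry u (σ 0) (δ 0) - entry u (σ l.succ) e) + entry u (σ l.succ) e)
        + (G₀ + G₁) * ((((2 * ((δ 0 : ℤ) * lam (σ 0)) : ℤ).sign : ℝ))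
            * (entry u (σ 0) (δ 0) - entry u (σ 0) (-δ 0)) + entry u (σ 0) (-δ 0)))
      = entry (leadingOp g (G₀ + G₁) (shifted g (G₀ + G₁) lam) u) (σ 0) (δ 0) := by
  have hu : ∀ F : ℤˣ → ℝ, ∑ e : ℤˣ, F e = F 1 + F (-1) := fun F => by
    rw [show (Finset.univ : Finset ℤˣ) = {1, -1} from rfl, Finset.sum_pair (by decide)]
  have hne : (-1 : ℤˣ) ≠ 1 := by decide
  have pos := hl.2
  have hcard := card_gt (σ 0)
  simp only [hu]
  rcases Int.units_eq_one_or (δ 0) with h | h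
  · simp only [h, Units.val_one, one_mul, Units.val_neg, neg_mul, sub_neg_eq_add] at hwd hwd0 ⊢
    -- Combined contribution of the two roots joining coordinate `0` to another one. For positions
    -- after `σ 0` it is diagonal and builds up the `ρ`-shift; for earlier ones it is the
    -- off-diagonal entry of `leadingOp`.
    have row : ∀ l : Fin m, ((((lam (σ 0) - lam (σ l.succ) : ℤ)).sign : ℝ)
          * (entry u (σ 0) 1 - entry u (σ l.succ) 1) + entry u (σ l.succ) 1)
        + ((((lam (σ 0) + lam (σ l.succ) : ℤ)).sign : ℝ)
          * (entry u (σ 0) 1 - entry u (σ l.succ) (-1)) + entry u (σ l.succ) (-1))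
        = (fun j => 2 * u.1 (σ 0) * (if σ 0 < j then 1 else 0)
            + 2 * (if j < σ 0 then u.1 j else 0)) (σ l.succ) := by
      intro l
      have hj : σ l.succ ≠ σ 0 := fun h => Fin.succ_ne_zero l (σ.injective h)
      rw [sign_term_of_nonneg (x := lam (σ 0) + lam (σ l.succ))
        (by linarith [pos (σ 0), pos (σ l.succ)]) (fun h0 => hwd l (-1) (by simp; linarith))]
      rcases lt_or_gt_of_ne hj with hlt | hlt
      · rw [sign_term_of_nonpos (by linarith [hl.1 hlt.le])
          (fun h0 => hwd l 1 (by simp; linarith))]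
        simp [hlt, hlt.not_gt, entry]
      · rw [sign_term_of_nonneg (by linarith [hl.1 hlt.le])
          (fun h0 => hwd l 1 (by simp; linarith))]
        simp [hlt, hlt.not_gt, entry]; ring
    simp only [row]
    rw [← Finset.mul_sum, sum_perm_succ σ (fun j => 2 * u.1 (σ 0) * (if σ 0 < j then 1 else 0)
            + 2 * (if j < σ 0 then u.1 j else 0)),
      sign_term_of_nonneg (by linarith [pos (σ 0)]) (fun h0 => hwd0 (by linarith))]
    have hs : ∑ j, (if j = σ 0 then 0 else 2 * u.1 (σ 0) * (if σ 0 < j then 1 else 0)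
            + 2 * (if j < σ 0 then u.1 j else 0))
        = 2 * u.1 (σ 0) * ((m : ℝ) - (σ 0 : ℕ)) + 2 * ∑ j, (if j < σ 0 then u.1 j else 0) := by
      rw [← hcard, Finset.mul_sum, Finset.mul_sum, ← Finset.sum_add_distrib]
      refine Finset.sum_congr rfl fun j _ => ?_
      rcases lt_trichotomy j (σ 0) with h1 | h1 | h1
      · simp [h1, h1.ne, h1.not_gt]
      · simp [h1]
      · simp [h1, h1.ne', h1.not_gt]
    rw [hs]
    simp only [entry, if_true, leadingOp, LinearMap.coe_mk, AddHom.coe_mk, shifted]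
    ring
  · simp only [h, Units.val_one, one_mul, Units.val_neg, neg_mul, sub_neg_eq_add, neg_neg]
      at hwd hwd0 ⊢
    have row : ∀ l : Fin m, ((((-lam (σ 0) - lam (σ l.succ) : ℤ)).sign : ℝ)
          * (entry u (σ 0) (-1) - entry u (σ l.succ) 1) + entry u (σ l.succ) 1)
        + ((((-lam (σ 0) + lam (σ l.succ) : ℤ)).sign : ℝ)
          * (entry u (σ 0) (-1) - entry u (σ l.succ) (-1)) + entry u (σ l.succ) (-1))
        = (fun j => 2 * u.1 j - 2 * u.2 (σ 0) * (if σ 0 < j then 1 else 0)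
            + 2 * (if σ 0 < j then u.2 j else 0)) (σ l.succ) := by
      intro l
      have hj : σ l.succ ≠ σ 0 := fun h => Fin.succ_ne_zero l (σ.injective h)
      rw [sign_term_of_nonpos (x := -lam (σ 0) - lam (σ l.succ))
        (by linarith [pos (σ 0), pos (σ l.succ)]) (fun h0 => hwd l 1 (by simp; linarith))]
      rcases lt_or_gt_of_ne hj with hlt | hlt
      · rw [sign_term_of_nonneg (by linarith [hl.1 hlt.le])
          (fun h0 => hwd l (-1) (by simp; linarith))]
        simp [hlt.not_gt, entry, hne]
      · rw [sign_term_of_nonpos (by linarith [hl.1 hlt.le])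
          (fun h0 => hwd l (-1) (by simp; linarith))]
        simp [hlt, entry, hne]; ring
    simp only [row]
    rw [← Finset.mul_sum, sum_perm_succ σ (fun j => 2 * u.1 j
          - 2 * u.2 (σ 0) * (if σ 0 < j then 1 else 0) + 2 * (if σ 0 < j then u.2 j else 0)),
      sign_term_of_nonpos (by linarith [pos (σ 0)]) (fun h0 => hwd0 (by linarith))]
    have hs : ∑ j, (if j = σ 0 then 0 else 2 * u.1 j
          - 2 * u.2 (σ 0) * (if σ 0 < j then 1 else 0) + 2 * (if σ 0 < j then u.2 j else 0))
        = 2 * ∑ j, (if j = σ 0 then 0 else u.1 j) - 2 * u.2 (σ 0) * ((m : ℝ) - (σ 0 : ℕ))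
          + 2 * ∑ j, (if σ 0 < j then u.2 j else 0) := by
      rw [← hcard, Finset.mul_sum, Finset.mul_sum, Finset.mul_sum, ← Finset.sum_sub_distrib,
        ← Finset.sum_add_distrib]
      refine Finset.sum_congr rfl fun j _ => ?_
      rcases lt_trichotomy j (σ 0) with h1 | h1 | h1
      · simp [h1.ne, h1.not_gt]
      · simp [h1]
      · simp [h1, h1.ne']
    rw [hs]
    simp only [entry, if_neg hne, if_true, leadingOp, LinearMap.coe_mk, AddHom.coe_mk, shifted]
    push_cast
    ring

/-- Coefficients on the orbit that depend only on the signed entry of `lam` in the first place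
retain this property, and are transformed by `leadingOp` at `lam + ρ`. -/
theorem dunkl_leading {g G₀ G₁ : ℝ} {lam : Fin (m + 1) → ℤ} (hl : IsDominant lam)
    {f : LPoly (m + 1)} (hf : f ∈ hullSub lam) (u : (Fin (m + 1) → ℝ) × (Fin (m + 1) → ℝ))
    (hu : ∀ w : SignedPerm (m + 1), f (act w lam) = (entry u (w.1 0) (w.2 0) : ℂ))
    (w : SignedPerm (m + 1)) :
    dunkl g G₀ G₁ f (act w lam)
      = (entry (leadingOp g (G₀ + G₁) (shifted g (G₀ + G₁) lam) u) (w.1 0) (w.2 0) : ℂ) := by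
  obtain ⟨σ, δ⟩ := w
  have hν : act (σ, δ) lam ∈ weylOrbit lam := mem_weylOrbit.2 ⟨_, rfl⟩
  have f0 : f (act (σ, δ) lam) = (entry u (σ 0) (δ 0) : ℂ) := hu _
  have f1 : ∀ l : Fin m, f (act (swapMirror l).w (act (σ, δ) lam))
      = (entry u (σ l.succ) (δ l.succ) : ℂ) := fun l => by
    rw [← act_comp, hu]; simp [SignedPerm.comp, swapMirror]
  have f2 : ∀ l : Fin m, f (act (negSwapMirror l).w (act (σ, δ) lam))
      = (entry u (σ l.succ) (-δ l.succ) : ℂ) := fun l => by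
    rw [← act_comp, hu]; simp [SignedPerm.comp, negSwapMirror]
  have f3 : ∀ ε, f (act (flipMirror m ε).w (act (σ, δ) lam))
      = (entry u (σ 0) (-δ 0) : ℂ) := fun ε => by
    rw [← act_comp, hu]; simp [SignedPerm.comp, flipMirror]
  -- A zero pairing means that the mirror fixes the exponent. Different signed positions may then
  -- describe one coefficient, so their entries coincide.
  have fix : ∀ (M : Mirror (m + 1)) (a b : ℝ), f (act (σ, δ) lam) = a →
      f (act M.w (act (σ, δ) lam)) = b → M.pair (act (σ, δ) lam) = 0 → a = b := by
    intro M a b ha hb hp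
    rw [M.act_eq, hp, zero_smul, sub_zero] at hb
    exact_mod_cast ha.symm.trans hb
  have eδ : ∀ l : Fin m, ∀ e : ℤˣ, e = δ l.succ ∨ e = -δ l.succ := fun l e => by
    rcases Int.units_eq_one_or e with rfl | rfl <;>
      rcases Int.units_eq_one_or (δ l.succ) with h | h <;> simp [h]
  have row := leading_row (g := g) (G₀ := G₀) (G₁ := G₁) hl u σ δ
    (fun l e he => by
      rcases eδ l e with rfl | rfl
      · exact fix (swapMirror l) _ _ f0 (f1 l) (by simp [swapMirror, act]; linarith)
      · refine fix (negSwapMirror l) _ _ f0 (f2 l) ?_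
        simp only [negSwapMirror, act]
        rw [Units.val_neg] at he
        linarith)
    (fun he => fix (flipMirror m 1) _ _ f0 (f3 1) (by simp only [flipMirror, act]; linarith))
  rw [dunkl_apply hf hν, ← row]
  rw [Fintype.sum_sum_type, Fintype.sum_prod_type]
  simp only [Fintype.sum_bool, mirror, multiplicity, f0, f1, f2, f3]
  have hsum : ∀ l : Fin m, ∀ F : ℤˣ → ℝ, ∑ e : ℤˣ, F e = F (δ l.succ) + F (-δ l.succ) := by
    intro l F
    have : F (δ l.succ) + F (-δ l.succ) = F 1 + F (-1) := by
      rcases Int.units_eq_one_or (δ l.succ) with h | h <;> simp [h, add_comm]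
    rw [this, show (Finset.univ : Finset ℤˣ) = {1, -1} from rfl, Finset.sum_pair (by decide)]
  have e1 : ∀ l : Fin m, (swapMirror l).pair (act (σ, δ) lam)
      = (δ 0 : ℤ) * lam (σ 0) - (δ l.succ : ℤ) * lam (σ l.succ) := fun l => rfl
  have e2 : ∀ l : Fin m, (negSwapMirror l).pair (act (σ, δ) lam)
      = (δ 0 : ℤ) * lam (σ 0) - ((-δ l.succ : ℤˣ) : ℤ) * lam (σ l.succ) := fun l => by
    rw [Units.val_neg, neg_mul, sub_neg_eq_add]; rfl
  have e3 : ∀ ε, (flipMirror m ε).pair (act (σ, δ) lam) = 2 * ((δ 0 : ℤ) * lam (σ 0)) :=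
    fun ε => rfl
  have e4 : act (σ, δ) lam 0 = (δ 0 : ℤ) * lam (σ 0) := rfl
  simp only [e1, e2, e3, e4]
  have row' : ∑ l : Fin m, g * ∑ e : ℤˣ,
        ((((δ 0 : ℤ) * lam (σ 0) - e * lam (σ l.succ) : ℤ).sign : ℝ)
          * (entry u (σ 0) (δ 0) - entry u (σ l.succ) e) + entry u (σ l.succ) e)
      = ∑ l : Fin m, g * (((((δ 0 : ℤ) * lam (σ 0) - δ l.succ * lam (σ l.succ) : ℤ).sign : ℝ)
          * (entry u (σ 0) (δ 0) - entry u (σ l.succ) (δ l.succ)) + entry u (σ l.succ) (δ l.succ))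
        + ((((δ 0 : ℤ) * lam (σ 0) - (-δ l.succ : ℤˣ) * lam (σ l.succ) : ℤ).sign : ℝ)
          * (entry u (σ 0) (δ 0) - entry u (σ l.succ) (-δ l.succ))
            + entry u (σ l.succ) (-δ l.succ))) :=
    Finset.sum_congr rfl fun l _ => by rw [hsum l]
  rw [row']
  push_cast
  simp only [← mul_add]
  ring

theorem dunkl_pow_leading {g G₀ G₁ : ℝ} {lam : Fin (m + 1) → ℤ} (hl : IsDominant lam)
    {f : LPoly (m + 1)} (hf : f ∈ hullSub lam) (hu : ∀ w, f (act w lam) = 1) (k : ℕ) :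
    ((dunkl g G₀ G₁) ^ k) f ∈ hullSub lam ∧ ∀ w, ((dunkl g G₀ G₁) ^ k) f (act w lam)
      = (entry (((leadingOp g (G₀ + G₁) (shifted g (G₀ + G₁) lam)) ^ k) 1) (w.1 0) (w.2 0) : ℂ) := by
  induction k with
  | zero =>
    refine ⟨by simpa using hf, fun w => ?_⟩
    simp [hu, entry]
  | succ k ih =>
    rw [pow_succ', pow_succ', Module.End.mul_apply, Module.End.mul_apply]
    exact ⟨dunkl_mem ih.1, dunkl_leading hl ih.1 _ ih.2⟩

theorem shifted_antitone {g κ : ℝ} (hg : 0 ≤ g) {lam : Fin (m + 1) → ℤ} (hl : IsDominant lam) :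
    Antitone (shifted g κ lam) := by
  intro i j hij
  have h1 : (lam j : ℝ) ≤ lam i := by exact_mod_cast hl.1 hij
  have h2 : ((i : ℕ) : ℝ) ≤ (j : ℕ) := by exact_mod_cast hij
  unfold shifted
  nlinarith

theorem shifted_nonneg {g κ : ℝ} (hg : 0 ≤ g) (hκ : 0 ≤ κ) {lam : Fin (m + 1) → ℤ}
    (hl : IsDominant lam) (i : Fin (m + 1)) : 0 ≤ shifted g κ lam i := by
  have h1 : (0 : ℝ) ≤ lam i := by exact_mod_cast hl.2 i
  have h2 : ((i : ℕ) : ℝ) ≤ m := by exact_mod_cast Nat.lt_succ_iff.1 i.2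
  have h3 : 0 ≤ g * ((m : ℝ) - (i : ℕ)) := mul_nonneg hg (by linarith)
  unfold shifted
  linarith

/-- Every signed position is taken at index `0` by the same number of signed permutations. -/
theorem sum_signedPerm (u : (Fin (m + 1) → ℝ) × (Fin (m + 1) → ℝ)) :
    ∑ w : SignedPerm (m + 1), entry u (w.1 0) (w.2 0)
      = (Fintype.card (Equiv.Perm (Fin m)) * Fintype.card (Fin m → ℤˣ) : ℕ)
        * entrySum (m + 1) u := by
  have h1 : ∀ F : ℤˣ → ℝ, ∑ δ : Fin (m + 1) → ℤˣ, F (δ 0)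
      = (Fintype.card (Fin m → ℤˣ) : ℕ) * ∑ e, F e := by
    intro F
    rw [← (Fin.consEquiv fun _ => ℤˣ).sum_comp, Fintype.sum_prod_type, Finset.mul_sum]
    simp [Fin.consEquiv]
  have h2 : ∀ F : Fin (m + 1) → ℝ, ∑ σ : Equiv.Perm (Fin (m + 1)), F (σ 0)
      = (Fintype.card (Equiv.Perm (Fin m)) : ℕ) * ∑ i, F i := by
    intro F
    rw [← Equiv.Perm.decomposeFin.symm.sum_comp, Fintype.sum_prod_type, Finset.mul_sum]
    simp
  rw [Fintype.sum_prod_type]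
  simp only [h1]
  rw [h2 fun i => ((Fintype.card (Fin m → ℤˣ) : ℕ) : ℝ) * ∑ e, entry u i e, ← Finset.mul_sum]
  have h3 : ∀ i, ∑ e : ℤˣ, entry u i e = u.1 i + u.2 i := fun i => by
    rw [show (Finset.univ : Finset ℤˣ) = {1, -1} from rfl, Finset.sum_pair (by decide)]
    simp [entry, show (-1 : ℤˣ) ≠ 1 by decide]
  simp only [h3, Finset.sum_add_distrib]
  simp only [entrySum, LinearMap.coe_mk, AddHom.coe_mk]
  push_cast
  ring

/-- The leading coefficient of the symmetrized power of the Dunkl-type operator. -/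
def eigenvalue (g κ : ℝ) (lam : Fin (m + 1) → ℤ) (k : ℕ) : ℝ :=
  ∑ w : SignedPerm (m + 1), entry (((leadingOp g κ (shifted g κ lam)) ^ k) 1) (w.1 0) (w.2 0)

theorem eq_of_eigenvalue_eq {g κ : ℝ} (hg : 0 ≤ g) (hκ : 0 ≤ κ) {lam lam' : Fin (m + 1) → ℤ}
    (hl : IsDominant lam) (hl' : IsDominant lam')
    (h : ∀ k, eigenvalue g κ lam k = eigenvalue g κ lam' k) : lam = lam' := by
  have hs : shifted g κ lam = shifted g κ lam' := by
    refine separation hg hκ (shifted_antitone hg hl) (shifted_antitone hg hl')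
      (shifted_nonneg hg hκ hl) (shifted_nonneg hg hκ hl') fun k => ?_
    have := h k
    rw [eigenvalue, eigenvalue, sum_signedPerm, sum_signedPerm] at this
    refine mul_left_cancel₀ ?_ this
    rw [Nat.cast_ne_zero]
    exact (Nat.mul_pos Fintype.card_pos Fintype.card_pos).ne'
  funext i
  have := congrFun hs i
  simp only [shifted, add_left_inj] at this
  exact_mod_cast this

end LeadingCoefficients
end KoornwinderJacobi
end

noncomputable section
namespace KoornwinderJacobi
open Filter Topology MeasureTheory

/-! ### Signed permutations of the torus -/

section TorusAction

variable {n : ℕ}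

/-- The action of a signed permutation on `ℝⁿ`. -/
def actR (w : SignedPerm n) (x : Fin n → ℝ) : Fin n → ℝ := fun j => ((w.2 j : ℤ) : ℝ) * x (w.1 j)

theorem units_mul_self_real (u : ℤˣ) : ((u : ℤ) : ℝ) * (u : ℤ) = 1 := by
  exact_mod_cast units_mul_self_cast u

theorem actR_symm_actR (w : SignedPerm n) (x : Fin n → ℝ) : actR w.symm (actR w x) = x := by
  funext j
  simp [actR, SignedPerm.symm, ← mul_assoc, units_mul_self_real]

theorem actR_actR_symm (w : SignedPerm n) (x : Fin n → ℝ) : actR w (actR w.symm x) = x := by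
  have := actR_symm_actR w.symm x
  rwa [SignedPerm.symm_symm] at this

theorem measurable_actR (w : SignedPerm n) : Measurable (actR w) := by
  unfold actR; fun_prop

/-- A signed permutation as a measurable equivalence. -/
def actEquiv (w : SignedPerm n) : (Fin n → ℝ) ≃ᵐ (Fin n → ℝ) where
  toFun := actR w
  invFun := actR w.symm
  left_inv := actR_symm_actR w
  right_inv := actR_actR_symm w
  measurable_toFun := measurable_actR w
  measurable_invFun := measurable_actR w.symm

theorem character_act (w : SignedPerm n) (μ : Fin n → ℤ) (x : Fin n → ℝ) :
    character (act w μ) x = character μ (actR w.symm x) := by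
  unfold character act actR SignedPerm.symm
  rw [← Equiv.sum_comp w.1⁻¹]
  congr 2
  refine Finset.sum_congr rfl fun j _ => ?_
  simp
  ring

theorem measurePreserving_unit_mul (u : ℤˣ) : MeasurePreserving (fun t : ℝ => ((u : ℤ) : ℝ) * t)
    (volume.restrict (Set.Icc (-Real.pi) Real.pi)) (volume.restrict (Set.Icc (-Real.pi) Real.pi)) := by
  rcases Int.units_eq_one_or u with rfl | rfl
  · simp only [Units.val_one, Int.cast_one, one_mul]
    exact MeasurePreserving.id _
  · have := (Measure.measurePreserving_neg (volume : Measure ℝ)).restrict_preimage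
      (measurableSet_Icc (a := -Real.pi) (b := Real.pi))
    simpa using this

theorem measurePreserving_actR (w : SignedPerm n) :
    MeasurePreserving (actEquiv w) (volume.restrict (cube n)) (volume.restrict (cube n)) := by
  rw [restrict_cube]
  have h1 := measurePreserving_arrowCongr'
    (fun _ : Fin n => (volume.restrict (Set.Icc (-Real.pi) Real.pi) : Measure ℝ))
    (fun _ : Fin n => (volume.restrict (Set.Icc (-Real.pi) Real.pi) : Measure ℝ))
    w.1⁻¹ (MeasurableEquiv.refl ℝ) (fun _ => MeasurePreserving.id _)
  have h2 := measurePreserving_pi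
    (fun _ : Fin n => (volume.restrict (Set.Icc (-Real.pi) Real.pi) : Measure ℝ))
    (fun _ : Fin n => (volume.restrict (Set.Icc (-Real.pi) Real.pi) : Measure ℝ))
    (fun j => measurePreserving_unit_mul (w.2 j))
  exact h2.comp h1

theorem integral_actR (w : SignedPerm n) (F : (Fin n → ℝ) → ℂ) :
    ∫ x in cube n, F (actR w x) = ∫ x in cube n, F x :=
  (measurePreserving_actR w).integral_comp' F

theorem integral_eq_zero_of_odd (w : SignedPerm n) {F : (Fin n → ℝ) → ℂ}
    (h : ∀ᵐ x, F (actR w x) = -F x) : ∫ x in cube n, F x = 0 := by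
  have h1 := integral_actR w F
  rw [integral_congr_ae (ae_restrict_of_ae h), integral_neg] at h1
  exact self_eq_neg.1 h1.symm

end TorusAction

/-! ### The weight with `sin²` and `cos²` replaced by `sin² + ε` and `cos² + ε` -/

section Regularisation

variable {n : ℕ}

/-- Rewrites the sum over `j < k` as one over all pairs, for which permutation invariance is plain.
-/
theorem two_mul_sum_Ioi {a : Fin n → Fin n → ℝ} (h : ∀ j k, a j k = a k j) :
    2 * ∑ j, ∑ k ∈ Finset.Ioi j, a j k = ∑ j, ∑ k, a j k - ∑ j, a j j := by
  have h1 : ∀ j, ∑ k, a j k = ∑ k ∈ Finset.Ioi j, a j k + ∑ k ∈ Finset.Iio j, a j k + a j j := by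
    intro j
    have hu : (Finset.univ : Finset (Fin n)) = Finset.Iio j ∪ ({j} ∪ Finset.Ioi j) := by
      ext k
      simp only [Finset.mem_univ, Finset.mem_union, Finset.mem_Iio, Finset.mem_singleton,
        Finset.mem_Ioi, true_iff]
      exact lt_trichotomy k j
    rw [hu, Finset.sum_union, Finset.sum_union, Finset.sum_singleton]
    · ring
    · simp
    · rw [Finset.disjoint_left]
      intro k hk hk'
      simp only [Finset.mem_union, Finset.mem_Iio, Finset.mem_singleton, Finset.mem_Ioi] at hk hk'
      omega
  have h2 : ∑ j, ∑ k ∈ Finset.Iio j, a j k = ∑ j, ∑ k ∈ Finset.Ioi j, a j k := by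
    rw [Finset.sum_comm' (t' := Finset.univ) (s' := fun k => Finset.Ioi k) (by simp)]
    exact Finset.sum_congr rfl fun j _ => Finset.sum_congr rfl fun k _ => h _ _
  simp only [h1, Finset.sum_add_distrib, h2]
  ring

/-- The regularised logarithm of `sin²`. -/
def logSin (ε θ : ℝ) : ℝ := Real.log (Real.sin θ ^ 2 + ε)

/-- The regularised logarithm of `cos²`. -/
def logCos (ε θ : ℝ) : ℝ := Real.log (Real.cos θ ^ 2 + ε)

theorem logSin_neg (ε θ : ℝ) : logSin ε (-θ) = logSin ε θ := by simp [logSin]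

theorem logCos_neg (ε θ : ℝ) : logCos ε (-θ) = logCos ε θ := by simp [logCos]

/-- The contribution of a pair of coordinates to the logarithm of the weight. -/
def pairLog (ε s t : ℝ) : ℝ := logSin ε ((s + t) / 2) + logSin ε ((s - t) / 2)

theorem pairLog_comm (ε s t : ℝ) : pairLog ε s t = pairLog ε t s := by
  unfold pairLog
  rw [add_comm s t, ← logSin_neg ε ((s - t) / 2)]
  congr 2; ring

theorem pairLog_neg_right (ε s t : ℝ) : pairLog ε s (-t) = pairLog ε s t := by
  unfold pairLog
  rw [sub_neg_eq_add, ← sub_eq_add_neg, add_comm]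

/-- The contribution of a single coordinate to the logarithm of the weight. -/
def singleLog (G₀ G₁ ε t : ℝ) : ℝ := G₀ * logSin ε (t / 2) + G₁ * logCos ε (t / 2)

theorem singleLog_neg (G₀ G₁ ε t : ℝ) : singleLog G₀ G₁ ε (-t) = singleLog G₀ G₁ ε t := by
  unfold singleLog
  rw [neg_div, logSin_neg, logCos_neg]

/-- The regularised logarithm of the weight function. -/
def logWeight (g G₀ G₁ ε : ℝ) (x : Fin n → ℝ) : ℝ :=
  g * ∑ j, ∑ k ∈ Finset.Ioi j, pairLog ε (x j) (x k) + ∑ j, singleLog G₀ G₁ ε (x j)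

theorem logWeight_actR (g G₀ G₁ ε : ℝ) (w : SignedPerm n) (x : Fin n → ℝ) :
    logWeight g G₀ G₁ ε (actR w x) = logWeight g G₀ G₁ ε x := by
  have hp : ∀ j k, pairLog ε (actR w x j) (actR w x k) = pairLog ε (x (w.1 j)) (x (w.1 k)) := by
    have h1 : ∀ (u : ℤˣ) (s t : ℝ), pairLog ε s ((u : ℤ) * t) = pairLog ε s t := by
      intro u s t
      rcases Int.units_eq_one_or u with rfl | rfl
      · simp
      · simpa using pairLog_neg_right ε s t
    intro j k
    rw [actR, actR, h1, pairLog_comm, h1, pairLog_comm]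
  have hs : ∀ j, singleLog G₀ G₁ ε (actR w x j) = singleLog G₀ G₁ ε (x (w.1 j)) := by
    intro j
    unfold actR
    rcases Int.units_eq_one_or (w.2 j) with h | h
    · simp [h]
    · simpa [h] using singleLog_neg G₀ G₁ ε _
  have h2 : 2 * ∑ j, ∑ k ∈ Finset.Ioi j, pairLog ε (actR w x j) (actR w x k)
      = 2 * ∑ j, ∑ k ∈ Finset.Ioi j, pairLog ε (x j) (x k) := by
    rw [two_mul_sum_Ioi (a := fun j k => pairLog ε (actR w x j) (actR w x k))
        (fun _ _ => pairLog_comm _ _ _),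
      two_mul_sum_Ioi (a := fun j k => pairLog ε (x j) (x k)) (fun _ _ => pairLog_comm _ _ _)]
    simp only [hp]
    congr 1
    · rw [← Equiv.sum_comp w.1 (fun j => ∑ k, pairLog ε (x j) (x k))]
      exact Finset.sum_congr rfl fun j _ =>
        Equiv.sum_comp w.1 (fun k => pairLog ε (x (w.1 j)) (x k))
    · exact Equiv.sum_comp w.1 (fun j => pairLog ε (x j) (x j))
  unfold logWeight
  rw [mul_left_cancel₀ two_ne_zero h2]
  congr 1
  simp only [hs]
  exact Equiv.sum_comp w.1 (fun j => singleLog G₀ G₁ ε (x j))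

theorem sin_sq_add_pos {ε : ℝ} (hε : 0 < ε) (θ : ℝ) : 0 < Real.sin θ ^ 2 + ε := by positivity

theorem cos_sq_add_pos {ε : ℝ} (hε : 0 < ε) (θ : ℝ) : 0 < Real.cos θ ^ 2 + ε := by positivity

theorem contDiff_logSin {ε : ℝ} (hε : 0 < ε) : ContDiff ℝ 1 (logSin ε) :=
  ((Real.contDiff_sin.pow 2).add contDiff_const).log fun θ => (sin_sq_add_pos hε θ).ne'

theorem contDiff_logCos {ε : ℝ} (hε : 0 < ε) : ContDiff ℝ 1 (logCos ε) :=
  ((Real.contDiff_cos.pow 2).add contDiff_const).log fun θ => (cos_sq_add_pos hε θ).ne'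

/-- The purpose of `ε`: for small exponents the Jacobi weight itself need not be differentiable on
the mirrors. -/
theorem contDiff_logWeight (g G₀ G₁ : ℝ) {ε : ℝ} (hε : 0 < ε) :
    ContDiff ℝ 1 (logWeight g G₀ G₁ ε : (Fin n → ℝ) → ℝ) := by
  unfold logWeight pairLog singleLog
  have h1 := contDiff_logSin hε
  have h2 := contDiff_logCos hε
  fun_prop

/-- The regularised weight function. -/
def regWeight (g G₀ G₁ ε : ℝ) (x : Fin n → ℝ) : ℝ := Real.exp (logWeight g G₀ G₁ ε x)

theorem regWeight_actR (g G₀ G₁ ε : ℝ) (w : SignedPerm n) (x : Fin n → ℝ) :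
    regWeight g G₀ G₁ ε (actR w x) = regWeight g G₀ G₁ ε x := by
  rw [regWeight, logWeight_actR, regWeight]

theorem contDiff_regWeight (g G₀ G₁ : ℝ) {ε : ℝ} (hε : 0 < ε) :
    ContDiff ℝ 1 (regWeight g G₀ G₁ ε : (Fin n → ℝ) → ℝ) :=
  (contDiff_logWeight g G₀ G₁ hε).exp

theorem regWeight_eq {g G₀ G₁ ε : ℝ} (hε : 0 < ε) (x : Fin n → ℝ) :
    regWeight g G₀ G₁ ε x = (∏ j : Fin n, ∏ k ∈ Finset.Ioi j,
        (Real.sin ((x j + x k) / 2) ^ 2 + ε) ^ g * (Real.sin ((x j - x k) / 2) ^ 2 + ε) ^ g) *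
      ∏ j : Fin n, (Real.sin (x j / 2) ^ 2 + ε) ^ G₀ * (Real.cos (x j / 2) ^ 2 + ε) ^ G₁ := by
  unfold regWeight logWeight
  rw [Real.exp_add, Finset.mul_sum, Real.exp_sum, Real.exp_sum]
  congr 1
  · refine Finset.prod_congr rfl fun j _ => ?_
    rw [Finset.mul_sum, Real.exp_sum]
    refine Finset.prod_congr rfl fun k _ => ?_
    rw [Real.rpow_def_of_pos (sin_sq_add_pos hε _), Real.rpow_def_of_pos (sin_sq_add_pos hε _),
      ← Real.exp_add, pairLog, logSin, logSin]
    congr 1; ring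
  · refine Finset.prod_congr rfl fun k _ => ?_
    rw [Real.rpow_def_of_pos (sin_sq_add_pos hε _), Real.rpow_def_of_pos (cos_sq_add_pos hε _),
      ← Real.exp_add, singleLog, logSin, logCos]
    congr 1; ring

theorem tendsto_regWeight {g G₀ G₁ : ℝ} (hg : 0 ≤ g) (hG₀ : 0 ≤ G₀) (hG₁ : 0 ≤ G₁)
    (x : Fin n → ℝ) : Tendsto (fun ε => regWeight g G₀ G₁ ε x) (𝓝[>] 0)
      (𝓝 (realJacobi g G₀ G₁ x)) := by
  have h : ∀ s a : ℝ, 0 ≤ a → Tendsto (fun ε => (s ^ 2 + ε) ^ a) (𝓝[>] 0) (𝓝 (|s| ^ (2 * a))) := by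
    intro s a ha
    have h1 : Tendsto (fun ε : ℝ => s ^ 2 + ε) (𝓝[>] 0) (𝓝 (s ^ 2)) := by
      have : Tendsto (fun ε : ℝ => s ^ 2 + ε) (𝓝 0) (𝓝 (s ^ 2 + 0)) := tendsto_id.const_add _
      rw [add_zero] at this
      exact this.mono_left nhdsWithin_le_nhds
    have h2 : |s| ^ (2 * a) = (s ^ 2) ^ a := by
      rw [Real.rpow_mul (abs_nonneg _)]; norm_cast; rw [sq_abs]
    rw [h2]
    exact h1.rpow_const (Or.inr ha)
  have h3 : realJacobi g G₀ G₁ x = (∏ j : Fin n, ∏ k ∈ Finset.Ioi j,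
        |Real.sin ((x j + x k) / 2)| ^ (2 * g) * |Real.sin ((x j - x k) / 2)| ^ (2 * g)) *
      ∏ j : Fin n, |Real.sin (x j / 2)| ^ (2 * G₀) * |Real.cos (x j / 2)| ^ (2 * G₁) := by
    unfold realJacobi
    simp only [abs_mul, Real.mul_rpow (abs_nonneg _) (abs_nonneg _)]
  rw [h3]
  refine Tendsto.congr' (f₁ := fun ε => (∏ j : Fin n, ∏ k ∈ Finset.Ioi j,
        (Real.sin ((x j + x k) / 2) ^ 2 + ε) ^ g * (Real.sin ((x j - x k) / 2) ^ 2 + ε) ^ g) *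
      ∏ j : Fin n, (Real.sin (x j / 2) ^ 2 + ε) ^ G₀ * (Real.cos (x j / 2) ^ 2 + ε) ^ G₁) ?_ ?_
  · filter_upwards [self_mem_nhdsWithin] with ε hε
    exact (regWeight_eq hε x).symm
  · exact (tendsto_finsetProd _ fun j _ => tendsto_finsetProd _ fun k _ =>
      (h _ _ hg).mul (h _ _ hg)).mul
      (tendsto_finsetProd _ fun j _ => (h _ _ hG₀).mul (h _ _ hG₁))

theorem realJacobi_actR {g G₀ G₁ : ℝ} (hg : 0 ≤ g) (hG₀ : 0 ≤ G₀) (hG₁ : 0 ≤ G₁)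
    (w : SignedPerm n) (x : Fin n → ℝ) :
    realJacobi g G₀ G₁ (actR w x) = realJacobi g G₀ G₁ x := by
  refine tendsto_nhds_unique (tendsto_regWeight hg hG₀ hG₁ (actR w x)) ?_
  simpa only [regWeight_actR] using tendsto_regWeight hg hG₀ hG₁ x

theorem regWeight_le {g G₀ G₁ : ℝ} (hg : 0 ≤ g) (hG₀ : 0 ≤ G₀) (hG₁ : 0 ≤ G₁) :
    ∃ C : ℝ, ∀ ε : ℝ, 0 < ε → ε ≤ 1 → ∀ x : Fin n → ℝ, regWeight g G₀ G₁ ε x ≤ C := by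
  refine ⟨(∏ j : Fin n, ∏ k ∈ Finset.Ioi j, 2 ^ g * 2 ^ g) * ∏ j : Fin n, 2 ^ G₀ * 2 ^ G₁, ?_⟩
  intro ε hε hε1 x
  rw [regWeight_eq hε]
  have hs : ∀ θ : ℝ, Real.sin θ ^ 2 + ε ≤ 2 := fun θ => by linarith [Real.sin_sq_le_one θ]
  have hc : ∀ θ : ℝ, Real.cos θ ^ 2 + ε ≤ 2 := fun θ => by linarith [Real.cos_sq_le_one θ]
  gcongr with j _ k _ j _
  · exact hs _
  · exact hs _
  · exact hs _
  · exact hc _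

end Regularisation
end KoornwinderJacobi
end

noncomputable section
namespace KoornwinderJacobi
open Filter Topology MeasureTheory

/-! ### Integration by parts -/

section IntegrationByParts

variable {m : ℕ}

/-- Half the linear form given by the root of a mirror. -/
def Mirror.angle {n : ℕ} (M : Mirror n) (x : Fin n → ℝ) : ℝ := (∑ j, (M.α j : ℝ) * x j) / 2

/-- The regularised (co)tangent attached to a mirror. -/
def Mirror.regCot {n : ℕ} (M : Mirror n) (ε : ℝ) (x : Fin n → ℝ) : ℝ :=
  if M.sign = 1 then
    Real.sin (M.angle x) * Real.cos (M.angle x) / (Real.sin (M.angle x) ^ 2 + ε)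
  else -(Real.sin (M.angle x) * Real.cos (M.angle x) / (Real.cos (M.angle x) ^ 2 + ε))

theorem Mirror.regCot_of_sign {n : ℕ} {M : Mirror n} (h : M.sign = 1) (ε : ℝ) (x : Fin n → ℝ) :
    M.regCot ε x
      = Real.sin (M.angle x) * Real.cos (M.angle x) / (Real.sin (M.angle x) ^ 2 + ε) := if_pos h

theorem Mirror.regCot_of_sign_ne {n : ℕ} {M : Mirror n} (h : M.sign ≠ 1) (ε : ℝ) (x : Fin n → ℝ) :
    M.regCot ε x
      = -(Real.sin (M.angle x) * Real.cos (M.angle x) / (Real.cos (M.angle x) ^ 2 + ε)) := if_neg h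

theorem logWeight_succ (g G₀ G₁ ε : ℝ) (x : Fin (m + 1) → ℝ) :
    logWeight g G₀ G₁ ε x = g * ∑ l : Fin m, pairLog ε (x 0) (x l.succ) + singleLog G₀ G₁ ε (x 0)
      + logWeight g G₀ G₁ ε (fun l => x l.succ) := by
  unfold logWeight
  simp only [Fin.sum_univ_succ, Fin.sum_Ioi_zero, Fin.sum_Ioi_succ]
  ring

theorem hasDerivAt_logSin {ε : ℝ} (hε : 0 < ε) (θ : ℝ) : HasDerivAt (logSin ε)
    (2 * (Real.sin θ * Real.cos θ / (Real.sin θ ^ 2 + ε))) θ := by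
  have := ((((Real.hasDerivAt_sin θ).fun_pow 2).add_const ε)).log (sin_sq_add_pos hε θ).ne'
  refine this.congr_deriv ?_
  push_cast; ring

theorem hasDerivAt_logCos {ε : ℝ} (hε : 0 < ε) (θ : ℝ) : HasDerivAt (logCos ε)
    (2 * -(Real.sin θ * Real.cos θ / (Real.cos θ ^ 2 + ε))) θ := by
  have := ((((Real.hasDerivAt_cos θ).fun_pow 2).add_const ε)).log (cos_sq_add_pos hε θ).ne'
  refine this.congr_deriv ?_
  push_cast; ring

theorem add_smul_single_zero (x : Fin (m + 1) → ℝ) (t : ℝ) :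
    (x + t • Pi.single 0 1 : Fin (m + 1) → ℝ) 0 = x 0 + t := by simp

theorem add_smul_single_succ (x : Fin (m + 1) → ℝ) (t : ℝ) (l : Fin m) :
    (x + t • Pi.single 0 1 : Fin (m + 1) → ℝ) l.succ = x l.succ := by simp

theorem angle_swapMirror (l : Fin m) (x : Fin (m + 1) → ℝ) :
    (swapMirror l).angle x = (x 0 - x l.succ) / 2 := by
  simp [Mirror.angle, swapMirror, sub_mul, Finset.sum_sub_distrib, Pi.single_apply]

theorem angle_negSwapMirror (l : Fin m) (x : Fin (m + 1) → ℝ) :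
    (negSwapMirror l).angle x = (x 0 + x l.succ) / 2 := by
  simp [Mirror.angle, negSwapMirror, add_mul, Finset.sum_add_distrib, Pi.single_apply]

theorem angle_flipMirror (ε : ℤˣ) (x : Fin (m + 1) → ℝ) :
    (flipMirror m ε).angle x = x 0 / 2 := by
  simp [Mirror.angle, flipMirror, Pi.single_apply]

/-- Only factors involving the first coordinate contribute, one regularised cotangent or tangent for
each mirror. -/
theorem hasLineDerivAt_logWeight (g G₀ G₁ : ℝ) {ε : ℝ} (hε : 0 < ε) (x : Fin (m + 1) → ℝ) :
    HasLineDerivAt ℝ (logWeight g G₀ G₁ ε)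
      (∑ i : MirrorIndex m, multiplicity g G₀ G₁ i * (mirror i).regCot ε x) x (Pi.single 0 1) := by
  unfold HasLineDerivAt
  simp only [logWeight_succ, add_smul_single_zero, add_smul_single_succ]
  have hs : ∀ c : ℝ, HasDerivAt (fun t => (x 0 + t + c) / 2) (1 / 2) 0 := fun c =>
    (((hasDerivAt_id (0 : ℝ)).const_add (x 0)).add_const c).div_const 2
  have hL : ∀ c : ℝ, HasDerivAt (fun t => logSin ε ((x 0 + t + c) / 2))
      (Real.sin ((x 0 + c) / 2) * Real.cos ((x 0 + c) / 2) / (Real.sin ((x 0 + c) / 2) ^ 2 + ε)) 0 := by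
    intro c
    have := (hasDerivAt_logSin hε ((x 0 + 0 + c) / 2)).comp 0 (hs c)
    refine this.congr_deriv ?_
    rw [add_zero]; ring
  have hC : HasDerivAt (fun t => logCos ε ((x 0 + t) / 2))
      (-(Real.sin (x 0 / 2) * Real.cos (x 0 / 2) / (Real.cos (x 0 / 2) ^ 2 + ε))) 0 := by
    have h0 := hs 0
    simp only [add_zero] at h0
    have := (hasDerivAt_logCos hε ((x 0 + 0) / 2)).comp 0 h0
    refine this.congr_deriv ?_
    rw [add_zero]; ring
  have hS := hL 0
  simp only [add_zero] at hS
  have hP : ∀ l : Fin m, HasDerivAt (fun t => pairLog ε (x 0 + t) (x l.succ))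
      ((negSwapMirror l).regCot ε x + (swapMirror l).regCot ε x) 0 := by
    intro l
    have h1 := (hL (x l.succ)).add (hL (-x l.succ))
    refine h1.congr_deriv ?_
    rw [Mirror.regCot_of_sign (M := negSwapMirror l) rfl, Mirror.regCot_of_sign (M := swapMirror l) rfl, angle_swapMirror, angle_negSwapMirror,
      sub_eq_add_neg]
  have := (((HasDerivAt.fun_sum fun l (_ : l ∈ Finset.univ) => hP l).const_mul g).add
    ((hS.const_mul G₀).add (hC.const_mul G₁))).add_const (logWeight g G₀ G₁ ε fun l => x l.succ)
  refine this.congr_deriv ?_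
  rw [Fintype.sum_sum_type, Fintype.sum_prod_type]
  simp only [Fintype.sum_bool, multiplicity, mirror]
  have hf1 : (flipMirror m 1).regCot ε x
      = Real.sin (x 0 / 2) * Real.cos (x 0 / 2) / (Real.sin (x 0 / 2) ^ 2 + ε) := by
    rw [Mirror.regCot_of_sign (M := flipMirror m 1) rfl, angle_flipMirror]
  have hf2 : (flipMirror m (-1)).regCot ε x
      = -(Real.sin (x 0 / 2) * Real.cos (x 0 / 2) / (Real.cos (x 0 / 2) ^ 2 + ε)) := by
    rw [Mirror.regCot_of_sign_ne (by simp [flipMirror]), angle_flipMirror]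
  rw [hf1, hf2, Finset.mul_sum]
  congr 1
  exact Finset.sum_congr rfl fun l _ => by ring

theorem character_succ (μ : Fin (m + 1) → ℤ) (x : Fin (m + 1) → ℝ) : character μ x =
    Complex.exp (Complex.I * μ 0 * x 0) * character (fun l => μ l.succ) (fun l => x l.succ) := by
  rw [character, character, ← Complex.exp_add, Fin.sum_univ_succ]
  congr 1; ring

theorem hasLineDerivAt_character (μ : Fin (m + 1) → ℤ) (x : Fin (m + 1) → ℝ) :
    HasLineDerivAt ℝ (character μ) (Complex.I * μ 0 * character μ x) x (Pi.single 0 1) := by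
  unfold HasLineDerivAt
  simp only [character_succ, add_smul_single_zero, add_smul_single_succ]
  have h1 : HasDerivAt (fun t : ℝ => Complex.I * μ 0 * ((x 0 + t : ℝ) : ℂ)) (Complex.I * μ 0) 0 := by
    have := (((hasDerivAt_id (0 : ℝ)).const_add (x 0)).ofReal_comp).const_mul (Complex.I * μ 0)
    simpa using this
  refine (h1.cexp.mul_const _).congr_deriv ?_
  rw [add_zero]; ring

theorem contDiff_character (μ : Fin (m + 1) → ℤ) : ContDiff ℝ 1 (character μ) := by
  unfold character
  have : ∀ j : Fin (m + 1), ContDiff ℝ 1 fun x : Fin (m + 1) → ℝ => ((x j : ℝ) : ℂ) := fun j =>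
    Complex.ofRealCLM.contDiff.comp (contDiff_apply ℝ ℝ j)
  fun_prop

theorem character_cons_pi (μ : Fin (m + 1) → ℤ) (y : Fin m → ℝ) :
    character μ (Fin.cons Real.pi y) = character μ (Fin.cons (-Real.pi) y) := by
  rw [character_succ, character_succ]
  simp only [Fin.cons_zero, Fin.cons_succ]
  congr 1
  rw [Complex.exp_eq_exp_iff_exists_int]
  exact ⟨μ 0, by push_cast; ring⟩

theorem logSin_add_pi (ε θ : ℝ) : logSin ε (θ + Real.pi) = logSin ε θ := by
  simp [logSin, Real.sin_add_pi]

theorem logCos_add_pi (ε θ : ℝ) : logCos ε (θ + Real.pi) = logCos ε θ := by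
  simp [logCos, Real.cos_add_pi]

theorem regWeight_cons_pi (g G₀ G₁ ε : ℝ) (y : Fin m → ℝ) :
    regWeight g G₀ G₁ ε (Fin.cons Real.pi y : Fin (m + 1) → ℝ)
      = regWeight g G₀ G₁ ε (Fin.cons (-Real.pi) y : Fin (m + 1) → ℝ) := by
  unfold regWeight
  rw [logWeight_succ, logWeight_succ]
  simp only [Fin.cons_zero, Fin.cons_succ]
  have hp : ∀ t, pairLog ε Real.pi t = pairLog ε (-Real.pi) t := by
    intro t
    rw [pairLog, pairLog, ← logSin_add_pi ε ((-Real.pi + t) / 2), ← logSin_add_pi ε ((-Real.pi - t) / 2)]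
    congr 2 <;> ring
  have hs : singleLog G₀ G₁ ε Real.pi = singleLog G₀ G₁ ε (-Real.pi) := by
    rw [singleLog, singleLog, ← logSin_add_pi ε (-Real.pi / 2), ← logCos_add_pi ε (-Real.pi / 2)]
    congr 3 <;> ring
  simp only [hp, hs]

/-- The divergence theorem for the vector field `(G, 0, …, 0)`: periodicity cancels the two opposite
faces. -/
theorem integral_fderiv_single_zero {G : (Fin (m + 1) → ℝ) → ℂ} (hG : ContDiff ℝ 1 G)
    (hper : ∀ y : Fin m → ℝ, G (Fin.cons Real.pi y) = G (Fin.cons (-Real.pi) y)) :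
    ∫ x in cube (m + 1), fderiv ℝ G x (Pi.single 0 1) = 0 := by
  have hc : Continuous fun x => fderiv ℝ G x (Pi.single 0 1) :=
    (hG.continuous_fderiv one_ne_zero).clm_apply continuous_const
  have h := integral_divergence_of_hasFDerivAt_off_countable'
    (fun _ : Fin (m + 1) => -Real.pi) (fun _ => Real.pi)
    (fun _ => by linarith [Real.pi_pos])
    (Fin.cons G fun _ _ => 0) (Fin.cons (fderiv ℝ G) fun _ _ => 0) ∅ Set.countable_empty
    (fun i => by
      refine Fin.cases ?_ (fun l => ?_) i
      · simpa using hG.continuous.continuousOn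
      · simpa using continuousOn_const)
    (fun x _ i => by
      refine Fin.cases ?_ (fun l => ?_) i
      · simpa using (hG.differentiable one_ne_zero x).hasFDerivAt
      · simpa using hasFDerivAt_const _ _)
    (by
      simp only [Fin.sum_univ_succ, Fin.cons_zero, Fin.cons_succ]
      simpa using hc.integrableOn_Icc)
  simp only [Fin.sum_univ_succ, Fin.cons_zero, Fin.cons_succ, zero_apply,
    Finset.sum_const_zero, add_zero, integral_zero, Fin.insertNth_zero', hper, sub_self] at h
  exact h

theorem integral_character_mul_regWeight (g G₀ G₁ : ℝ) {ε : ℝ} (hε : 0 < ε)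
    (μ : Fin (m + 1) → ℤ) :
    ∫ x in cube (m + 1), (Complex.I * μ 0
      + ∑ i : MirrorIndex m, (multiplicity g G₀ G₁ i : ℂ) * ((mirror i).regCot ε x : ℝ))
        * (character μ x * (regWeight g G₀ G₁ ε x : ℝ)) = 0 := by
  have hG : ContDiff ℝ 1 fun x : Fin (m + 1) → ℝ => character μ x * (regWeight g G₀ G₁ ε x : ℝ) :=
    (contDiff_character μ).mul (Complex.ofRealCLM.contDiff.comp (contDiff_regWeight g G₀ G₁ hε))
  rw [← integral_fderiv_single_zero hG fun y => by rw [character_cons_pi, regWeight_cons_pi]]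
  refine integral_congr_ae (Eventually.of_forall fun x => ?_)
  have h1 : HasLineDerivAt ℝ (fun x => (regWeight g G₀ G₁ ε x : ℂ))
      (((regWeight g G₀ G₁ ε x
        * ∑ i : MirrorIndex m, multiplicity g G₀ G₁ i * (mirror i).regCot ε x : ℝ) : ℂ)) x
      (Pi.single 0 1) := by
    have := (HasDerivAt.exp (hasLineDerivAt_logWeight g G₀ G₁ hε x)).ofReal_comp
    simpa [regWeight, HasLineDerivAt] using this
  have h2 : HasLineDerivAt ℝ (fun x => character μ x * (regWeight g G₀ G₁ ε x : ℂ)) _ x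
      (Pi.single 0 1) := HasDerivAt.mul (hasLineDerivAt_character μ x) h1
  have h3 := ((hG.differentiable one_ne_zero x).hasFDerivAt.hasLineDerivAt (Pi.single 0 1)).unique h2
  simp only
  rw [h3]
  simp only [zero_smul, add_zero]
  push_cast
  ring

end IntegrationByParts
end KoornwinderJacobi
end

noncomputable section
namespace KoornwinderJacobi
open Filter Topology MeasureTheory

/-! ### Symmetry of the Dunkl-type operator -/

section Symmetry

theorem sum_mul_actR {n : ℕ} (w : SignedPerm n) (μ : Fin n → ℤ) (x : Fin n → ℝ) :
    ∑ j, (μ j : ℝ) * actR w.symm x j = ∑ j, (act w μ j : ℝ) * x j := by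
  rw [← Equiv.sum_comp w.1]
  refine Finset.sum_congr rfl fun j _ => ?_
  simp [actR, act, SignedPerm.symm]
  ring

theorem Generic.actR {n : ℕ} {x : Fin n → ℝ} (hx : Generic x) (w : SignedPerm n) :
    Generic (actR w x) := by
  intro μ hμ
  rw [← w.symm_symm, ← character_act]
  refine hx _ fun h => hμ (act_injective w.symm ?_)
  rw [h]; funext j; simp [act]

theorem Generic.character_sq_ne {n : ℕ} {x : Fin n → ℝ} (hx : Generic x) {α : Fin n → ℤ}
    (hα : α ≠ 0) : character α x ^ 2 ≠ 1 := by
  rw [sq, ← character_add, ← two_smul ℤ]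
  exact hx _ (smul_ne_zero two_ne_zero hα)

namespace Mirror

variable {n : ℕ} (M : Mirror n)

theorem angle_actR (x : Fin n → ℝ) : M.angle (actR M.w.symm x) = -M.angle x := by
  rw [angle, angle, sum_mul_actR, M.act_root]
  simp [neg_div]

theorem regCot_actR (ε : ℝ) (x : Fin n → ℝ) : M.regCot ε (actR M.w.symm x) = -M.regCot ε x := by
  unfold regCot
  rw [angle_actR, Real.sin_neg, Real.cos_neg, neg_sq]
  split_ifs <;> ring

theorem continuous_regCot {ε : ℝ} (hε : 0 < ε) : Continuous (M.regCot ε) := by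
  have hc : Continuous M.angle := by unfold angle; fun_prop
  unfold regCot
  split_ifs
  · exact ((Real.continuous_sin.comp hc).mul (Real.continuous_cos.comp hc)).div
      (((Real.continuous_sin.comp hc).pow 2).add continuous_const) fun x => (sin_sq_add_pos hε _).ne'
  · exact (((Real.continuous_sin.comp hc).mul (Real.continuous_cos.comp hc)).div
      (((Real.continuous_cos.comp hc).pow 2).add continuous_const)
        fun x => (cos_sq_add_pos hε _).ne').neg

/-- The cut-off factor attached to a mirror. -/
def cutoff (ε : ℝ) (x : Fin n → ℝ) : ℝ :=
  if M.sign = 1 then Real.sin (M.angle x) ^ 2 / (Real.sin (M.angle x) ^ 2 + ε)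
  else Real.cos (M.angle x) ^ 2 / (Real.cos (M.angle x) ^ 2 + ε)

theorem abs_cutoff_le {ε : ℝ} (hε : 0 < ε) (x : Fin n → ℝ) : |M.cutoff ε x| ≤ 1 := by
  have h : ∀ s : ℝ, |s ^ 2 / (s ^ 2 + ε)| ≤ 1 := fun s => by
    rw [abs_of_nonneg (by positivity), div_le_one (by positivity)]; linarith
  unfold cutoff
  split_ifs <;> exact h _

theorem continuous_cutoff {ε : ℝ} (hε : 0 < ε) : Continuous (M.cutoff ε) := by
  have hc : Continuous M.angle := by unfold angle; fun_prop
  unfold cutoff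
  split_ifs
  · exact ((Real.continuous_sin.comp hc).pow 2).div
      (((Real.continuous_sin.comp hc).pow 2).add continuous_const) fun x => (sin_sq_add_pos hε _).ne'
  · exact ((Real.continuous_cos.comp hc).pow 2).div
      (((Real.continuous_cos.comp hc).pow 2).add continuous_const) fun x => (cos_sq_add_pos hε _).ne'

theorem character_root (x : Fin n → ℝ) :
    character M.α x = Complex.exp (Complex.I * M.angle x) ^ 2 := by
  rw [character_eq_exp_ofReal, angle, ← Complex.exp_nat_mul]
  congr 1
  push_cast; ring

theorem exp_angle (x : Fin n → ℝ) : Complex.exp (Complex.I * M.angle x)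
    = Complex.cos (M.angle x) + Complex.sin (M.angle x) * Complex.I := by
  rw [mul_comm, Complex.exp_mul_I]

theorem sin_angle_ne {x : Fin n → ℝ} (hx : Generic x) : Real.sin (M.angle x) ≠ 0 := by
  intro h
  refine hx _ M.root_ne ?_
  have h1 : Complex.sin (M.angle x) = 0 := by rw [← Complex.ofReal_sin, h, Complex.ofReal_zero]
  have h2 := Complex.sin_sq_add_cos_sq (M.angle x : ℂ)
  rw [character_root, exp_angle, h1]
  rw [h1] at h2
  linear_combination h2

theorem cos_angle_ne {x : Fin n → ℝ} (hx : Generic x) : Real.cos (M.angle x) ≠ 0 := by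
  intro h
  refine hx.character_sq_ne M.root_ne ?_
  have h1 : Complex.cos (M.angle x) = 0 := by rw [← Complex.ofReal_cos, h, Complex.ofReal_zero]
  have h2 := Complex.sin_sq_add_cos_sq (M.angle x : ℂ)
  have h3 : Complex.I ^ 2 = -1 := Complex.I_sq
  rw [h1] at h2
  have h4 : Complex.sin (M.angle x) ^ 2 = 1 := by linear_combination h2
  rw [character_root, exp_angle, h1, zero_add, mul_pow, h4, h3]
  norm_num

theorem tendsto_cutoff {x : Fin n → ℝ} (hx : Generic x) :
    Tendsto (fun ε => M.cutoff ε x) (𝓝[>] 0) (𝓝 1) := by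
  have h : ∀ s : ℝ, s ≠ 0 → Tendsto (fun ε : ℝ => s ^ 2 / (s ^ 2 + ε)) (𝓝[>] 0) (𝓝 1) := by
    intro s hs
    have h1 : Tendsto (fun ε : ℝ => s ^ 2 + ε) (𝓝 0) (𝓝 (s ^ 2 + 0)) := tendsto_id.const_add _
    have h2 := (tendsto_const_nhds (x := s ^ 2)).div h1 (by simpa using hs)
    rw [add_zero, div_self (pow_ne_zero 2 hs)] at h2
    exact h2.mono_left nhdsWithin_le_nhds
  unfold cutoff
  split_ifs
  · exact h _ (M.sin_angle_ne hx)
  · exact h _ (M.cos_angle_ne hx)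

/-- Without regularisation this is `cot θ = i (1 + e^{-2iθ}) / (1 - e^{-2iθ})`, or its analogue for
`-tan θ`, with `θ` half the root. The cut-off factor contains the squared sine or cosine, so the
identity persists on the mirrors. -/
theorem regCot_mul_sub {ε : ℝ} (hε : 0 < ε) (μ : Fin n → ℤ) (x : Fin n → ℝ) :
    (M.regCot ε x : ℂ) * (character μ x - character (act M.w μ) x)
      = Complex.I * M.cutoff ε x * ev (M.divMono μ) x := by
  have h := M.ev_divMono_mul μ x
  set δ := character μ x - character (act M.w μ) x
  set D := ev (M.divMono μ) x
  set e := Complex.exp (Complex.I * M.angle x) with he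
  have he0 : e ≠ 0 := Complex.exp_ne_zero _
  rw [M.character_root, ← he] at h
  have hE := M.exp_angle x
  rw [← he, ← Complex.ofReal_cos, ← Complex.ofReal_sin] at hE
  set s := Real.sin (M.angle x) with hs
  set c := Real.cos (M.angle x) with hc
  have hsc : (s : ℂ) ^ 2 + (c : ℂ) ^ 2 = 1 := by exact_mod_cast Real.sin_sq_add_cos_sq (M.angle x)
  have hinv : e⁻¹ = c - s * Complex.I := by
    rw [inv_eq_iff_eq_inv, eq_comm, inv_eq_of_mul_eq_one_left]
    rw [hE]
    linear_combination hsc - (s : ℂ) ^ 2 * Complex.I_sq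
  -- Multiplying by `e^{iθ}` makes both sides symmetric in `e^{±iθ}`, hence multiples of `sin θ` and
  -- `cos θ`.
  have h' : (e - ((M.sign : ℤ) : ℂ) * e⁻¹) * D = (e + ((M.sign : ℤ) : ℂ) * e⁻¹) * δ := by
    have := congrArg (fun t => e * t) h
    simp only [← mul_assoc, mul_sub, mul_add, mul_one] at this
    have h3 : e * ((M.sign : ℤ) : ℂ) * (e ^ 2)⁻¹ = ((M.sign : ℤ) : ℂ) * e⁻¹ := by field_simp
    rwa [h3] at this
  have hs0 : (s : ℂ) ^ 2 + ε ≠ 0 := by exact_mod_cast (sin_sq_add_pos hε _).ne'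
  have hc0 : (c : ℂ) ^ 2 + ε ≠ 0 := by exact_mod_cast (cos_sq_add_pos hε _).ne'
  by_cases h1 : M.sign = 1
  · rw [regCot, cutoff, if_pos h1, if_pos h1, ← hs, ← hc]
    rw [h1, hinv, hE] at h'
    push_cast at h' ⊢
    field_simp
    linear_combination -(s : ℂ) / 2 * h'
  · have h2 : M.sign = -1 := (Int.units_eq_one_or M.sign).resolve_left h1
    rw [regCot, cutoff, if_neg h1, if_neg h1, ← hs, ← hc]
    rw [h2, hinv, hE] at h'
    push_cast at h' ⊢
    field_simp
    linear_combination -(Complex.I * c) / 2 * h' - (s : ℂ) * c * δ * Complex.I_sq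

/-- The weight is invariant and the regularised cotangent is odd under the reflection. Averaging the
integral with its reflected form replaces `e^μ` by half of `e^μ - e^{sμ}`, which yields the divided
difference. -/
theorem integral_regCot_mul (g G₀ G₁ : ℝ) {ε : ℝ} (hε : 0 < ε) (μ : Fin n → ℤ) :
    ∫ x in cube n, (M.regCot ε x : ℂ) * (character μ x * (regWeight g G₀ G₁ ε x : ℝ))
      = Complex.I / 2 * ∫ x in cube n,
        (M.cutoff ε x : ℂ) * ev (M.divMono μ) x * (regWeight g G₀ G₁ ε x : ℝ) := by
  set F : (Fin n → ℝ) → ℂ :=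
    fun x => (M.regCot ε x : ℂ) * (character μ x * (regWeight g G₀ G₁ ε x : ℝ)) with hF
  have hFs : ∀ x, F (actR M.w.symm x)
      = -((M.regCot ε x : ℂ) * (character (act M.w μ) x * (regWeight g G₀ G₁ ε x : ℝ))) := by
    intro x
    simp only [hF, regCot_actR, regWeight_actR, ← character_act]
    push_cast; ring
  have hcont : Continuous F :=
    (Complex.continuous_ofReal.comp (M.continuous_regCot hε)).mul ((continuous_character μ).mul
      (Complex.continuous_ofReal.comp (contDiff_regWeight g G₀ G₁ hε).continuous))
  have hi : Integrable F (volume.restrict (cube n)) := hcont.integrableOn_Icc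
  have hi' : Integrable (fun x => F (actR M.w.symm x)) (volume.restrict (cube n)) := by
    have : Continuous fun x : Fin n → ℝ => actR M.w.symm x := by unfold actR; fun_prop
    exact (hcont.comp this).integrableOn_Icc
  have h1 : ∫ x in cube n, (F x + F (actR M.w.symm x)) = 2 * ∫ x in cube n, F x := by
    rw [integral_add hi hi', integral_actR, two_mul]
  have h2 : ∫ x in cube n, (F x + F (actR M.w.symm x)) = Complex.I * ∫ x in cube n,
      (M.cutoff ε x : ℂ) * ev (M.divMono μ) x * (regWeight g G₀ G₁ ε x : ℝ) := by
    rw [← integral_const_mul]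
    refine integral_congr_ae (Eventually.of_forall fun x => ?_)
    simp only [hFs]
    simp only [hF]
    linear_combination (regWeight g G₀ G₁ ε x : ℂ) * M.regCot_mul_sub hε μ x
  rw [h1] at h2
  linear_combination h2 / 2

end Mirror

variable {m : ℕ}

/-- The Dunkl-type operator without its reflection terms. -/
def divided (g G₀ G₁ : ℝ) : LPoly (m + 1) →ₗ[ℂ] LPoly (m + 1) :=
  derivOp m + (1 / 2 : ℂ) • ∑ i : MirrorIndex m, (multiplicity g G₀ G₁ i : ℂ) • (mirror i).divOp

theorem Mirror.divOp_single {n : ℕ} (M : Mirror n) (μ : Fin n → ℤ) :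
    M.divOp (Finsupp.single μ 1) = M.divMono μ := by
  simp [Mirror.divOp]

theorem ev_divided_single (g G₀ G₁ : ℝ) (μ : Fin (m + 1) → ℤ) (x : Fin (m + 1) → ℝ) :
    ev (divided g G₀ G₁ (Finsupp.single μ 1)) x = μ 0 * character μ x
      + 1 / 2 * ∑ i : MirrorIndex m, (multiplicity g G₀ G₁ i : ℂ) * ev ((mirror i).divMono μ) x := by
  simp only [divided, LinearMap.add_apply, LinearMap.smul_apply, LinearMap.sum_apply, map_add, map_smul,
    map_sum, Mirror.divOp_single, derivOp_single, Pi.add_apply, Pi.smul_apply, Finset.sum_apply,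
    smul_eq_mul, ev_single, one_mul]

theorem integral_cutoff (g G₀ G₁ : ℝ) {ε : ℝ} (hε : 0 < ε) (μ : Fin (m + 1) → ℤ) :
    ∫ x in cube (m + 1), (μ 0 * character μ x + 1 / 2 * ∑ i : MirrorIndex m,
      (multiplicity g G₀ G₁ i : ℂ) * ((mirror i).cutoff ε x * ev ((mirror i).divMono μ) x))
        * (regWeight g G₀ G₁ ε x : ℝ) = 0 := by
  have h := integral_character_mul_regWeight g G₀ G₁ hε μ
  have hw : Continuous fun x : Fin (m + 1) → ℝ => (regWeight g G₀ G₁ ε x : ℂ) :=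
    Complex.continuous_ofReal.comp (contDiff_regWeight g G₀ G₁ hε).continuous
  have hch := (continuous_character μ).mul hw
  have i1 : Integrable (fun x => character μ x * (regWeight g G₀ G₁ ε x : ℂ))
      (volume.restrict (cube (m + 1))) := hch.integrableOn_Icc
  have i2 : ∀ i : MirrorIndex m, Integrable (fun x => ((mirror i).regCot ε x : ℂ)
      * (character μ x * (regWeight g G₀ G₁ ε x : ℂ))) (volume.restrict (cube (m + 1))) := fun i =>
    ((Complex.continuous_ofReal.comp ((mirror i).continuous_regCot hε)).mul hch).integrableOn_Icc
  have i3 : ∀ i : MirrorIndex m, Integrable (fun x => ((mirror i).cutoff ε x : ℂ)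
      * ev ((mirror i).divMono μ) x * (regWeight g G₀ G₁ ε x : ℂ))
      (volume.restrict (cube (m + 1))) := fun i =>
    (((Complex.continuous_ofReal.comp ((mirror i).continuous_cutoff hε)).mul
      (continuous_ev _)).mul hw).integrableOn_Icc
  have e1 : ∀ x : Fin (m + 1) → ℝ, (Complex.I * μ 0
      + ∑ i : MirrorIndex m, (multiplicity g G₀ G₁ i : ℂ) * ((mirror i).regCot ε x : ℝ))
        * (character μ x * (regWeight g G₀ G₁ ε x : ℝ))
      = Complex.I * μ 0 * (character μ x * (regWeight g G₀ G₁ ε x : ℝ))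
        + ∑ i : MirrorIndex m, (multiplicity g G₀ G₁ i : ℂ) * (((mirror i).regCot ε x : ℂ)
          * (character μ x * (regWeight g G₀ G₁ ε x : ℝ))) := fun x => by
    rw [add_mul, Finset.sum_mul]
    simp only [mul_assoc]
  have e2 : ∀ x : Fin (m + 1) → ℝ, (μ 0 * character μ x + 1 / 2 * ∑ i : MirrorIndex m,
      (multiplicity g G₀ G₁ i : ℂ) * ((mirror i).cutoff ε x * ev ((mirror i).divMono μ) x))
        * (regWeight g G₀ G₁ ε x : ℝ)
      = μ 0 * (character μ x * (regWeight g G₀ G₁ ε x : ℝ)) + ∑ i : MirrorIndex m,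
      (1 / 2 * multiplicity g G₀ G₁ i : ℂ) * ((mirror i).cutoff ε x * ev ((mirror i).divMono μ) x
        * (regWeight g G₀ G₁ ε x : ℝ)) := fun x => by
    rw [add_mul, mul_assoc, Finset.mul_sum, Finset.sum_mul]
    congr 1
    exact Finset.sum_congr rfl fun i _ => by ring
  simp only [e1] at h
  simp only [e2]
  rw [integral_add (i1.const_mul _) (integrable_finsetSum _ fun i _ => (i2 i).const_mul _),
    integral_finsetSum _ fun i _ => (i2 i).const_mul _] at h
  rw [integral_add (i1.const_mul _) (integrable_finsetSum _ fun i _ => (i3 i).const_mul _),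
    integral_finsetSum _ fun i _ => (i3 i).const_mul _]
  simp only [integral_const_mul, Mirror.integral_regCot_mul _ g G₀ G₁ hε] at h ⊢
  have hI := Complex.I_ne_zero
  apply mul_left_cancel₀ hI
  rw [mul_zero, ← h, mul_add, Finset.mul_sum]
  congr 1
  · ring
  · exact Finset.sum_congr rfl fun i _ => by ring

/-- Let `ε → 0` in `integral_cutoff`: the cut-offs are bounded by `1` and tend to `1` at generic
points, and the weights are uniformly bounded. -/
theorem integral_divided {g G₀ G₁ : ℝ} (hg : 0 ≤ g) (hG₀ : 0 ≤ G₀) (hG₁ : 0 ≤ G₁)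
    (μ : Fin (m + 1) → ℤ) : ∫ x in cube (m + 1),
      ev (divided g G₀ G₁ (Finsupp.single μ 1)) x * (realJacobi g G₀ G₁ x : ℝ) = 0 := by
  obtain ⟨C, hC⟩ := regWeight_le (n := m + 1) hg hG₀ hG₁
  set B : (Fin (m + 1) → ℝ) → ℝ := fun x => ‖(μ 0 : ℂ)‖ * 1 + ‖(1 / 2 : ℂ)‖ *
    ∑ i : MirrorIndex m, ‖(multiplicity g G₀ G₁ i : ℂ)‖ * ‖ev ((mirror i).divMono μ) x‖ with hB
  have hBc : Continuous B := by
    have := fun i : MirrorIndex m => continuous_ev ((mirror i).divMono μ)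
    fun_prop
  have hlim : Tendsto (fun ε => ∫ x in cube (m + 1), (μ 0 * character μ x
      + 1 / 2 * ∑ i : MirrorIndex m, (multiplicity g G₀ G₁ i : ℂ)
        * ((mirror i).cutoff ε x * ev ((mirror i).divMono μ) x)) * (regWeight g G₀ G₁ ε x : ℝ))
      (𝓝[>] 0) (𝓝 (∫ x in cube (m + 1),
      ev (divided g G₀ G₁ (Finsupp.single μ 1)) x * (realJacobi g G₀ G₁ x : ℝ))) := by
    refine tendsto_integral_filter_of_dominated_convergence (fun x => B x * C) ?_ ?_ ?_ ?_
    · filter_upwards [self_mem_nhdsWithin] with ε hε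
      refine Continuous.aestronglyMeasurable ?_
      have h1 := fun i : MirrorIndex m => continuous_ev ((mirror i).divMono μ)
      have h2 := fun i : MirrorIndex m => (mirror i).continuous_cutoff (Set.mem_Ioi.1 hε)
      have h3 := continuous_character μ
      have h4 := (contDiff_regWeight (n := m + 1) g G₀ G₁ (Set.mem_Ioi.1 hε)).continuous
      fun_prop
    · filter_upwards [Ioo_mem_nhdsGT (zero_lt_one (α := ℝ))] with ε hε
      refine Eventually.of_forall fun x => ?_
      have hw0 : 0 ≤ regWeight g G₀ G₁ ε x := (Real.exp_pos _).le
      rw [norm_mul, Complex.norm_real, Real.norm_of_nonneg hw0]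
      refine mul_le_mul ?_ (hC ε hε.1 hε.2.le x) hw0 (by rw [hB]; positivity)
      refine (norm_add_le _ _).trans (add_le_add ?_ ?_)
      · rw [norm_mul, norm_character]
      · rw [norm_mul]
        refine mul_le_mul_of_nonneg_left ((norm_sum_le _ _).trans (Finset.sum_le_sum fun i _ => ?_))
          (norm_nonneg _)
        rw [norm_mul, norm_mul]
        refine mul_le_mul_of_nonneg_left ?_ (norm_nonneg _)
        refine mul_le_of_le_one_left (norm_nonneg _) ?_
        rw [Complex.norm_real]
        exact (mirror i).abs_cutoff_le hε.1 x
    · exact (hBc.mul continuous_const).integrableOn_Icc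
    · filter_upwards [ae_restrict_of_ae ae_generic] with x hx
      rw [ev_divided_single]
      refine Tendsto.mul (Tendsto.add tendsto_const_nhds (Tendsto.const_mul _ ?_))
        ((Complex.continuous_ofReal.tendsto _).comp (tendsto_regWeight hg hG₀ hG₁ x))
      refine tendsto_finsetSum _ fun i _ => Tendsto.const_mul _ ?_
      have := ((Complex.continuous_ofReal.tendsto _).comp ((mirror i).tendsto_cutoff hx)).mul_const
        (ev ((mirror i).divMono μ) x)
      simpa using this
  refine tendsto_nhds_unique hlim (tendsto_const_nhds.congr' ?_)
  filter_upwards [self_mem_nhdsWithin] with ε hε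
  exact (integral_cutoff g G₀ G₁ hε μ).symm

end Symmetry
end KoornwinderJacobi
end

noncomputable section
namespace KoornwinderJacobi
open Filter Topology MeasureTheory

/-! ### Self-adjointness of the operator for the Jacobi weight -/

section SelfAdjoint

variable {n : ℕ} {v : (Fin n → ℝ) → ℝ}

theorem GoodWeight.form_add_right (hv : GoodWeight v) (f h h' : LPoly n) :
    form v f (h + h') = form v f h + form v f h' := by
  rw [← form_conj, hv.form_add_left, map_add, form_conj, form_conj]

theorem ev_actOp (w : SignedPerm n) (f : LPoly n) (x : Fin n → ℝ) :
    ev (actOp w f) x = ev f (actR w.symm x) := by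
  induction f using Finsupp.induction_linear with
  | zero => simp
  | add f h hf hh => rw [map_add, map_add, map_add, Pi.add_apply, Pi.add_apply, hf, hh]
  | single μ c => rw [actOp_single, ev_single, ev_single, character_act]

theorem form_actOp (hinv : ∀ (w : SignedPerm n) x, v (actR w x) = v x) (w : SignedPerm n)
    (f h : LPoly n) : form v (actOp w f) h = form v f (actOp w.symm h) := by
  rw [form_eq, form_eq, ← integral_actR w]
  refine integral_congr_ae (Eventually.of_forall fun x => ?_)
  simp only [ev_actOp, actR_symm_actR, hinv, SignedPerm.symm_symm]

/-- The commutation defect of an operator on monomials only depends on the difference of the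
exponents. -/
def HasDifferenceDefect (v : (Fin n → ℝ) → ℝ) (K : LPoly n →ₗ[ℂ] LPoly n) : Prop :=
  ∀ μ ν : Fin n → ℤ, form v (K (Finsupp.single μ 1)) (Finsupp.single ν 1)
    - form v (Finsupp.single μ 1) (K (Finsupp.single ν 1))
    = form v (K (Finsupp.single (μ - ν) 1)) (Finsupp.single 0 1)

theorem HasDifferenceDefect.add (hv : GoodWeight v) {K L : LPoly n →ₗ[ℂ] LPoly n}
    (hK : HasDifferenceDefect v K) (hL : HasDifferenceDefect v L) :
    HasDifferenceDefect v (K + L) := by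
  intro μ ν
  simp only [LinearMap.add_apply, hv.form_add_left, hv.form_add_right, ← hK μ ν, ← hL μ ν]
  ring

theorem HasDifferenceDefect.smul {K : LPoly n →ₗ[ℂ] LPoly n} (hK : HasDifferenceDefect v K)
    {c : ℂ} (hc : (starRingEnd ℂ) c = c) : HasDifferenceDefect v (c • K) := by
  intro μ ν
  simp only [LinearMap.smul_apply, form_smul_left, form_smul_right, hc, ← hK μ ν]
  ring

theorem HasDifferenceDefect.sum (hv : GoodWeight v) {ι : Type*} (s : Finset ι)
    {K : ι → LPoly n →ₗ[ℂ] LPoly n} (hK : ∀ i, HasDifferenceDefect v (K i)) :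
    HasDifferenceDefect v (∑ i ∈ s, K i) := by
  intro μ ν
  simp only [LinearMap.sum_apply, hv.form_sum_left, hv.form_sum_right, ← Finset.sum_sub_distrib, hK _ μ ν]

theorem form_single_zero (f : LPoly n) :
    form v f (Finsupp.single 0 1) = ∫ x in cube n, ev f x * v x := by
  rw [form_eq]
  simp only [ev_single, character_zero, mul_one, map_one]

theorem hasDifferenceDefect_derivOp {m : ℕ} (v : (Fin (m + 1) → ℝ) → ℝ) :
    HasDifferenceDefect v (derivOp m) := by
  intro μ ν
  have h : ∀ (μ : Fin (m + 1) → ℤ) (a : ℂ), Finsupp.single μ a = a • Finsupp.single μ (1 : ℂ) :=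
    fun μ a => by simp
  have h1 : form v (Finsupp.single (μ - ν) 1) (Finsupp.single 0 1)
      = form v (Finsupp.single μ 1) (Finsupp.single ν 1) := by
    rw [form_single_zero, form_eq]
    simp only [ev_single, one_mul, conj_character, sub_eq_add_neg, character_add]
  rw [derivOp_single, derivOp_single, derivOp_single, h μ (1 * _), h ν (1 * _), h (μ - ν) (1 * _), form_smul_left,
    form_smul_left, form_smul_right, h1, one_mul, one_mul, one_mul, map_intCast, Pi.sub_apply]
  push_cast; ring

/-- Write the divided difference as `c (1 - s)` with `c` purely imaginary and odd under `s`. The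
integrand of the difference of the two sides is `c` times `e^{μ-ν} - e^{sμ-ν} - e^{μ-sν} +
e^{sμ-sν}`, which is `s`-invariant; so the integrand is odd. -/
theorem hasDifferenceDefect_divOp (hv : GoodWeight v)
    (hinv : ∀ (w : SignedPerm n) x, v (actR w x) = v x) (M : Mirror n) :
    HasDifferenceDefect v M.divOp := by
  intro μ ν
  have hi : Integrable (fun x => ev (M.divOp (Finsupp.single μ 1)) x
      * (starRingEnd ℂ) (ev (Finsupp.single ν 1) x) * v x - ev (Finsupp.single μ 1) x
      * (starRingEnd ℂ) (ev (M.divOp (Finsupp.single ν 1)) x) * v x) (volume.restrict (cube n)) :=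
    (hv.integrable _ _).sub (hv.integrable _ _)
  rw [form_single_zero, form_eq, form_eq, ← integral_sub (hv.integrable _ _) (hv.integrable _ _),
    ← sub_eq_zero, ← integral_sub hi (hv.integrable_mul (continuous_ev _))]
  refine integral_eq_zero_of_odd M.w.symm ?_
  filter_upwards [ae_generic] with x hx
  simp only [M.divOp_single, ev_single, one_mul, hinv]
  have conj_a : ∀ y, (starRingEnd ℂ) (character M.α y) = (character M.α y)⁻¹ := fun y => by
    rw [conj_character, character_neg]
  -- Off the mirrors the denominator `1 - ε e^{-α}` is nonzero, so `c` exists; `|e^α| = 1` gives `c̄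
  -- = -c`.
  have key : ∀ y, Generic y → ∃ c : ℂ, (starRingEnd ℂ) c = -c ∧
      c = (1 + ((M.sign : ℤ) : ℂ) * (character M.α y)⁻¹)
        / (1 - ((M.sign : ℤ) : ℂ) * (character M.α y)⁻¹) ∧
      ∀ κ, ev (M.divMono κ) y = c * (character κ y - character (act M.w κ) y) := by
    intro y hy
    have ha := character_ne_zero M.α y
    have ha2 := hy.character_sq_ne M.root_ne
    have hne : 1 - ((M.sign : ℤ) : ℂ) * (character M.α y)⁻¹ ≠ 0 := by
      intro h
      apply ha2
      have h1 : character M.α y = ((M.sign : ℤ) : ℂ) := by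
        field_simp at h; linear_combination h
      rw [h1]
      rcases Int.units_eq_one_or M.sign with h | h <;> simp [h]
    refine ⟨_, ?_, rfl, fun κ => ?_⟩
    · have hε : ((M.sign : ℤ) : ℂ) * (M.sign : ℤ) = 1 := by
        exact_mod_cast units_mul_self_cast M.sign
      have hne' : 1 - ((M.sign : ℤ) : ℂ) * character M.α y ≠ 0 := by
        intro h
        apply hne
        field_simp
        linear_combination -((M.sign : ℤ) : ℂ) * h - (character M.α y) * hε
      simp only [map_div₀, map_add, map_sub, map_one, map_mul, conj_a, map_intCast, inv_inv,
        map_inv₀]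
      rw [← neg_div, div_eq_div_iff hne' hne]
      field_simp
      linear_combination (-2 * character M.α y) * hε
    · rw [div_mul_eq_mul_div, eq_div_iff hne, mul_comm, M.ev_divMono_mul]
  obtain ⟨c, hc, hc', hcd⟩ := key x hx
  obtain ⟨d, hd, hd', hdd⟩ := key _ (hx.actR M.w.symm)
  have hcd' : d = -c := by
    rw [← hc, hc', hd', ← character_act, M.act_root, character_neg]
    simp only [map_div₀, map_add, map_sub, map_one, map_mul, conj_a, map_intCast, map_inv₀]
  have hsub : ∀ (κ ρ : Fin n → ℤ) y,
      character (κ - ρ) y = character κ y * (starRingEnd ℂ) (character ρ y) := fun κ ρ y => by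
    rw [sub_eq_add_neg, character_add, conj_character]
  simp only [hcd, hdd, hcd', ← character_act, M.act_act, act_sub, hsub, map_mul, map_sub, map_neg, hc]
  ring

theorem form_symm_of_single (hv : GoodWeight v) {K : LPoly n →ₗ[ℂ] LPoly n}
    (h : ∀ μ ν : Fin n → ℤ, form v (K (Finsupp.single μ 1)) (Finsupp.single ν 1)
      = form v (Finsupp.single μ 1) (K (Finsupp.single ν 1))) (f p : LPoly n) :
    form v (K f) p = form v f (K p) := by
  have e : ∀ f : LPoly n, f = ∑ μ ∈ f.support, f μ • Finsupp.single μ (1 : ℂ) := fun f => by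
    conv_lhs => rw [← Finsupp.sum_single f, Finsupp.sum]
    exact Finset.sum_congr rfl fun μ _ => by simp
  rw [e f, e p]
  simp only [map_sum, map_smul, hv.form_sum_left, hv.form_sum_right, form_smul_left, form_smul_right, h]

theorem mirror_actOp_symm (M : Mirror n) : actOp M.w.symm = actOp M.w := by
  ext1 μ
  ext1
  simp only [LinearMap.comp_apply, Finsupp.lsingle_apply, actOp_single]
  congr 1
  rw [← act_symm_act M.w (act M.w μ), M.act_act]

/-- The defect of `divided` is the integral of `divided` applied to one monomial, which vanishes by
integration by parts. The added reflections are symmetric because the weight is invariant. -/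
theorem form_dunkl {m : ℕ} {g G₀ G₁ : ℝ} (hg : 0 ≤ g) (hG₀ : 0 ≤ G₀) (hG₁ : 0 ≤ G₁)
    (f p : LPoly (m + 1)) : form (realJacobi g G₀ G₁) (dunkl g G₀ G₁ f) p
      = form (realJacobi g G₀ G₁) f (dunkl g G₀ G₁ p) := by
  have hv := goodWeight_realJacobi (n := m + 1) hg hG₀ hG₁
  have hinv := realJacobi_actR (n := m + 1) hg hG₀ hG₁
  set v : (Fin (m + 1) → ℝ) → ℝ := realJacobi g G₀ G₁ with hvdef
  have hsplit : dunkl g G₀ G₁ = divided g G₀ G₁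
      + (1 / 2 : ℂ) • ∑ i : MirrorIndex m, (multiplicity g G₀ G₁ i : ℂ) • actOp (mirror i).w := by
    simp only [dunkl, divided, smul_add, Finset.sum_add_distrib, add_assoc]
  have hdiv : ∀ f p, form v (divided g G₀ G₁ f) p = form v f (divided g G₀ G₁ p) := by
    refine form_symm_of_single hv fun μ ν => ?_
    have h1 : HasDifferenceDefect v (divided g G₀ G₁) :=
      (hasDifferenceDefect_derivOp v).add hv ((HasDifferenceDefect.sum hv _ fun i =>
        (hasDifferenceDefect_divOp hv hinv (mirror i)).smul (Complex.conj_ofReal _)).smul (by simp [map_ofNat]))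
    rw [← sub_eq_zero, h1 μ ν, form_single_zero]
    exact integral_divided hg hG₀ hG₁ _
  rw [hsplit]
  simp only [LinearMap.add_apply, LinearMap.smul_apply, LinearMap.sum_apply, hv.form_add_left,
    hv.form_add_right, form_smul_left, form_smul_right, hv.form_sum_left, hv.form_sum_right, hdiv,
    form_actOp hinv, mirror_actOp_symm, Complex.conj_ofReal]
  simp [map_ofNat]

theorem form_dunkl_pow {m : ℕ} {g G₀ G₁ : ℝ} (hg : 0 ≤ g) (hG₀ : 0 ≤ G₀) (hG₁ : 0 ≤ G₁) (k : ℕ)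
    (f p : LPoly (m + 1)) : form (realJacobi g G₀ G₁) ((dunkl g G₀ G₁ ^ k) f) p
      = form (realJacobi g G₀ G₁) f ((dunkl g G₀ G₁ ^ k) p) := by
  induction k generalizing f p with
  | zero => simp
  | succ k ih =>
    rw [pow_succ, Module.End.mul_apply, ih, form_dunkl hg hG₀ hG₁, ← Module.End.mul_apply, ← pow_succ',
      pow_succ]

end SelfAdjoint
end KoornwinderJacobi
end

noncomputable section
namespace KoornwinderJacobi
open Filter Topology MeasureTheory

/-! ### Orthogonality of the Jacobi polynomials -/

section Invariants

variable {n : ℕ}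

/-- Laurent polynomials that are invariant under signed permutations. -/
def IsInvariant (f : LPoly n) : Prop := ∀ (w : SignedPerm n) (ν : Fin n → ℤ), f (act w ν) = f ν

theorem isInvariant_symPoly (μ : Fin n → ℤ) : IsInvariant (symPoly μ) := fun w ν => by
  simp only [symPoly_apply, act_mem_weylOrbit]

theorem IsInvariant.smul {f : LPoly n} (hf : IsInvariant f) (c : ℂ) : IsInvariant (c • f) :=
  fun w ν => by rw [Finsupp.smul_apply, Finsupp.smul_apply, hf]

theorem IsInvariant.add {f h : LPoly n} (hf : IsInvariant f) (hh : IsInvariant h) :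
    IsInvariant (f + h) := fun w ν => by rw [Finsupp.add_apply, Finsupp.add_apply, hf, hh]

theorem IsInvariant.sub {f h : LPoly n} (hf : IsInvariant f) (hh : IsInvariant h) :
    IsInvariant (f - h) := fun w ν => by rw [Finsupp.sub_apply, Finsupp.sub_apply, hf, hh]

theorem IsInvariant.sum {ι : Type*} (s : Finset ι) {F : ι → LPoly n}
    (h : ∀ i, IsInvariant (F i)) : IsInvariant (∑ i ∈ s, F i) := fun w ν => by
  simp only [Finsupp.finsetSum_apply]
  exact Finset.sum_congr rfl fun i _ => h i w ν

theorem isInvariant_monicPoly (lam : Fin n → ℤ) (c : (Fin n → ℤ) → ℂ) :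
    IsInvariant (monicPoly lam c) :=
  (isInvariant_symPoly lam).add (IsInvariant.sum _ fun μ => (isInvariant_symPoly μ).smul _)

theorem IsInvariant.actOp_eq {f : LPoly n} (hf : IsInvariant f) (w : SignedPerm n) :
    actOp w f = f := by
  ext ν
  rw [← act_act_symm w ν, actOp_apply, hf w]

theorem symPoly_mem {lam μ : Fin n → ℤ} (h : InHull lam μ) : symPoly μ ∈ hullSub lam :=
  Submodule.sum_mem _ fun ν hν => by
    obtain ⟨w, rfl⟩ := mem_weylOrbit.1 hν
    exact single_mem_hullSub (h.image w) _

theorem monicPoly_mem {lam : Fin n → ℤ} (hl : IsDominant lam) (c : (Fin n → ℤ) → ℂ) :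
    monicPoly lam c ∈ hullSub lam :=
  Submodule.add_mem _ (symPoly_mem hl.inHull_self) (Submodule.sum_mem _ fun μ hμ =>
    Submodule.smul_mem _ _ (symPoly_mem ((isDominant_of_mem_below hμ).inHull
      ((mem_below lam μ).1 hμ).2.1)))

theorem monicPoly_self {lam : Fin n → ℤ} (hl : IsDominant lam) (c : (Fin n → ℤ) → ℂ) :
    monicPoly lam c lam = 1 := by
  rw [monicPoly, Finsupp.add_apply, hl.symPoly_apply hl, if_pos rfl, Finsupp.finsetSum_apply,
    Finset.sum_eq_zero, add_zero]
  intro μ hμ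
  rw [Finsupp.smul_apply, (isDominant_of_mem_below hμ).symPoly_apply hl,
    if_neg ((mem_below lam μ).1 hμ).2.2.symm, smul_zero]

/-- An invariant polynomial is determined by its coefficients at dominant exponents; in the hull,
these are at most `lam`. -/
theorem IsInvariant.eq_sum_symPoly {lam : Fin n → ℤ} {f : LPoly n} (hf : f ∈ hullSub lam)
    (hinv : IsInvariant f) (h0 : f lam = 0) : f = ∑ μ ∈ below lam, f μ • symPoly μ := by
  ext ν
  obtain ⟨w, hw⟩ := exists_act_isDominant ν
  have hr : IsInvariant (∑ μ ∈ below lam, f μ • symPoly μ) :=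
    IsInvariant.sum _ fun μ => (isInvariant_symPoly μ).smul _
  rw [← hinv w, ← hr w]
  by_cases hb : act w ν ∈ below lam
  · rw [sum_symPoly_apply hb]
  · have h1 : f (act w ν) = 0 := by
      by_contra hne
      exact hb ((mem_below _ _).2 ⟨hw, (inHull_of_mem_support hf hne).domLE,
        fun h => hne (by rw [h, h0])⟩)
    rw [h1, Finsupp.finsetSum_apply]
    refine (Finset.sum_eq_zero fun μ hμ => ?_).symm
    rw [Finsupp.smul_apply, (isDominant_of_mem_below hμ).symPoly_apply hw, if_neg, smul_zero]
    rintro h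
    exact hb (h ▸ hμ)

/-- The sum over all signed permutations. -/
def average : LPoly n →ₗ[ℂ] LPoly n := ∑ w : SignedPerm n, actOp w.symm

theorem average_apply (f : LPoly n) (ν : Fin n → ℤ) :
    average f ν = ∑ w : SignedPerm n, f (act w ν) := by
  rw [average, LinearMap.sum_apply, Finsupp.finsetSum_apply]
  refine Finset.sum_congr rfl fun w _ => ?_
  conv_lhs => rw [← act_symm_act w ν]
  rw [actOp_apply]

theorem isInvariant_average (f : LPoly n) : IsInvariant (average f) := fun v ν => by
  rw [average_apply, average_apply, ← Equiv.sum_comp (compRight v) fun w => f (act w ν)]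
  refine Finset.sum_congr rfl fun w _ => ?_
  rw [← act_comp]; rfl

theorem average_mem {lam : Fin n → ℤ} {f : LPoly n} (hf : f ∈ hullSub lam) :
    average f ∈ hullSub lam := by
  rw [average, LinearMap.sum_apply]
  exact Submodule.sum_mem _ fun w _ => actOp_mem _ hf

theorem form_average_left {v : (Fin n → ℝ) → ℝ} (hv : GoodWeight v)
    (hinv : ∀ (w : SignedPerm n) x, v (actR w x) = v x) (f : LPoly n) {p : LPoly n}
    (hp : IsInvariant p) : form v (average f) p = Fintype.card (SignedPerm n) * form v f p := by
  rw [average, LinearMap.sum_apply, hv.form_sum_left]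
  simp only [form_actOp hinv, hp.actOp_eq, Finset.sum_const, Finset.card_univ, nsmul_eq_mul]

theorem form_average_right {v : (Fin n → ℝ) → ℝ} (hv : GoodWeight v)
    (hinv : ∀ (w : SignedPerm n) x, v (actR w x) = v x) (f : LPoly n) {p : LPoly n}
    (hp : IsInvariant p) : form v p (average f) = Fintype.card (SignedPerm n) * form v p f := by
  rw [← form_conj, form_average_left hv hinv f hp, map_mul, form_conj, map_natCast]

end Invariants

/-! ### Jacobi polynomials as simultaneous eigenvectors of the symmetrised powers -/

section Orthogonality

variable {m : ℕ}

/-- The symmetrised powers of the Dunkl-type operator. -/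
def symmetrised (g G₀ G₁ : ℝ) (k : ℕ) : LPoly (m + 1) →ₗ[ℂ] LPoly (m + 1) :=
  average ∘ₗ (dunkl g G₀ G₁ ^ k)

theorem symmetrised_mem {g G₀ G₁ : ℝ} (k : ℕ) {lam : Fin (m + 1) → ℤ} {f : LPoly (m + 1)}
    (hf : f ∈ hullSub lam) : symmetrised g G₀ G₁ k f ∈ hullSub lam := by
  refine average_mem ?_
  induction k with
  | zero => simpa using hf
  | succ k ih =>
    rw [pow_succ', Module.End.mul_apply]
    exact dunkl_mem ih

theorem form_symmetrised {g G₀ G₁ : ℝ} (hg : 0 ≤ g) (hG₀ : 0 ≤ G₀) (hG₁ : 0 ≤ G₁)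
    (k : ℕ) {f p : LPoly (m + 1)} (hf : IsInvariant f) (hp : IsInvariant p) :
    form (realJacobi g G₀ G₁) (symmetrised g G₀ G₁ k f) p
      = form (realJacobi g G₀ G₁) f (symmetrised g G₀ G₁ k p) := by
  have hv := goodWeight_realJacobi (n := m + 1) hg hG₀ hG₁
  have hinv := realJacobi_actR (n := m + 1) hg hG₀ hG₁
  rw [symmetrised, LinearMap.comp_apply, LinearMap.comp_apply, form_average_left hv hinv _ hp,
    form_average_right hv hinv _ hf, form_dunkl_pow hg hG₀ hG₁]

/-- The remainder after subtracting the leading term is a combination of lower `m_μ`. It is also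
orthogonal to every lower `m_μ`, by symmetry and triangularity, and is therefore zero. -/
theorem symmetrised_monicPoly {g G₀ G₁ : ℝ} (hg : 0 ≤ g) (hG₀ : 0 ≤ G₀) (hG₁ : 0 ≤ G₁)
    (k : ℕ) {lam : Fin (m + 1) → ℤ} (hl : IsDominant lam)
    {c : (Fin (m + 1) → ℤ) → ℂ}
    (hc : ∀ μ ∈ below lam, form (realJacobi g G₀ G₁) (monicPoly lam c) (symPoly μ) = 0) :
    symmetrised g G₀ G₁ k (monicPoly lam c)
      = (eigenvalue g (G₀ + G₁) lam k : ℂ) • monicPoly lam c := by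
  have hv := goodWeight_realJacobi (n := m + 1) hg hG₀ hG₁
  set P := monicPoly lam c with hP
  have hPinv : IsInvariant P := isInvariant_monicPoly lam c
  have hPmem : P ∈ hullSub lam := monicPoly_mem hl c
  have hPu : ∀ w, P (act w lam) = 1 := fun w => by rw [hPinv, hP, monicPoly_self hl]
  set R := symmetrised g G₀ G₁ k P - (eigenvalue g (G₀ + G₁) lam k : ℂ) • P with hR
  have hRinv : IsInvariant R := (isInvariant_average _).sub (hPinv.smul _)
  have hRmem : R ∈ hullSub lam :=
    Submodule.sub_mem _ (symmetrised_mem k hPmem) (Submodule.smul_mem _ _ hPmem)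
  have hP1 : P lam = 1 := monicPoly_self hl c
  have hR0 : R lam = 0 := by
    rw [hR, Finsupp.sub_apply, Finsupp.smul_apply, hP1, symmetrised, LinearMap.comp_apply,
      average_apply]
    simp only [(dunkl_pow_leading hl hPmem hPu k).2, eigenvalue]
    push_cast
    simp
  -- Moving the operator onto `m_μ` stays in the hull of `μ`, where only exponents strictly below
  -- `lam` occur; `P` is orthogonal to all of that.
  have horth : ∀ μ ∈ below lam, ∀ h ∈ hullSub μ, IsInvariant h →
      form (realJacobi g G₀ G₁) P h = 0 := by
    intro μ hμ h hh hi
    obtain ⟨hμd, hμl, hne⟩ := (mem_below lam μ).1 hμ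
    have hmem : h ∈ hullSub lam := fun ν hν => (InHull.mono (hh hν) hμl : InHull lam ν)
    have h0 : h lam = 0 := by
      by_contra hn
      exact hne (DomLE.antisymm hμl (inHull_of_mem_support hh hn).domLE)
    rw [hi.eq_sum_symPoly hmem h0, hv.form_sum_right]
    refine Finset.sum_eq_zero fun ν hν => ?_
    rw [form_smul_right, hc ν hν, mul_zero]
  have hRo : ∀ μ ∈ below lam, form (realJacobi g G₀ G₁) R (symPoly μ) = 0 := by
    intro μ hμ
    rw [hR, hv.form_sub_left, form_smul_left, hc μ hμ,
      form_symmetrised hg hG₀ hG₁ k hPinv (isInvariant_symPoly μ),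
      horth μ hμ _ (symmetrised_mem k (symPoly_mem (isDominant_of_mem_below hμ).inHull_self))
        (isInvariant_average _)]
    simp
  have hRR : form (realJacobi g G₀ G₁) R R = 0 := by
    have h1 : form (realJacobi g G₀ G₁) R (∑ μ ∈ below lam, R μ • symPoly μ) = 0 := by
      rw [hv.form_sum_right]
      refine Finset.sum_eq_zero fun ν hν => ?_
      rw [form_smul_right, hRo ν hν, mul_zero]
    rwa [← hRinv.eq_sum_symPoly hRmem hR0] at h1
  exact sub_eq_zero.1 (hv.eq_zero_of_form_self hRR)

/-- The eigenvalues are real. A nonzero inner product would force those of `lam` and `lam'` to agree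
for every power `k`, contradicting their separation. -/
theorem form_monicPoly_eq_zero {g G₀ G₁ : ℝ} (hg : 0 ≤ g) (hG₀ : 0 ≤ G₀) (hG₁ : 0 ≤ G₁)
    {lam lam' : Fin (m + 1) → ℤ} (hl : IsDominant lam)
    (hl' : IsDominant lam') (hne : lam ≠ lam') {c c' : (Fin (m + 1) → ℤ) → ℂ}
    (hc : ∀ μ ∈ below lam, form (realJacobi g G₀ G₁) (monicPoly lam c) (symPoly μ) = 0)
    (hc' : ∀ μ ∈ below lam', form (realJacobi g G₀ G₁) (monicPoly lam' c') (symPoly μ) = 0) :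
    form (realJacobi g G₀ G₁) (monicPoly lam c) (monicPoly lam' c') = 0 := by
  by_contra h
  refine hne (eq_of_eigenvalue_eq hg (add_nonneg hG₀ hG₁) hl hl' fun k => ?_)
  have h1 := form_symmetrised hg hG₀ hG₁ k (isInvariant_monicPoly lam c)
    (isInvariant_monicPoly lam' c')
  rw [symmetrised_monicPoly hg hG₀ hG₁ k hl hc, symmetrised_monicPoly hg hG₀ hG₁ k hl' hc',
    form_smul_left, form_smul_right, Complex.conj_ofReal] at h1
  exact_mod_cast mul_right_cancel₀ h h1

end Orthogonality

theorem innerW_jacobiPoly_eq_zero {n : ℕ} {g G₀ G₁ : ℝ} (hg : 0 ≤ g) (hG₀ : 0 ≤ G₀) (hG₁ : 0 ≤ G₁)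
    {lam lam' : Fin n → ℤ} (hl : IsDominant lam) (hl' : IsDominant lam') (hne : lam ≠ lam') :
    innerW (jacobiWeight g G₀ G₁) (jacobiPoly g G₀ G₁ lam) (jacobiPoly g G₀ G₁ lam') = 0 := by
  cases n with
  | zero => exact absurd (Subsingleton.elim _ _) hne
  | succ m =>
    have hv := goodWeight_realJacobi (n := m + 1) hg hG₀ hG₁
    have hw : (jacobiWeight g G₀ G₁ : (Fin (m + 1) → ℝ) → ℂ)
        = fun x => (realJacobi g G₀ G₁ x : ℂ) := rfl
    have key : ∀ lam : Fin (m + 1) → ℤ, ∃ c, jacobiPoly g G₀ G₁ lam = ev (monicPoly lam c) ∧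
        ∀ μ ∈ below lam, form (realJacobi g G₀ G₁) (monicPoly lam c) (symPoly μ) = 0 := by
      intro lam
      obtain ⟨⟨c, h1⟩, h2⟩ := hv.isMonicOrthogonal_orthPoly lam
      refine ⟨c, by rw [ev_monicPoly, ← h1, jacobiPoly, hw], fun μ hμ => ?_⟩
      have h3 := (mem_below lam μ).1 hμ
      rw [form, ev_monicPoly, ev_symPoly, ← h1]
      exact h2 μ h3.1 h3.2.1 h3.2.2
    obtain ⟨c, h1, h2⟩ := key lam
    obtain ⟨c', h1', h2'⟩ := key lam'
    rw [h1, h1', hw]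
    exact form_monicPoly_eq_zero hg hG₀ hG₁ hl hl' hne h2 h2'

end KoornwinderJacobi
end

/-! ### The main theorem -/

open KoornwinderJacobi Filter Topology in
theorem mainTheorem9 (n : ℕ) (g g₀ g₁ g₀' g₁' : ℝ) (hg : 0 ≤ g)
    (hg₀ : 0 ≤ g₀) (hg₁ : 0 ≤ g₁) (hg₀' : 0 ≤ g₀') (hg₁' : 0 ≤ g₁') :
    -- the defining conditions determine the Koornwinder and the Jacobi polynomials uniquely
    (∀ β : ℝ, 0 < β → ∀ lam : Fin n → ℤ, IsDominant lam → ∀ p : (Fin n → ℝ) → ℂ,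
      IsMonicOrthogonal (koornwinderWeight β g g₀ g₁ g₀' g₁') lam p ↔
        p = koornwinderPoly β g g₀ g₁ g₀' g₁' lam) ∧
    (∀ lam : Fin n → ℤ, IsDominant lam → ∀ p : (Fin n → ℝ) → ℂ,
      IsMonicOrthogonal (jacobiWeight g (g₀ + g₀') (g₁ + g₁')) lam p ↔
        p = jacobiPoly g (g₀ + g₀') (g₁ + g₁') lam) ∧
    -- convergence, coefficient by coefficient and uniformly
    (∀ lam : Fin n → ℤ, IsDominant lam →
      (∃ (c : ℝ → (Fin n → ℤ) → ℂ) (c₀ : (Fin n → ℤ) → ℂ),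
        (∀ β : ℝ, 0 < β → koornwinderPoly β g g₀ g₁ g₀' g₁' lam = monicSum lam (c β)) ∧
        jacobiPoly g (g₀ + g₀') (g₁ + g₁') lam = monicSum lam c₀ ∧
        ∀ μ ∈ below lam, Tendsto (fun β => c β μ) (𝓝[>] 0) (𝓝 (c₀ μ))) ∧
      TendstoUniformly (fun β : ℝ => koornwinderPoly β g g₀ g₁ g₀' g₁' lam)
        (jacobiPoly g (g₀ + g₀') (g₁ + g₁') lam) (𝓝[>] 0)) ∧
    -- orthogonality of the Jacobi polynomials
    (∀ lam lam' : Fin n → ℤ, IsDominant lam → IsDominant lam' → lam ≠ lam' →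
      innerW (jacobiWeight g (g₀ + g₀') (g₁ + g₁'))
        (jacobiPoly g (g₀ + g₀') (g₁ + g₁') lam)
        (jacobiPoly g (g₀ + g₀') (g₁ + g₁') lam') = 0) := by
  have hG₀ : 0 ≤ g₀ + g₀' := add_nonneg hg₀ hg₀'
  have hG₁ : 0 ≤ g₁ + g₁' := add_nonneg hg₁ hg₁'
  have hJ := goodWeight_realJacobi (n := n) hg hG₀ hG₁
  have hK : ∀ β : ℝ, 0 < β → GoodWeight (realKoornwinder β g g₀ g₁ g₀' g₁' : (Fin n → ℝ) → ℝ) :=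
    fun β hβ => by
      obtain ⟨C, hCb⟩ := realKoornwinder_le (n := n) hg hg₀ hg₁ hg₀' hg₁'
      exact goodWeight_realKoornwinder hβ hg hg₀ hg₁ hg₀' hg₁' ⟨C, hCb β hβ⟩
  refine ⟨fun β hβ lam _ p => ?_, fun lam _ p => hJ.isMonicOrthogonal_iff_eq lam p,
    fun lam _ => ?_, fun lam lam' hl hl' hne => innerW_jacobiPoly_eq_zero hg hG₀ hG₁ hl hl' hne⟩
  · rw [koornwinderPoly, koornwinderWeight_eq hβ]
    exact (hK β hβ).isMonicOrthogonal_iff_eq lam p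
  have hC := limitConst_pos n g (g₀ + g₀') (g₁ + g₁')
  have hL := hJ.const_mul hC
  -- The true limit of the Koornwinder weights; its constant comes from `|1 - e^{iz}| = 2 |sin (z /
  -- 2)|` and is removed by `orthPoly_const_mul`.
  set v₀ : (Fin n → ℝ) → ℝ := fun x => limitConst n g (g₀ + g₀') (g₁ + g₁')
    * realJacobi g (g₀ + g₀') (g₁ + g₁') x with hv₀
  have h1 : ∀ β : ℝ, 0 < β → koornwinderPoly β g g₀ g₁ g₀' g₁' lam
      = monicSum lam (solCoeff (koornwinderWeight β g g₀ g₁ g₀' g₁') lam) := fun β hβ => by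
    rw [koornwinderPoly, koornwinderWeight_eq hβ]
    exact (hK β hβ).orthPoly_eq lam
  have h2 : jacobiPoly g (g₀ + g₀') (g₁ + g₁') lam
      = monicSum lam (solCoeff (fun x => (v₀ x : ℂ)) lam) := by
    rw [← hL.orthPoly_eq, jacobiPoly, ← orthPoly_const_mul (Complex.ofReal_ne_zero.2 hC.ne')]
    congr 1
    funext x
    rw [hv₀, Complex.ofReal_mul]
    rfl
  obtain ⟨C, hCb⟩ := realKoornwinder_le (n := n) hg hg₀ hg₁ hg₀' hg₁'
  have h3 : ∀ μ : Fin n → ℤ, Tendsto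
      (fun β => solCoeff (koornwinderWeight β g g₀ g₁ g₀' g₁') lam μ) (𝓝[>] 0)
      (𝓝 (solCoeff (fun x => (v₀ x : ℂ)) lam μ)) := by
    refine fun μ => hL.tendsto_solCoeff (fun κ ν => ?_) lam μ
    have := tendsto_innerW (l := 𝓝[>] (0 : ℝ))
      (v := fun β => (realKoornwinder β g g₀ g₁ g₀' g₁' : (Fin n → ℝ) → ℝ)) (v₀ := v₀) (C := C)
      (by filter_upwards [self_mem_nhdsWithin] with β hβ using (hK β hβ).measurable)
      (by
        filter_upwards [self_mem_nhdsWithin] with β hβ x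
        rw [abs_of_nonneg ((hK β hβ).nonneg x)]
        exact hCb β hβ x)
      (by
        filter_upwards [ae_generic] with x hx
        exact tendsto_realKoornwinder hg hg₀ hg₁ hg₀' hg₁' hx) (symPoly κ) (symPoly ν)
    simp only [ev_symPoly] at this
    refine this.congr' ?_
    filter_upwards [self_mem_nhdsWithin] with β hβ
    rw [koornwinderWeight_eq hβ]
  refine ⟨⟨_, _, h1, h2, fun μ _ => h3 μ⟩, ?_⟩
  rw [h2]
  -- The formula with `solCoeff` is available for `β > 0` only, which suffices within `𝓝[>] 0`.
  intro U hU
  filter_upwards [self_mem_nhdsWithin, tendstoUniformly_monicSum (fun μ _ => h3 μ) U hU] with β hβ h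
  rw [h1 β hβ]
  exact h
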